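/- **Labeled trees.** We consider locally finite plane rooted trees $T$ (finite or infinite) with integer labels $l$ on the vertices; $(T,l)$ is well-labeled if labels of neighbouring vertices differ by at most $1$. Let $D(\theta,\theta')=(1+\sup\{r\ge 0: B_\theta(r)=B_{\theta'}(r)\})^{-1}$, where $B_\theta(r)$ is the labeled ball of radius $r$ around the root; the topology of $D$ is the local topology. For $x\in\mathbb Z$ let $\mathcal S(x)$ be the set of infinite well-labeled trees with root label $x$ having exactly one spine (infinite line of descent from the root). For such a tree $\theta$ and $i\ge 0$, $S_i(\theta)$ is the label of the $i$-th spine vertex $s_i$ ($s_0$ is the root), and $L_i(\theta)$ (resp. $R_i(\theta)$) is the labeled subtree rooted at $s_i$ formed by $s_i$ and the descendants of its children that lie to the left (resp. right) of $s_{i+1}$. The corners of $\theta$ are listed in clockwise (contour) order as $(c_n)_{n\in\mathbb Z}$, $c_0$ being the root corner, so that the corners $c_n$, $n\ge 0$, visit the left-hand side of the spine. **Galton–Watson trees.** $\mathrm{GW}(x)$ is the law of the Galton–Watson tree with offspring law $\mathbb P(n)=2^{-n-1}$, $n\ge 0$, root label $x$ and independent label increments along the edges, uniform in $\{-1,0,1\}$.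 For $x\ge 1$, $\mathrm{GW}(x)^+$ is $\mathrm{GW}(x)$ conditioned on all labels being positive. **The uniform infinite labeled tree.** $\theta_\infty=(T_\infty,l_\infty)$ is the random element of $\mathcal S(0)$ whose law is characterized by: $(S_i(\theta_\infty))_{i\ge0}$ is a random walk started at $0$ with independent uniform steps in $\{-1,0,1\}$; conditionally on it, the trees $L_i(\theta_\infty)$, $R_i(\theta_\infty)$, $i\ge0$, are independent, with laws $\mathrm{GW}(S_i(\theta_\infty))$. For $k\ge 1$, $\theta_\infty^{(k)}$ is $\theta_\infty$ re-rooted at the first corner with label $-k$ after the root corner, and $\theta_\infty^{(-k+1)}$ is $\theta_\infty$ re-rooted at the last corner with label $-k+1$ before the root corner (the root corner itself if $k=1$), with $k$ added to all labels in both cases. (These corners exist almost surely.) **The Markov chain.** $\tilde X$ is the Markov chain on $\{1,2,\dots\}$ with transition probabilities $$p_x=\mathbb P(x\to x+1)=\frac{(x+4)(2x+5)}{3(x+2)(2x+3)},\quad r_x=\mathbb P(x\to x)=\frac{x(x+3)}{3(x+1)(x+2)},\quad q_x=\mathbb P(x\to x-1)=\frac{(x-1)(2x+1)}{3(x+1)(2x+3)}.$$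 **Theorem.** As $k\to\infty$, the pair $(\theta_\infty^{(k)},\theta_\infty^{(-k+1)})$ converges jointly in distribution, for the local topology, to a pair $(\overrightarrow{\theta}_\infty,\overleftarrow{\theta}_\infty)$ of *independent* random elements of $\mathcal S(0)$ and $\mathcal S(1)$, whose laws exist and are characterized by the following properties. 1. $(S_i(\overrightarrow\theta_\infty))_{i\ge1}$ has the law of $\tilde X$ started from $1$ (and $S_0(\overrightarrow\theta_\infty)=0$). 2. Conditionally on $(S_i(\overrightarrow\theta_\infty))_{i\ge0}$, the trees $L_i(\overrightarrow\theta_\infty)$, $i\ge0$, and $R_i(\overrightarrow\theta_\infty)$, $i\ge1$, are independent, with laws $\mathrm{GW}(S_i(\overrightarrow\theta_\infty))$ and $\mathrm{GW}(S_i(\overrightarrow\theta_\infty))^+$ respectively; $R_0(\overrightarrow\theta_\infty)$ is reduced to a single vertex (with label $0$). 3. Writing $\theta-1$ for the tree $\theta$ with all labels decreased by $1$, the following identity in law holds jointly in all $i\ge 0$ and in the three coordinates: $$\bigl(S_i(\overleftarrow\theta_\infty)-1,\;L_i(\overleftarrow\theta_\infty)-1,\;R_i(\overleftarrow\theta_\infty)-1\bigr)_{i\ge0}\;\overset{(d)}{=}\;\bigl(S_i(\overrightarrow\theta_\infty),\;R_i(\overrightarrow\theta_\infty),\;L_i(\overrightarrow\theta_\infty)\bigr)_{i\ge0}.$$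 -/

import Mathlib

open MeasureTheory ProbabilityTheory Filter Topology
open scoped ENNReal

/-- A locally finite plane rooted tree, finite or infinite, with integer labels on its vertices.
A vertex is the word of the birth ranks on its ancestral line (the root is the empty word,
`u ++ [i]` is the `i`-th child of `u`, children being numbered from `0`, from left to right).
`lab u` is the label of the vertex `u`, and `none` if the word `u` is not a vertex. -/
@[ext]
structure LTree where
  lab : List ℕ → Option ℤ
  root_isSome : (lab []).isSome
  children_isSome : ∀ u, ∃ d : ℕ, ∀ i, (lab (u ++ [i])).isSome ↔ (lab u).isSome ∧ i < d

namespace LTree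

/-- The label of the root. -/
def rootLabel (t : LTree) : ℤ := (t.lab []).getD 0

/-- The number of children of the vertex `u`. -/
noncomputable def deg (t : LTree) (u : List ℕ) : ℕ := sInf {i | t.lab (u ++ [i]) = none}

/-- Neighbouring vertices have labels that differ by at most one. -/
def WellLabeled (t : LTree) : Prop :=
  ∀ u i x y, t.lab u = some x → t.lab (u ++ [i]) = some y → |y - x| ≤ 1

/-- All labels are positive. -/
def Positive (t : LTree) : Prop := ∀ u x, t.lab u = some x → 0 < x

/-! ### The local topology -/

/-- The labeled ball of radius `r` around the root. -/
def ball (r : ℕ) (t : LTree) : List ℕ → Option ℤ := fun u => if u.length ≤ r then t.lab u else none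

/-- `(1 + sup {r | the balls of radius r coincide})⁻¹`, with values in `[0, 1]`. -/
noncomputable def localDist (t t' : LTree) : ℝ≥0∞ :=
  (1 + ⨆ (r : ℕ) (_ : ball r t = ball r t'), (r : ℝ≥0∞))⁻¹

theorem ball_mono {t t' : LTree} {r s : ℕ} (h : r ≤ s) (e : ball s t = ball s t') :
    ball r t = ball r t' := by
  funext u
  by_cases hu : u.length ≤ r
  · have := congrFun e u
    simpa [ball, hu, hu.trans h] using this
  · simp [ball, hu]

theorem localDist_le_one (t t' : LTree) : localDist t t' ≤ 1 := by
  rw [localDist, ENNReal.inv_le_one]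
  exact le_self_add

theorem localDist_self (t : LTree) : localDist t t = 0 := by
  simp [localDist, ENNReal.iSup_natCast]

theorem localDist_comm (t t' : LTree) : localDist t t' = localDist t' t := by
  simp only [localDist, eq_comm]

theorem localDist_ultra (a b c : LTree) :
    localDist a c ≤ max (localDist a b) (localDist b c) := by
  by_contra! h
  rw [max_lt_iff] at h
  obtain ⟨h1, h2⟩ := h
  simp only [localDist, ENNReal.inv_lt_inv] at h1 h2
  replace h1 := lt_of_add_lt_add_left h1
  replace h2 := lt_of_add_lt_add_left h2
  simp only [lt_iSup_iff] at h1 h2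
  obtain ⟨r, hr, h1⟩ := h1
  obtain ⟨s, hs, h2⟩ := h2
  have key : ball (min r s) a = ball (min r s) c :=
    (ball_mono (min_le_left _ _) hr).trans (ball_mono (min_le_right _ _) hs)
  have : ((min r s : ℕ) : ℝ≥0∞) ≤ ⨆ (r : ℕ) (_ : ball r a = ball r c), (r : ℝ≥0∞) :=
    le_iSup₂_of_le (min r s) key le_rfl
  rcases min_choice r s with hm | hm <;> rw [hm] at this
  · exact absurd this (not_le.2 h1)
  · exact absurd this (not_le.2 h2)

theorem eq_of_ball_eq {t t' : LTree} (h : ∀ r, ball r t = ball r t') : t = t' := by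
  ext1
  funext u
  simpa [ball] using congrFun (h u.length) u

theorem eq_of_localDist_eq_zero {t t' : LTree} (h : localDist t t' = 0) : t = t' := by
  refine eq_of_ball_eq fun r => ?_
  rw [localDist, ENNReal.inv_eq_zero] at h
  have h' : (⨆ (s : ℕ) (_ : ball s t = ball s t'), (s : ℝ≥0∞)) = ⊤ := by
    by_contra hne
    exact (ENNReal.add_ne_top.2 ⟨ENNReal.one_ne_top, hne⟩) h
  have : (r : ℝ≥0∞) < ⨆ (s : ℕ) (_ : ball s t = ball s t'), (s : ℝ≥0∞) := by
    rw [h']; exact ENNReal.natCast_lt_top r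
  simp only [lt_iSup_iff] at this
  obtain ⟨s, hs, hrs⟩ := this
  exact ball_mono (by exact_mod_cast hrs.le) hs

theorem localDist_ne_top (t t' : LTree) : localDist t t' ≠ ⊤ :=
  ((localDist_le_one t t').trans_lt ENNReal.one_lt_top).ne

noncomputable instance : MetricSpace LTree where
  dist t t' := (localDist t t').toReal
  dist_self t := by simp [localDist_self]
  dist_comm t t' := by simp [localDist_comm t t']
  dist_triangle a b c := by
    rw [← ENNReal.toReal_add (localDist_ne_top _ _) (localDist_ne_top _ _)]
    refine ENNReal.toReal_mono (ENNReal.add_ne_top.2 ⟨localDist_ne_top _ _, localDist_ne_top _ _⟩)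
      ((localDist_ultra a b c).trans (max_le le_self_add le_add_self))
  eq_of_dist_eq_zero {t t'} h := by
    refine eq_of_localDist_eq_zero ?_
    simpa [ENNReal.toReal_eq_zero_iff, localDist_ne_top] using h

noncomputable instance : MeasurableSpace LTree := borel LTree

instance : BorelSpace LTree := ⟨rfl⟩

theorem finite_length (t : LTree) (n : ℕ) :
    {u : List ℕ | u.length = n ∧ (t.lab u).isSome}.Finite := by
  induction n with
  | zero => exact (Set.finite_singleton []).subset fun u hu => by simpa using hu.1
  | succ n ih =>
    choose d hd using t.children_isSome
    refine (ih.biUnion (t := fun u => (fun i => u ++ [i]) '' Set.Iio (d u))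
      fun u _ => (Set.finite_Iio (d u)).image _).subset ?_
    rintro u ⟨hu, hs⟩
    obtain ⟨v, i, rfl⟩ : ∃ v i, u = v ++ [i] := by
      rcases List.eq_nil_or_concat u with rfl | ⟨v, i, rfl⟩
      · simp at hu
      · exact ⟨v, i, by simp⟩
    have := (hd v i).1 hs
    simp only [Set.mem_iUnion]
    exact ⟨v, ⟨by simpa using hu, this.1⟩, i, this.2, rfl⟩

theorem finite_ball (t : LTree) (r : ℕ) : {u : List ℕ | (ball r t u).isSome}.Finite := by
  refine ((Set.finite_Iic r).biUnion fun n _ => finite_length t n).subset fun u hu => ?_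
  by_cases h : u.length ≤ r
  · simp only [Set.mem_iUnion]
    exact ⟨u.length, h, rfl, by simpa [ball, h] using hu⟩
  · simp [ball, h] at hu

instance : SecondCountableTopology LTree := by
  refine Metric.secondCountable_of_countable_discretization fun ε hε => ?_
  obtain ⟨r, hr⟩ := exists_nat_one_div_lt hε
  refine ⟨Finset (List ℕ × ℤ), inferInstance,
    fun t => (finite_ball t r).toFinset.image fun u => (u, (ball r t u).getD 0), fun t t' h => ?_⟩
  have hb : ball r t = ball r t' := by
    have key : ∀ (t : LTree) u x,
        (u, x) ∈ (finite_ball t r).toFinset.image (fun u => (u, (ball r t u).getD 0)) ↔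
          ball r t u = some x := by
      intro t u x
      simp only [Finset.mem_image, Set.Finite.mem_toFinset, Set.mem_ofPred_eq, Prod.mk.injEq]
      constructor
      · rintro ⟨v, hv, rfl, rfl⟩
        obtain ⟨y, hy⟩ := Option.isSome_iff_exists.1 hv
        simp [hy]
      · intro h
        exact ⟨u, by simp [h], rfl, by simp [h]⟩
    funext u
    refine Option.ext fun x => ?_
    rw [← key t u x, ← key t' u x]
    exact Finset.ext_iff.1 h (u, x)
  have h1 : localDist t t' ≤ (1 + (r : ℝ≥0∞))⁻¹ := by
    rw [localDist, ENNReal.inv_le_inv]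
    gcongr
    exact le_iSup₂_of_le r hb le_rfl
  refine le_trans (ENNReal.toReal_mono (by simp) h1) (le_trans (le_of_eq ?_) hr.le)
  rw [ENNReal.toReal_inv, ENNReal.toReal_add (by simp) (by simp)]
  simp [add_comm]

theorem measurable_of_lab {α : Type*} [MeasurableSpace α] (f : α → LTree)
    (h : ∀ u o, MeasurableSet {a | (f a).lab u = o}) : Measurable f := by
  have hball : ∀ (r : ℕ) (b : LTree), MeasurableSet {a | ball r (f a) = ball r b} := by
    intro r b
    have : {a | ball r (f a) = ball r b} =
        ⋂ u : List ℕ, ⋂ _ : u.length ≤ r, {a | (f a).lab u = b.lab u} := by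
      ext a
      simp only [Set.mem_iInter, Set.mem_ofPred_eq]
      constructor
      · intro e u hu
        simpa [ball, hu] using congrFun e u
      · intro e; funext u
        by_cases hu : u.length ≤ r
        · simp [ball, hu, e u hu]
        · simp [ball, hu]
    rw [this]
    exact MeasurableSet.iInter fun u => MeasurableSet.iInter fun _ => h _ _
  have hdist : ∀ c : LTree, Measurable fun a => localDist (f a) c := by
    intro c
    classical
    have : (fun a => localDist (f a) c) = fun a =>
        (1 + ⨆ r : ℕ, if ball r (f a) = ball r c then (r : ℝ≥0∞) else 0)⁻¹ := by
      funext a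
      rw [localDist]
      congr 3
      funext r
      by_cases e : ball r (f a) = ball r c <;> simp [e]
    rw [this]
    have h1 : Measurable fun a => ⨆ r : ℕ, if ball r (f a) = ball r c then (r : ℝ≥0∞) else 0 :=
      Measurable.iSup fun r => Measurable.ite (hball r c) measurable_const measurable_const
    exact (h1.const_add 1).inv
  have hcb : ∀ (c : LTree) (ε : ℝ), MeasurableSet (f ⁻¹' Metric.ball c ε) := fun c ε => by
    have h1 : Measurable fun a => (localDist (f a) c).toReal := (hdist c).ennreal_toReal
    exact h1 (measurableSet_Iio (a := ε))
  refine measurable_of_isOpen (γ := LTree) fun U hU => ?_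
  have hU' : ∀ t : U, ∃ ε > 0, Metric.ball (t : LTree) ε ⊆ U :=
    fun t => Metric.isOpen_iff.1 hU t t.2
  choose ε hε hs using hU'
  obtain ⟨T, hT, hTU⟩ := TopologicalSpace.isOpen_iUnion_countable (α := LTree)
    (fun t : U => Metric.ball (t : LTree) (ε t)) fun _ => Metric.isOpen_ball
  have : U = ⋃ t ∈ T, Metric.ball (t : LTree) (ε t) := by
    rw [hTU]
    ext t
    simp only [Set.mem_iUnion]
    exact ⟨fun ht => ⟨⟨t, ht⟩, Metric.mem_ball_self (hε _)⟩, fun ⟨s, h⟩ => hs s h⟩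
  rw [this, Set.preimage_iUnion₂]
  exact MeasurableSet.biUnion hT fun t _ => hcb _ _

/-! ### Operations on labeled trees -/

/-- The tree whose root has label `x`, and whose subtrees at the children of the root are,
from left to right, the elements of the list `cs`. -/
def node (x : ℤ) (cs : List LTree) : LTree where
  lab u := match u with
    | [] => some x
    | a :: w => (cs[a]?).bind fun c => c.lab w
  root_isSome := rfl
  children_isSome u := by
    cases u with
    | nil =>
      refine ⟨cs.length, fun i => ?_⟩
      by_cases h : i < cs.length
      · simp [h, (cs[i]).root_isSome]
      · simp [h]
    | cons a w =>
      by_cases h : a < cs.length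
      · simpa [h] using (cs[a]).children_isSome w
      · exact ⟨0, fun i => by simp [h]⟩

/-- The subtree of `t` formed by the vertex `u` and its descendants (if the word `u` is not a
vertex of `t`, a single vertex with label `0`). -/
def subtree (t : LTree) (u : List ℕ) : LTree where
  lab w := match w with
    | [] => some ((t.lab u).getD 0)
    | a :: w' => t.lab (u ++ a :: w')
  root_isSome := rfl
  children_isSome w := by
    cases w with
    | nil =>
      obtain ⟨d, hd⟩ := t.children_isSome u
      by_cases h : (t.lab u).isSome
      · exact ⟨d, fun i => by simpa [h] using hd i⟩
      · exact ⟨0, fun i => by simpa [h] using hd i⟩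
    | cons a w' => simpa using t.children_isSome (u ++ a :: w')

/-- The list of the subtrees at the children of the root, from left to right. -/
noncomputable def children (t : LTree) : List LTree :=
  (List.range (t.deg [])).map fun i => t.subtree [i]

/-- The same tree, with `k` added to all labels. -/
def addLabel (k : ℤ) (t : LTree) : LTree where
  lab u := (t.lab u).map (· + k)
  root_isSome := by simpa using t.root_isSome
  children_isSome u := by simpa using t.children_isSome u

/-! ### Corners and re-rooting

The corners of a tree are indexed by `n ∈ ℤ` in clockwise (contour) order, the corner `c₀` being
the root corner. Re-rooting at a corner `c` of a vertex `v` makes `v` the root, its neighbours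
being ordered clockwise from `c`. -/

/-- The tree re-rooted at the corner `c₁` that follows the root corner in clockwise order: this is
the first corner of the leftmost child of the root, and the old root becomes the last child of this
vertex. -/
noncomputable def nextCorner (t : LTree) : LTree :=
  match t.children with
  | [] => t
  | c :: cs => node c.rootLabel (c.children ++ [node t.rootLabel cs])

/-- The tree re-rooted at the corner `c₋₁` that precedes the root corner in clockwise order: this
is the last corner of the rightmost child of the root, and the old root becomes the first child of
this vertex. -/
noncomputable def prevCorner (t : LTree) : LTree :=
  match t.children.getLast? with
  | none => t
  | some c => node c.rootLabel (node t.rootLabel t.children.dropLast :: c.children)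

/-- The index `n ≥ 0` of the first corner `cₙ` with label `x`, from the root corner on, in clockwise
order. -/
noncomputable def firstCornerAfter (t : LTree) (x : ℤ) : ℕ :=
  sInf {n : ℕ | (nextCorner^[n] t).rootLabel = x}

/-- The index `n ≥ 0` such that `c₋ₙ` is the last corner with label `x`, up to the root corner. -/
noncomputable def lastCornerBefore (t : LTree) (x : ℤ) : ℕ :=
  sInf {n : ℕ | (prevCorner^[n] t).rootLabel = x}

/-- The tree `θ^(k)`: `t` re-rooted at its first corner with label `-k` after the root, with `k`
added to all labels. -/
noncomputable def rerootRight (k : ℕ) (t : LTree) : LTree :=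
  (nextCorner^[t.firstCornerAfter (-k)] t).addLabel k

/-- The tree `θ^(-k+1)`: `t` re-rooted at its last corner with label `-k+1` before the root, with
`k` added to all labels. -/
noncomputable def rerootLeft (k : ℕ) (t : LTree) : LTree :=
  (prevCorner^[t.lastCornerBefore (-k + 1)] t).addLabel k

/-! ### Trees with one spine -/

/-- The word of the `i`-th vertex on the infinite line of descent that follows the `j n`-th child
at generation `n`. -/
def spineWord (j : ℕ → ℕ) (i : ℕ) : List ℕ := (List.range i).map j

/-- The sequence of birth ranks `j` defines a spine of `t`. -/
def IsSpine (t : LTree) (j : ℕ → ℕ) : Prop := ∀ i, (t.lab (spineWord j i)).isSome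

/-- The well-labeled trees with root label `x` that have exactly one spine. -/
def oneSpine (x : ℤ) : Set LTree :=
  {t | t.WellLabeled ∧ t.rootLabel = x ∧ ∃! j, t.IsSpine j}

/-- The birth ranks along the spine of `t`. -/
noncomputable def spine (t : LTree) : ℕ → ℕ := Classical.epsilon t.IsSpine

/-- The subtree at the `i`-th spine vertex. -/
noncomputable def spineSubtree (i : ℕ) (t : LTree) : LTree := t.subtree (spineWord t.spine i)

/-- The label `S_i` of the `i`-th spine vertex. -/
noncomputable def spineLabel (i : ℕ) (t : LTree) : ℤ := (t.spineSubtree i).rootLabel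

/-- The subtree `L_i` to the left of the `i`-th spine vertex. -/
noncomputable def leftTree (i : ℕ) (t : LTree) : LTree :=
  node (t.spineLabel i) ((t.spineSubtree i).children.take (t.spine i))

/-- The subtree `R_i` to the right of the `i`-th spine vertex. -/
noncomputable def rightTree (i : ℕ) (t : LTree) : LTree :=
  node (t.spineLabel i) ((t.spineSubtree i).children.drop (t.spine i + 1))

/-! ### Galton-Watson trees -/

/-- The labels of the tree in which the root has label `x`, a vertex `u` has `(ω u).1` children,
and the label of a vertex `u` other than the root is the one of its parent plus `(ω u).2 - 1`. -/
def gwLab (x : ℤ) (ω : List ℕ → ℕ × Fin 3) : List ℕ → Option ℤ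
  | [] => some x
  | a :: w =>
    if a < (ω []).1 then gwLab (x + (((ω [a]).2 : ℕ) : ℤ) - 1) (fun v => ω (a :: v)) w else none

/-- The tree with labels `gwLab x ω`. -/
def gwTree (x : ℤ) (ω : List ℕ → ℕ × Fin 3) : LTree where
  lab := gwLab x ω
  root_isSome := rfl
  children_isSome u := by
    induction u generalizing x ω with
    | nil => exact ⟨(ω []).1, fun i => by by_cases h : i < (ω []).1 <;> simp [gwLab, h]⟩
    | cons a w ih =>
      by_cases h : a < (ω []).1
      · simpa [gwLab, h] using ih (x + (((ω [a]).2 : ℕ) : ℤ) - 1) fun v => ω (a :: v)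
      · exact ⟨0, fun i => by simp [gwLab, h]⟩

theorem measurable_gwTree (x : ℤ) : Measurable (gwTree x) := by
  refine measurable_of_lab _ fun u o => ?_
  change MeasurableSet {ω | gwLab x ω u = o}
  induction u generalizing x with
  | nil => exact MeasurableSet.const (some x = o)
  | cons a w ih =>
    have h1 : MeasurableSet {ω : List ℕ → ℕ × Fin 3 | a < (ω []).1} :=
      measurableSet_lt measurable_const (measurable_fst.comp (measurable_pi_apply []))
    have h2 : MeasurableSet {ω : List ℕ → ℕ × Fin 3 |
        gwLab (x + (((ω [a]).2 : ℕ) : ℤ) - 1) (fun v => ω (a :: v)) w = o} := by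
      have : {ω : List ℕ → ℕ × Fin 3 |
          gwLab (x + (((ω [a]).2 : ℕ) : ℤ) - 1) (fun v => ω (a :: v)) w = o} =
          ⋃ i : Fin 3, {ω | (ω [a]).2 = i} ∩
            (fun ω v => ω (a :: v)) ⁻¹' {ω | gwLab (x + ((i : ℕ) : ℤ) - 1) ω w = o} := by
        ext ω; simp
      rw [this]
      refine MeasurableSet.iUnion fun i => MeasurableSet.inter ?_ ?_
      · exact (measurable_snd.comp (measurable_pi_apply [a])) (measurableSet_singleton i)
      · exact (measurable_pi_lambda _ fun v => measurable_pi_apply _) (ih _)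
    have : {ω | gwLab x ω (a :: w) = o} =
        ({ω | a < (ω []).1} ∩ {ω : List ℕ → ℕ × Fin 3 |
          gwLab (x + (((ω [a]).2 : ℕ) : ℤ) - 1) (fun v => ω (a :: v)) w = o}) ∪
        ({ω | a < (ω []).1}ᶜ ∩ {_ω | none = o}) := by
      ext ω
      by_cases h : a < (ω []).1 <;> simp [gwLab, h]
    rw [this]
    exact (h1.inter h2).union (h1.compl.inter (MeasurableSet.const _))

/-- The law of the Galton-Watson tree with offspring distribution `Geom(1/2)` on `{0, 1, 2, …}`,
root label `x`, and independent label increments along the edges, uniform in `{-1, 0, 1}`. -/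
noncomputable def gw (x : ℤ) : Measure LTree :=
  (Measure.infinitePi fun _ : List ℕ =>
    (geometricMeasure ⟨1 / 2, by norm_num, by norm_num⟩).prod
      (PMF.uniformOfFintype (Fin 3)).toMeasure).map (gwTree x)

instance (x : ℤ) : IsProbabilityMeasure (gw x) :=
  Measure.isProbabilityMeasure_map (measurable_gwTree x).aemeasurable

/-- The law `gw x` conditioned on all labels being positive. -/
noncomputable def gwPos (x : ℤ) : Measure LTree := (gw x)[|{t | t.Positive}]

end LTree

/-! ### Laws of the infinite trees -/

open LTree

/-- Under `μ`, the process `X` is a Markov chain with transition probabilities `Q`,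
started from `x₀`. -/
def IsMarkovChain {Ω : Type*} [MeasurableSpace Ω] (μ : Measure Ω) (X : ℕ → Ω → ℤ) (x₀ : ℤ)
    (Q : ℤ → ℤ → ℝ≥0∞) : Prop :=
  ∀ (n : ℕ) (s : ℕ → ℤ), μ {ω | ∀ i ≤ n, X i ω = s i} =
    (if s 0 = x₀ then 1 else 0) * ∏ i ∈ Finset.range n, Q (s i) (s (i + 1))

/-- Uniform steps in `{-1, 0, 1}`. -/
noncomputable def uniformStep (x y : ℤ) : ℝ≥0∞ := if |y - x| ≤ 1 then 1 / 3 else 0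

/-- The transition probabilities of the Markov chain `X̃` on the positive integers. -/
noncomputable def besselStep (x y : ℤ) : ℝ≥0∞ :=
  if x ≤ 0 then 0
  else if y = x + 1 then
    ENNReal.ofReal (((x : ℝ) + 4) * (2 * x + 5) / (3 * (x + 2) * (2 * x + 3)))
  else if y = x then
    ENNReal.ofReal ((x : ℝ) * (x + 3) / (3 * (x + 1) * (x + 2)))
  else if y = x - 1 then
    ENNReal.ofReal (((x : ℝ) - 1) * (2 * x + 1) / (3 * (x + 1) * (2 * x + 3)))
  else 0

/-- Under `μ`, conditionally on the spine labels `(S_i)`, the trees `L_i`, `R_i`, `i ≥ 0`, are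
independent, with respective laws `lam i S_i` and `rho i S_i`. -/
def SubtreesGivenSpine (μ : Measure LTree) (lam rho : ℕ → ℤ → Measure LTree) : Prop :=
  ∀ (n : ℕ) (s : ℕ → ℤ) (A B : ℕ → Set LTree),
    (∀ i, MeasurableSet (A i)) → (∀ i, MeasurableSet (B i)) →
    μ {t | ∀ i ≤ n, t.spineLabel i = s i ∧ t.leftTree i ∈ A i ∧ t.rightTree i ∈ B i} =
      μ {t | ∀ i ≤ n, t.spineLabel i = s i} *
        ∏ i ∈ Finset.range (n + 1), lam i (s i) (A i) * rho i (s i) (B i)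

/-- `μ` is the law of the uniform infinite labeled tree `θ_∞`. -/
structure IsUniformInfiniteLaw (μ : Measure LTree) : Prop where
  oneSpine : ∀ᵐ t ∂μ, t ∈ oneSpine 0
  spineLabels : IsMarkovChain μ spineLabel 0 uniformStep
  subtrees : SubtreesGivenSpine μ (fun _ x => gw x) (fun _ x => gw x)

/-- `μ` is the law of the limit tree with positive labels on its right-hand side. The tree `R_0` is
a single vertex, with label `0`. -/
structure IsRightLimitLaw (μ : Measure LTree) : Prop where
  oneSpine : ∀ᵐ t ∂μ, t ∈ oneSpine 0
  spineLabels : IsMarkovChain μ (fun i => spineLabel (i + 1)) 1 besselStep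
  subtrees : SubtreesGivenSpine μ (fun _ x => gw x)
    (fun i x => if i = 0 then Measure.dirac (node 0 []) else gwPos x)

/-- `μ'` is the law of a tree whose left and right subtrees, once the labels are decreased by `1`,
are jointly distributed as the right and left subtrees of a tree with law `μ`. -/
structure IsLeftLimitLaw (μ μ' : Measure LTree) : Prop where
  oneSpine : ∀ᵐ t ∂μ', t ∈ oneSpine 1
  joint_law :
    μ'.map (fun t (i : ℕ) =>
      (t.spineLabel i - 1, (t.leftTree i).addLabel (-1), (t.rightTree i).addLabel (-1))) =
    μ.map (fun t (i : ℕ) => (t.spineLabel i, t.rightTree i, t.leftTree i))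

/-! Add `k` to all labels, so that the spine starts from the label `k` and the target labels no
longer depend on `k`. The clockwise walk from the root corner goes around `L_0, L_1, …`. It crosses
a tree completely as long as its labels are positive, and it stops inside the first `L_i` that is
not positive, at the first vertex `v` of `L_i` with label `0`. Re-rooting at `v` makes the ancestral
line of `v` in `L_i` the beginning of the new spine. What was to the right of this line is now to
its left. What was to its left is positive, since `v` is the first zero, and is now to its right
(`HitDec.exists_reach`, `exists_plug_eq_firstZero_of_hitDec`). The other re-rooting is the same one
in the mirror image, with all labels lowered by one (`rerootLeft_eq`).

The law around `v` is computed exactly. With the geometric offspring law, the parts of a tree on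
both sides of a distinguished child are again Galton-Watson trees (`gw_splitSet`). Let `w(x) =
x(x+3)/((x+1)(x+2))`, the probability that `GW(x)` is positive (`gw_positive`). Prescribe the last
`n + 1` vertices of the ancestral line of `v` with their side trees, and let `u(x)` be the
probability of this event in `GW(x)`. Then `u(x)` equals a source term, carried by the label of the
topmost prescribed vertex, plus `w(x)` times the average of `u` over `x-1, x, x+1`. The homogeneous
equation is solved by `h(x) = x(x+3)(2x+3)`, which vanishes at `0`, and by `1 - w`, which vanishes
at infinity. The Green function is a multiple of `h(min) (1 - w(max))`. Hence, from the label of the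
source on, `u(x)` is exactly proportional to `1 - w(x)`, the probability that `v` exists:
conditionally on its existence, the prescribed event has a probability that does not depend on `x`
(`gw_hitSet`). This probability is the one given by the `h`-transform of the walk weighted by `w`,
which is the chain `X̃` (`besselStep_toReal`, `limitWeight_toReal`).

As `k → ∞`, the first tree that is not positive is attached at a vertex with a high label, on both
sides (`tendsto_lowHit`). Given the spine, the left and right trees are independent. The two sides
share the spine labels, but the conditional probabilities above do not depend on them, so the two
neighbourhoods become independent (`le_liminf_uniformData`). Summing over countably many local
configurations gives the lower bound on open sets that is equivalent to weak convergence
(`prod_le_liminf`).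

The laws themselves are handled through the correspondence between trees with one spine and
sequences of labels and side trees (`eq_map_glue_iff`). -/

namespace LTree

/-! ### Combinatorics and local topology of labeled trees. -/

/-! ### Nodes and children -/

@[simp] theorem lab_node_nil (x : ℤ) (cs : List LTree) : (node x cs).lab [] = some x := rfl

@[simp] theorem lab_node_cons (x : ℤ) (cs : List LTree) (a : ℕ) (w : List ℕ) :
    (node x cs).lab (a :: w) = (cs[a]?).bind fun c => c.lab w := rfl

@[simp] theorem rootLabel_node (x : ℤ) (cs : List LTree) : (node x cs).rootLabel = x := rfl

theorem lab_nil (t : LTree) : t.lab [] = some t.rootLabel := by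
  obtain ⟨x, hx⟩ := Option.isSome_iff_exists.1 t.root_isSome
  simp [rootLabel, hx]

theorem deg_eq_of {t : LTree} {u : List ℕ} {d : ℕ}
    (h : ∀ i, (t.lab (u ++ [i])).isSome ↔ i < d) : t.deg u = d := by
  have : {i | t.lab (u ++ [i]) = none} = Set.Ici d := by
    ext i
    have := h i
    rw [Set.mem_ofPred_eq, Set.mem_Ici, ← Option.not_isSome_iff_eq_none, this, not_lt]
  rw [deg, this, csInf_Ici]

theorem lab_append_isSome (t : LTree) {u : List ℕ} (hu : (t.lab u).isSome) (i : ℕ) :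
    (t.lab (u ++ [i])).isSome ↔ i < t.deg u := by
  obtain ⟨d, hd⟩ := t.children_isSome u
  have h : ∀ i, (t.lab (u ++ [i])).isSome ↔ i < d := fun i => by simp [hd, hu]
  rw [deg_eq_of h, h]

theorem lab_singleton_isSome (t : LTree) (i : ℕ) : (t.lab [i]).isSome ↔ i < t.deg [] :=
  t.lab_append_isSome t.root_isSome i

@[simp] theorem length_children (t : LTree) : t.children.length = t.deg [] := by
  simp [children]

theorem lab_isSome_of_append (t : LTree) (u w : List ℕ) (h : (t.lab (u ++ w)).isSome) :
    (t.lab u).isSome := by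
  induction w using List.reverseRecOn with
  | nil => simpa using h
  | append_singleton w i ih =>
    obtain ⟨d, hd⟩ := t.children_isSome (u ++ w)
    rw [← List.append_assoc] at h
    exact ih ((hd i).1 h).1

theorem lab_subtree (t : LTree) {u : List ℕ} (hu : (t.lab u).isSome) (w : List ℕ) :
    (t.subtree u).lab w = t.lab (u ++ w) := by
  cases w with
  | nil =>
    obtain ⟨x, hx⟩ := Option.isSome_iff_exists.1 hu
    simp [subtree, hx]
  | cons a w => rfl

theorem getElem_children (t : LTree) (i : ℕ) (h : i < t.children.length) :
    t.children[i] = t.subtree [i] := by simp [children]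

theorem node_children (t : LTree) : node t.rootLabel t.children = t := by
  ext1
  funext u
  cases u with
  | nil => simp [lab_nil]
  | cons a w =>
    by_cases h : a < t.deg []
    · have h' := (t.lab_singleton_isSome a).2 h
      rw [lab_node_cons, List.getElem?_eq_getElem (by simpa using h), getElem_children]
      exact lab_subtree t h' w
    · have : ¬ (t.lab (a :: w)).isSome := fun h' =>
        h ((t.lab_singleton_isSome a).1 (t.lab_isSome_of_append [a] w h'))
      rw [lab_node_cons, List.getElem?_eq_none (by simpa using h)]
      simpa using (Option.not_isSome_iff_eq_none.1 this).symm

theorem deg_node (x : ℤ) (cs : List LTree) : (node x cs).deg [] = cs.length := by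
  refine deg_eq_of fun i => ?_
  by_cases h : i < cs.length
  · simp [h, (cs[i]).root_isSome]
  · simp [h]

@[simp] theorem children_node (x : ℤ) (cs : List LTree) : (node x cs).children = cs := by
  refine List.ext_getElem (by simp [deg_node]) fun i h1 h2 => ?_
  ext1
  funext w
  have h : ((node x cs).lab [i]).isSome := by simp [h2, (cs[i]).root_isSome]
  simp [children, lab_subtree _ h, h2]

theorem node_inj {x y : ℤ} {cs ds : List LTree} : node x cs = node y ds ↔ x = y ∧ cs = ds := by
  refine ⟨fun h => ⟨?_, ?_⟩, fun h => by rw [h.1, h.2]⟩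
  · simpa using congrArg rootLabel h
  · simpa using congrArg children h

theorem exists_eq_node (t : LTree) : ∃ x cs, t = node x cs := ⟨_, _, (node_children t).symm⟩

@[simp] theorem addLabel_node (k x : ℤ) (cs : List LTree) :
    (node x cs).addLabel k = node (x + k) (cs.map (addLabel k)) := by
  ext1; funext u
  cases u with
  | nil => rfl
  | cons a w => by_cases h : a < cs.length <;> simp [addLabel, h]

@[simp] theorem addLabel_addLabel (j k : ℤ) (t : LTree) :
    (t.addLabel j).addLabel k = t.addLabel (j + k) := by
  ext1; funext u
  simp [addLabel, Function.comp_def, add_assoc]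

@[simp] theorem addLabel_zero (t : LTree) : t.addLabel 0 = t := by
  ext1; funext u
  simp [addLabel]

@[simp] theorem rootLabel_addLabel (k : ℤ) (t : LTree) :
    (t.addLabel k).rootLabel = t.rootLabel + k := by
  obtain ⟨x, cs, rfl⟩ := t.exists_eq_node
  simp

@[simp] theorem children_addLabel (k : ℤ) (t : LTree) :
    (t.addLabel k).children = t.children.map (addLabel k) := by
  obtain ⟨x, cs, rfl⟩ := t.exists_eq_node
  simp

theorem nextCorner_addLabel (k : ℤ) (t : LTree) :
    (t.addLabel k).nextCorner = t.nextCorner.addLabel k := by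
  obtain ⟨x, cs, rfl⟩ := t.exists_eq_node
  cases cs with
  | nil => simp [nextCorner]
  | cons c cs => simp [nextCorner]

theorem nextCorner_iterate_addLabel (k : ℤ) (n : ℕ) (t : LTree) :
    nextCorner^[n] (t.addLabel k) = (nextCorner^[n] t).addLabel k :=
  (Function.Semiconj.iterate_right (f := addLabel k) (fun t => (nextCorner_addLabel k t).symm)
    n t).symm

/-! ### Positive trees, trees of bounded height -/

theorem positive_node {x : ℤ} {cs : List LTree} :
    (node x cs).Positive ↔ 0 < x ∧ ∀ c ∈ cs, c.Positive := by
  constructor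
  · intro h
    refine ⟨h [] x rfl, fun c hc u y hu => ?_⟩
    obtain ⟨i, hi, rfl⟩ := List.getElem_of_mem hc
    exact h (i :: u) y (by simp [hi, hu])
  · rintro ⟨hx, h⟩ u y hu
    cases u with
    | nil => simp at hu; omega
    | cons a w =>
      by_cases ha : a < cs.length
      · simp [ha] at hu
        exact h _ (List.getElem_mem ha) _ _ hu
      · simp [ha] at hu

/-- All the vertices of `t` are at distance less than `n` from the root. -/
def HeightLT (n : ℕ) (t : LTree) : Prop := ∀ u : List ℕ, n ≤ u.length → t.lab u = none

theorem not_heightLT_zero (t : LTree) : ¬ t.HeightLT 0 := fun h => by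
  simpa [h [] (by simp)] using t.root_isSome

theorem heightLT_succ_node {n : ℕ} {x : ℤ} {cs : List LTree} :
    (node x cs).HeightLT (n + 1) ↔ ∀ c ∈ cs, c.HeightLT n := by
  constructor
  · intro h c hc u hu
    obtain ⟨i, hi, rfl⟩ := List.getElem_of_mem hc
    simpa [hi] using h (i :: u) (by simpa using hu)
  · intro h u hu
    cases u with
    | nil => simp at hu
    | cons a w =>
      by_cases ha : a < cs.length
      · simpa [ha] using h _ (List.getElem_mem ha) w (by simpa using hu)
      · simp [ha]

/-- `t` has bounded height; as it is locally finite, it is finite. -/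
def IsFinite (t : LTree) : Prop := ∃ n, t.HeightLT n

theorem IsFinite.of_mem {x : ℤ} {cs : List LTree} (h : (node x cs).IsFinite) :
    ∀ c ∈ cs, c.IsFinite := by
  obtain ⟨n, hn⟩ := h
  cases n with
  | zero => exact absurd hn (not_heightLT_zero _)
  | succ n => exact fun c hc => ⟨n, heightLT_succ_node.1 hn c hc⟩

theorem IsFinite.addLabel {t : LTree} (k : ℤ) (h : t.IsFinite) : (t.addLabel k).IsFinite := by
  obtain ⟨n, hn⟩ := h
  exact ⟨n, fun u hu => by simp [LTree.addLabel, hn u hu]⟩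

theorem wellLabeled_node {x : ℤ} {cs : List LTree} :
    (node x cs).WellLabeled ↔ ∀ c ∈ cs, |c.rootLabel - x| ≤ 1 ∧ c.WellLabeled := by
  constructor
  · intro h c hc
    obtain ⟨i, hi, rfl⟩ := List.getElem_of_mem hc
    refine ⟨h [] i x _ rfl (by simp [hi, lab_nil]), fun u j y z hy hz => ?_⟩
    exact h (i :: u) j y z (by simp [hi, hy]) (by simpa [hi] using hz)
  · intro h u i y z hy hz
    cases u with
    | nil =>
      by_cases hi : i < cs.length
      · simp [hi, lab_nil] at hy hz
        subst hy hz
        exact (h _ (List.getElem_mem hi)).1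
      · simp [hi] at hz
    | cons a w =>
      by_cases ha : a < cs.length
      · simp [ha] at hy hz
        exact (h _ (List.getElem_mem ha)).2 w i y z hy hz
      · simp [ha] at hy

/-! ### Closeness and the local topology -/

/-- The trees `t` and `t'` coincide at all words of length less than `d`. -/
def Close (d : ℕ) (t t' : LTree) : Prop := ∀ u : List ℕ, u.length < d → t.lab u = t'.lab u

theorem Close.refl (d : ℕ) (t : LTree) : Close d t t := fun _ _ => rfl

theorem Close.symm {d : ℕ} {t t' : LTree} (h : Close d t t') : Close d t' t :=
  fun u hu => (h u hu).symm

theorem Close.trans {d : ℕ} {t t' t'' : LTree} (h : Close d t t') (h' : Close d t' t'') :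
    Close d t t'' := fun u hu => (h u hu).trans (h' u hu)

theorem Close.mono {d e : ℕ} {t t' : LTree} (hde : d ≤ e) (h : Close e t t') : Close d t t' :=
  fun u hu => h u (hu.trans_le hde)

/-- The inequality on lengths is strict, so depth `0` carries no information and inductions on the
depth start for free. -/
theorem close_zero (t t' : LTree) : Close 0 t t' := fun u hu => by simp at hu

theorem close_succ_iff_ball {r : ℕ} {t t' : LTree} :
    Close (r + 1) t t' ↔ ball r t = ball r t' := by
  constructor
  · intro h; funext u
    by_cases hu : u.length ≤ r
    · simp [ball, hu, h u (by omega)]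
    · simp [ball, hu]
  · intro h u hu
    have := congrFun h u
    simpa [ball, show u.length ≤ r by omega] using this

theorem close_one_node {x y : ℤ} {cs ds : List LTree} :
    Close 1 (node x cs) (node y ds) ↔ x = y := by
  constructor
  · intro h; simpa using h [] (by simp)
  · rintro rfl u hu
    have : u = [] := by simpa using hu
    simp [this]

/-- At depth one only the root label is visible. The number of children is visible from depth two
on, whence the shift. -/
theorem close_add_two_node {d : ℕ} {x y : ℤ} {cs ds : List LTree} :
    Close (d + 2) (node x cs) (node y ds) ↔ x = y ∧ List.Forall₂ (Close (d + 1)) cs ds := by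
  constructor
  · intro h
    refine ⟨by simpa using h [] (by simp), ?_⟩
    have hlen : cs.length = ds.length := by
      rw [← deg_node x cs, ← deg_node y ds, deg, deg]
      congr 1; ext i
      simp only [List.nil_append, Set.mem_ofPred_eq, h [i] (by simp)]
    refine List.forall₂_iff_get.2 ⟨hlen, fun i h1 h2 u hu => ?_⟩
    have := h (i :: u) (by simp; omega)
    simpa [h1, h2] using this
  · rintro ⟨rfl, h⟩ u hu
    cases u with
    | nil => rfl
    | cons a w =>
      obtain ⟨hlen, h⟩ := List.forall₂_iff_get.1 h
      by_cases ha : a < cs.length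
      · have ha' : a < ds.length := hlen ▸ ha
        simpa [ha, ha'] using h a ha ha' w (by simp at hu; omega)
      · simp [ha, ← hlen]

theorem close_succ_node {d : ℕ} {x : ℤ} {cs ds : List LTree} (h : List.Forall₂ (Close d) cs ds) :
    Close (d + 1) (node x cs) (node x ds) := by
  cases d with
  | zero => exact close_one_node.2 rfl
  | succ d => exact close_add_two_node.2 ⟨rfl, h⟩

theorem Close.rootLabel_eq {d : ℕ} {t t' : LTree} (h : Close (d + 1) t t') :
    t.rootLabel = t'.rootLabel := by simp [rootLabel, h [] (by simp)]

theorem Close.children {d : ℕ} {t t' : LTree} (h : Close (d + 2) t t') :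
    List.Forall₂ (Close (d + 1)) t.children t'.children := by
  rw [← node_children t, ← node_children t'] at h
  exact (close_add_two_node.1 h).2

theorem eq_of_forall_close {t t' : LTree} (h : ∀ d, Close d t t') : t = t' := by
  ext1; funext u; exact h (u.length + 1) u (by simp)

theorem exists_close_of_dist (t : LTree) (d : ℕ) :
    ∃ ε > 0, ∀ t', dist t' t < ε → Close d t t' := by
  refine ⟨((1 + d : ℝ≥0∞)⁻¹).toReal, ?_, fun t' h => ?_⟩
  · exact ENNReal.toReal_pos (by simp) (by simp)
  · change (localDist t' t).toReal < _ at h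
    rw [ENNReal.toReal_lt_toReal (localDist_ne_top _ _) (by simp), localDist,
      ENNReal.inv_lt_inv] at h
    replace h := lt_of_add_lt_add_left h
    simp only [lt_iSup_iff] at h
    obtain ⟨s, hs, hds⟩ := h
    have hds' : d ≤ s := by exact_mod_cast hds.le
    exact ((close_succ_iff_ball.2 hs).mono (by omega)).symm

theorem Close.dist_le {d : ℕ} {t t' : LTree} (h : Close (d + 1) t t') :
    dist t t' ≤ (1 + (d : ℝ))⁻¹ := by
  have h1 : localDist t t' ≤ (1 + (d : ℝ≥0∞))⁻¹ := by
    rw [localDist, ENNReal.inv_le_inv]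
    gcongr
    exact le_iSup₂_of_le d (close_succ_iff_ball.1 h) le_rfl
  refine (ENNReal.toReal_mono (by simp) h1).trans (le_of_eq ?_)
  rw [ENNReal.toReal_inv, ENNReal.toReal_add (by simp) (by simp)]
  simp

theorem isOpen_of_close {S : Set LTree} (h : ∀ t ∈ S, ∃ d, ∀ t', Close d t t' → t' ∈ S) :
    IsOpen S := by
  refine Metric.isOpen_iff.2 fun t ht => ?_
  obtain ⟨d, hd⟩ := h t ht
  obtain ⟨ε, hε, hε'⟩ := exists_close_of_dist t d
  exact ⟨ε, hε, fun t' ht' => hd t' (hε' t' ht')⟩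

theorem exists_close_of_isOpen {S : Set LTree} (h : IsOpen S) {t : LTree} (ht : t ∈ S) :
    ∃ d, ∀ t', Close d t t' → t' ∈ S := by
  obtain ⟨ε, hε, hs⟩ := Metric.isOpen_iff.1 h t ht
  obtain ⟨r, hr⟩ := exists_nat_one_div_lt hε
  refine ⟨r + 1, fun t' h' => hs ?_⟩
  rw [Metric.mem_ball]
  refine (h'.symm.dist_le).trans_lt ?_
  rwa [add_comm, ← one_div]

theorem continuous_of_close {f : LTree → LTree}
    (h : ∀ t d, ∃ e, ∀ t', Close e t t' → Close d (f t) (f t')) : Continuous f := by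
  refine continuous_def.2 fun U hU => isOpen_of_close fun t ht => ?_
  obtain ⟨d, hd⟩ := exists_close_of_isOpen hU ht
  obtain ⟨e, he⟩ := h t d
  exact ⟨e, fun t' ht' => hd _ (he t' ht')⟩

/-- A property that depends on finitely many generations defines an open set. -/
theorem measurableSet_of_close {S : Set LTree} (d : ℕ)
    (h : ∀ t t', Close d t t' → t ∈ S → t' ∈ S) : MeasurableSet S :=
  (isOpen_of_close fun t ht => ⟨d, fun t' h' => h t t' h' ht⟩).measurableSet

theorem measurableSet_close (d : ℕ) (t : LTree) : MeasurableSet {t' | Close d t' t} :=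
  measurableSet_of_close d fun _ _ h h' => h.symm.trans h'

theorem measurableSet_lab (u : List ℕ) (o : Option ℤ) : MeasurableSet {t : LTree | t.lab u = o} :=
  measurableSet_of_close (u.length + 1) fun t t' h ht => by
    rw [Set.mem_ofPred_eq] at *
    rw [← ht, h u (by simp)]

theorem measurable_of_close {α : Type*} [MeasurableSpace α] [Countable α]
    [MeasurableSingletonClass α] {f : LTree → α} (d : ℕ)
    (h : ∀ t t', Close d t t' → f t = f t') : Measurable f :=
  measurable_to_countable' fun a => measurableSet_of_close d fun t t' hc ht => by
    rw [Set.mem_preimage] at *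
    rwa [← h t t' hc]

theorem measurable_rootLabel : Measurable rootLabel :=
  measurable_of_close 1 fun _ _ h => h.rootLabel_eq

theorem Close.deg_eq {d : ℕ} {t t' : LTree} {u : List ℕ} (h : Close d t t')
    (hu : u.length + 1 < d) : t.deg u = t'.deg u := by
  rw [deg, deg]
  congr 1; ext i
  simp only [Set.mem_ofPred_eq, h (u ++ [i]) (by simpa using hu)]

theorem measurable_deg (u : List ℕ) : Measurable fun t : LTree => t.deg u :=
  measurable_of_close (u.length + 2) fun _ _ h => h.deg_eq (by omega)

theorem Close.subtree {d : ℕ} {t t' : LTree} {u : List ℕ} (h : Close (d + u.length) t t')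
    (_hd : d ≠ 0) : Close d (t.subtree u) (t'.subtree u) := by
  intro w hw
  cases w with
  | nil => simp [LTree.subtree, h u (by omega)]
  | cons a w => exact h (u ++ a :: w) (by simp at *; omega)

theorem continuous_subtree (u : List ℕ) : Continuous fun t : LTree => t.subtree u :=
  continuous_of_close fun _ d => ⟨(d + 1) + u.length, fun _ h =>
    (h.subtree (by omega)).mono (by omega)⟩

theorem Close.addLabel {d : ℕ} {t t' : LTree} (k : ℤ) (h : Close d t t') :
    Close d (t.addLabel k) (t'.addLabel k) := fun u hu => by simp [LTree.addLabel, h u hu]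

theorem continuous_addLabel (k : ℤ) : Continuous (addLabel k) :=
  continuous_of_close fun _ d => ⟨d, fun _ h => h.addLabel k⟩

theorem forall₂_close_refl (d : ℕ) (cs : List LTree) : List.Forall₂ (Close d) cs cs :=
  List.forall₂_same.2 fun c _ => Close.refl d c

theorem continuous_take (a : ℕ) : Continuous fun t : LTree => node t.rootLabel (t.children.take a) :=
  continuous_of_close fun t d => ⟨d + 2, fun t' h => by
    rw [h.rootLabel_eq]
    exact (close_succ_node (List.forall₂_take a h.children)).mono (by omega)⟩

theorem continuous_drop (a : ℕ) : Continuous fun t : LTree => node t.rootLabel (t.children.drop a) :=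
  continuous_of_close fun t d => ⟨d + 2, fun t' h => by
    rw [h.rootLabel_eq]
    exact (close_succ_node (List.forall₂_drop a h.children)).mono (by omega)⟩

theorem continuous_nextCorner : Continuous nextCorner :=
  continuous_of_close fun t d => ⟨d + 3, fun t' h => by
    have h1 := h.children
    have hr : t.rootLabel = t'.rootLabel := h.rootLabel_eq
    rw [nextCorner, nextCorner]
    revert h1
    rcases t.children with _ | ⟨c, cs⟩ <;> rcases t'.children with _ | ⟨c', cs'⟩ <;> intro h1
    · exact h.mono (by omega)
    · cases h1
    · cases h1
    · obtain ⟨hc, hcs⟩ := List.forall₂_cons.1 h1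
      dsimp only
      rw [hr, hc.rootLabel_eq]
      refine Close.mono (Nat.le_succ d) (close_succ_node ?_)
      refine List.rel_append (hc.children.imp fun _ _ h => h.mono (by omega)) ?_
      refine List.Forall₂.cons ((close_succ_node hcs).mono (by omega)) .nil⟩

theorem measurableSet_positive : MeasurableSet {t : LTree | t.Positive} := by
  have : {t : LTree | t.Positive} =
      ⋂ u : List ℕ, ⋂ x : ℤ, {t | t.lab u = some x → 0 < x} := by
    ext t; simp [Positive]
  rw [this]
  refine MeasurableSet.iInter fun u => MeasurableSet.iInter fun x => ?_
  exact measurableSet_of_close (u.length + 1) fun t t' h ht hx => ht (by rw [h u (by simp), hx])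

theorem measurableSet_heightLT (n : ℕ) : MeasurableSet {t : LTree | t.HeightLT n} := by
  have : {t : LTree | t.HeightLT n} = ⋂ u : List ℕ, ⋂ _ : n ≤ u.length, {t | t.lab u = none} := by
    ext t; simp [HeightLT]
  rw [this]
  exact MeasurableSet.iInter fun u => MeasurableSet.iInter fun _ => measurableSet_lab _ _

theorem measurableSet_isFinite : MeasurableSet {t : LTree | t.IsFinite} := by
  have : {t : LTree | t.IsFinite} = ⋃ n, {t | t.HeightLT n} := by
    ext t; simp [IsFinite]
  rw [this]
  exact MeasurableSet.iUnion measurableSet_heightLT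

/-! ### Mirror images -/

/-- The labels of the mirror image. -/
noncomputable def mirrorLab (t : LTree) : List ℕ → Option ℤ
  | [] => t.lab []
  | a :: w => if a < t.deg [] then mirrorLab (t.subtree [t.deg [] - 1 - a]) w else none

/-- The mirror image of `t`. -/
noncomputable def mirror (t : LTree) : LTree where
  lab := t.mirrorLab
  root_isSome := t.root_isSome
  children_isSome u := by
    induction u generalizing t with
    | nil =>
      refine ⟨t.deg [], fun i => ?_⟩
      by_cases h : i < t.deg []
      · simp [mirrorLab, h, t.root_isSome, (t.subtree [t.deg [] - 1 - i]).root_isSome]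
      · simp [mirrorLab, h]
    | cons a w ih =>
      by_cases h : a < t.deg []
      · simpa [mirrorLab, h] using ih (t.subtree [t.deg [] - 1 - a])
      · exact ⟨0, fun i => by simp [mirrorLab, h]⟩

theorem mirror_node (x : ℤ) (cs : List LTree) :
    (node x cs).mirror = node x (cs.map mirror).reverse := by
  ext1; funext u
  cases u with
  | nil => rfl
  | cons a w =>
    change mirrorLab _ _ = _
    by_cases h : a < cs.length
    · have h2 : cs.length - 1 - a < (node x cs).children.length := by simp; omega
      have := getElem_children (node x cs) (cs.length - 1 - a) h2
      simp only [children_node] at this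
      simp [mirrorLab, deg_node, h, ← this]
      rfl
    · simp [mirrorLab, deg_node, h]

@[simp] theorem mirror_mirror (t : LTree) : t.mirror.mirror = t := by
  refine eq_of_forall_close fun d => ?_
  induction d generalizing t with
  | zero => exact close_zero _ _
  | succ d ih =>
    obtain ⟨x, cs, rfl⟩ := t.exists_eq_node
    rw [mirror_node, mirror_node, List.map_reverse, List.reverse_reverse, List.map_map]
    refine close_succ_node (List.forall₂_map_left_iff.2 (List.forall₂_same.2 fun c _ => ih c))

@[simp] theorem rootLabel_mirror (t : LTree) : t.mirror.rootLabel = t.rootLabel := rfl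

theorem children_mirror (t : LTree) : t.mirror.children = (t.children.map mirror).reverse := by
  obtain ⟨x, cs, rfl⟩ := t.exists_eq_node
  simp [mirror_node]

theorem Close.mirror {d : ℕ} {t t' : LTree} (h : Close d t t') : Close d t.mirror t'.mirror := by
  induction d generalizing t t' with
  | zero => exact close_zero _ _
  | succ d ih =>
    obtain ⟨x, cs, rfl⟩ := t.exists_eq_node
    obtain ⟨y, ds, rfl⟩ := t'.exists_eq_node
    rw [mirror_node, mirror_node]
    cases d with
    | zero => exact close_one_node.2 (close_one_node.1 h)
    | succ d =>
      obtain ⟨hx, h⟩ := close_add_two_node.1 h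
      refine close_add_two_node.2 ⟨hx, List.rel_reverse ?_⟩
      rw [List.forall₂_map_left_iff, List.forall₂_map_right_iff]
      exact h.imp fun _ _ h => ih h

theorem continuous_mirror : Continuous mirror :=
  continuous_of_close fun _ d => ⟨d, fun _ h => h.mirror⟩

theorem mirror_addLabel (k : ℤ) (t : LTree) : (t.addLabel k).mirror = t.mirror.addLabel k := by
  refine eq_of_forall_close fun d => ?_
  induction d generalizing t with
  | zero => exact close_zero _ _
  | succ d ih =>
    obtain ⟨x, cs, rfl⟩ := t.exists_eq_node
    rw [addLabel_node, mirror_node, mirror_node, addLabel_node, List.map_reverse, List.map_map,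
      List.map_map]
    refine close_succ_node (List.rel_reverse ?_)
    rw [List.forall₂_map_left_iff, List.forall₂_map_right_iff]
    exact List.forall₂_same.2 fun c _ => ih c

/-- A reflection exchanges the two senses of rotation. Corners before the root thus need no separate
study. -/
theorem prevCorner_eq (t : LTree) : t.prevCorner = t.mirror.nextCorner.mirror := by
  obtain ⟨x, cs, rfl⟩ := t.exists_eq_node
  rw [prevCorner, nextCorner, children_mirror]
  simp only [children_node]
  rcases List.eq_nil_or_concat cs with rfl | ⟨cs, c, rfl⟩
  · simp
  · simp [mirror_node, children_mirror, Function.comp_def]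

theorem prevCorner_iterate (n : ℕ) (t : LTree) :
    prevCorner^[n] t = (nextCorner^[n] t.mirror).mirror := by
  induction n generalizing t with
  | zero => simp
  | succ n ih => rw [Function.iterate_succ_apply, ih, Function.iterate_succ_apply, prevCorner_eq,
      mirror_mirror]

/-- `t` re-rooted at its first corner with label `0`. -/
noncomputable def firstZero (t : LTree) : LTree := nextCorner^[t.firstCornerAfter 0] t

/-- Translating the labels beforehand makes the re-rooting map independent of `k`; only the law of
the tree depends on `k` afterwards. -/
theorem rerootRight_eq (k : ℕ) (t : LTree) : t.rerootRight k = (t.addLabel k).firstZero := by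
  have : (t.addLabel k).firstCornerAfter 0 = t.firstCornerAfter (-k) := by
    rw [firstCornerAfter, firstCornerAfter]
    congr 1; ext n
    simp only [Set.mem_ofPred_eq, nextCorner_iterate_addLabel, rootLabel_addLabel]
    omega
  rw [firstZero, this, nextCorner_iterate_addLabel, rerootRight]

theorem measurable_firstZero : Measurable firstZero := by
  have h1 : ∀ n, Measurable fun t : LTree => nextCorner^[n] t := fun n =>
    (continuous_nextCorner.iterate n).measurable
  have h2 : ∀ n, MeasurableSet {t : LTree | (nextCorner^[n] t).rootLabel = 0} := fun n =>
    (measurable_rootLabel.comp (h1 n)) (measurableSet_singleton 0)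
  have h3 : Measurable fun t : LTree => t.firstCornerAfter 0 := by
    refine measurable_to_countable' fun n => ?_
    -- The second alternative accounts for `sInf ∅ = 0`, when no corner has label `0`.
    have : (fun t : LTree => t.firstCornerAfter 0) ⁻¹' {n} =
        {t | ((nextCorner^[n] t).rootLabel = 0 ∧ ∀ m < n, (nextCorner^[m] t).rootLabel ≠ 0) ∨
          (n = 0 ∧ ∀ m, (nextCorner^[m] t).rootLabel ≠ 0)} := by
      ext t
      rw [Set.mem_preimage, Set.mem_singleton_iff, Set.mem_ofPred_eq, firstCornerAfter]
      constructor
      · rintro rfl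
        by_cases h : {n | (nextCorner^[n] t).rootLabel = 0}.Nonempty
        · exact .inl ⟨Nat.sInf_mem h, fun m hm => Nat.notMem_of_lt_sInf hm⟩
        · rw [Set.not_nonempty_iff_eq_empty] at h
          exact .inr ⟨by simp [h], fun m hm => by
            have : m ∈ (∅ : Set ℕ) := h ▸ hm
            exact this⟩
      · rintro (⟨h, h'⟩ | ⟨rfl, h⟩)
        · exact le_antisymm (Nat.sInf_le h) (le_csInf ⟨n, h⟩ fun m hm =>
            not_lt.1 fun hlt => h' m hlt hm)
        · simp [h]
    rw [this]
    refine ((h2 n).inter ?_).union ((MeasurableSet.const _).inter ?_)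
    · have : {t : LTree | ∀ m < n, (nextCorner^[m] t).rootLabel ≠ 0} =
          ⋂ m : ℕ, ⋂ _ : m < n, {t : LTree | (nextCorner^[m] t).rootLabel = 0}ᶜ := by
        ext t; simp
      exact (congrArg MeasurableSet this).mpr <|
        MeasurableSet.iInter fun m => MeasurableSet.iInter fun _ => (h2 m).compl
    · have : {t : LTree | ∀ m, (nextCorner^[m] t).rootLabel ≠ 0} =
          ⋂ m : ℕ, {t : LTree | (nextCorner^[m] t).rootLabel = 0}ᶜ := by
        ext t; simp
      exact (congrArg MeasurableSet this).mpr <| MeasurableSet.iInter fun m => (h2 m).compl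
  have : Measurable fun p : LTree × ℕ => nextCorner^[p.2] p.1 :=
    measurable_from_prod_countable_left fun n => h1 n
  exact this.comp (measurable_id.prodMk h3)

/-! ### The contour walk up to the first zero, and the shape of the re-rooted tree. -/

/-! ### Walking around a tree until the first corner with label `0` -/

/-- Walking clockwise from the root corner of `t` along corners with nonzero labels, one arrives at
a corner such that `t` re-rooted there is `t'`. -/
def Reach (t t' : LTree) : Prop :=
  ∃ n, nextCorner^[n] t = t' ∧ ∀ m < n, (nextCorner^[m] t).rootLabel ≠ 0

theorem Reach.refl (t : LTree) : Reach t t := ⟨0, rfl, fun _ h => by omega⟩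

theorem Reach.trans {a b c : LTree} (hab : Reach a b) (hbc : Reach b c) : Reach a c := by
  obtain ⟨m, rfl, hm⟩ := hab
  obtain ⟨n, rfl, hn⟩ := hbc
  refine ⟨n + m, Function.iterate_add_apply _ _ _ _, fun j hj => ?_⟩
  by_cases h : j < m
  · exact hm j h
  · obtain ⟨i, rfl⟩ := Nat.exists_eq_add_of_le (not_lt.1 h)
    rw [add_comm, Function.iterate_add_apply]
    exact hn i (by omega)

theorem reach_nextCorner {t : LTree} (h : t.rootLabel ≠ 0) : Reach t t.nextCorner :=
  ⟨1, rfl, fun m hm => by obtain rfl : m = 0 := by omega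
                          exact h⟩

theorem reach_node_cons {x y : ℤ} (hx : x ≠ 0) (ds cs : List LTree) :
    Reach (node x (node y ds :: cs)) (node y (ds ++ [node x cs])) := by
  simpa [nextCorner] using reach_nextCorner (t := node x (node y ds :: cs)) hx

theorem Reach.firstZero_eq {t t' : LTree} (h : Reach t t') (h0 : t'.rootLabel = 0) :
    t.firstZero = t' := by
  obtain ⟨n, rfl, hn⟩ := h
  have : t.firstCornerAfter 0 = n :=
    le_antisymm (Nat.sInf_le h0) (le_csInf ⟨n, h0⟩ fun m hm => not_lt.1 fun hlt => hn m hlt hm)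
  rw [firstZero, this]

theorem reach_append_of_forall {x : ℤ} {ds : List LTree}
    (h : ∀ d ∈ ds, ∀ cs, Reach (node x (d :: cs)) (node x (cs ++ [d]))) (cs : List LTree) :
    Reach (node x (ds ++ cs)) (node x (cs ++ ds)) := by
  induction ds generalizing cs with
  | nil => simpa using Reach.refl _
  | cons d ds ih =>
    have := ih (fun d hd => h d (by simp [hd])) (cs ++ [d])
    simp only [List.append_assoc, List.singleton_append] at this
    refine Reach.trans ?_ this
    have := h d (by simp) (ds ++ cs)
    simpa using this

/-- A complete tour of the subtree `c`: enter it, rotate its own children one after the other by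
induction, and come back. Finiteness ensures the return, positivity that no zero is met. -/
theorem reach_rotate {n : ℕ} {c : LTree} (hc : c.HeightLT n) (hp : c.Positive) {x : ℤ}
    (hx : x ≠ 0) (cs : List LTree) : Reach (node x (c :: cs)) (node x (cs ++ [c])) := by
  induction n generalizing c x cs with
  | zero => exact absurd hc (not_heightLT_zero c)
  | succ n ih =>
    obtain ⟨y, ds, rfl⟩ := c.exists_eq_node
    rw [positive_node] at hp
    rw [heightLT_succ_node] at hc
    refine (reach_node_cons hx ds cs).trans ?_
    refine (reach_append_of_forall (fun d hd cs => ih (hc d hd) (hp.2 d hd) hp.1.ne' cs) _).trans ?_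
    exact reach_node_cons hp.1.ne' cs ds

theorem reach_append {x : ℤ} (hx : x ≠ 0) {ds : List LTree}
    (h : ∀ d ∈ ds, d.IsFinite ∧ d.Positive) (cs : List LTree) :
    Reach (node x (ds ++ cs)) (node x (cs ++ ds)) :=
  reach_append_of_forall (fun d hd cs => by
    obtain ⟨⟨n, hn⟩, hp⟩ := h d hd
    exact reach_rotate hn hp hx cs) cs

/-- `HitDec t l` holds if `t` has a first vertex `v` with label `0` in clockwise order, preceded by
vertices with positive labels, and if `l` lists, for the vertices from the root of `t` to `v`, the
label, the subtree on the right and the subtree on the left of the ancestral line of `v`. -/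
inductive HitDec : LTree → List (ℤ × LTree × LTree) → Prop
  | root (t : LTree) (h : t.rootLabel = 0) : HitDec t [(0, t, node 0 [])]
  | child (x : ℤ) (bs : List LTree) (c : LTree) (cs : List LTree) (l : List (ℤ × LTree × LTree))
      (hx : 0 < x) (hb : ∀ b ∈ bs, b.Positive) (hc : HitDec c l) :
      HitDec (node x (bs ++ c :: cs)) ((x, node x cs, node x bs) :: l)

theorem HitDec.not_positive {t : LTree} {l : List (ℤ × LTree × LTree)} (h : HitDec t l) :
    ¬ t.Positive := by
  induction h with
  | root t h =>
    obtain ⟨x, cs, rfl⟩ := t.exists_eq_node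
    intro hp
    exact absurd (positive_node.1 hp).1 (by simpa using h.le)
  | child x bs c cs l hx hb hc ih => exact fun hp => ih ((positive_node.1 hp).2 c (by simp))

/-- In both decompositions the distinguished element is the first one of the list that is not
positive. -/
theorem append_cons_inj_of_positive {bs cs bs' cs' : List LTree} {c c' : LTree}
    (h : bs ++ c :: cs = bs' ++ c' :: cs') (hb : ∀ b ∈ bs, b.Positive)
    (hb' : ∀ b ∈ bs', b.Positive) (hc : ¬ c.Positive) (hc' : ¬ c'.Positive) :
    bs = bs' ∧ c = c' ∧ cs = cs' := by
  induction bs generalizing bs' with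
  | nil =>
    cases bs' with
    | nil => simpa using h
    | cons b' bs' =>
      simp only [List.nil_append, List.cons_append, List.cons.injEq] at h
      exact absurd (hb' b' (by simp)) (h.1 ▸ hc)
  | cons b bs ih =>
    cases bs' with
    | nil =>
      simp only [List.nil_append, List.cons_append, List.cons.injEq] at h
      exact absurd (hb b (by simp)) (h.1 ▸ hc')
    | cons b' bs' =>
      simp only [List.cons_append, List.cons.injEq] at h
      obtain ⟨h1, h2⟩ := ih h.2 (fun b hb' => hb b (by simp [hb']))
        (fun b hb => hb' b (by simp [hb]))
      exact ⟨by rw [h.1, h1], h2⟩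

theorem HitDec.unique {t : LTree} {l l' : List (ℤ × LTree × LTree)} (h : HitDec t l)
    (h' : HitDec t l') : l = l' := by
  induction h generalizing l' with
  | root t h =>
    cases h' with
    | root _ => rfl
    | child x bs c cs l hx hb hc => exact absurd h hx.ne'
  | child x bs c cs l hx hb hc ih =>
    generalize ht : node x (bs ++ c :: cs) = t at h'
    cases h' with
    | root _ h => rw [← ht] at h; exact absurd h hx.ne'
    | child x' bs' c' cs' l' hx' hb' hc' =>
      obtain ⟨rfl, h2⟩ := node_inj.1 ht
      obtain ⟨rfl, rfl, rfl⟩ := append_cons_inj_of_positive h2 hb hb' hc.not_positive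
        hc'.not_positive
      rw [ih hc']

/-- The tree whose root has the label of `d`, and whose children are those of the left tree of `d`,
followed by the trees of the list `Qs`, followed by those of the right tree of `d`. -/
noncomputable def plugNode (d : ℤ × LTree × LTree) (Qs : List LTree) : LTree :=
  node d.1 (d.2.1.children ++ Qs ++ d.2.2.children)

/-- The tree with left and right subtrees listed by `l` along an ancestral line, the last element
of `l` being at the root, with the trees `Qs` at the tip of the line. -/
noncomputable def plug (l : List (ℤ × LTree × LTree)) (Qs : List LTree) : List LTree :=
  l.foldl (fun Qs d => [plugNode d Qs]) Qs

@[simp] theorem plug_nil (Qs : List LTree) : plug [] Qs = Qs := rfl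

@[simp] theorem plug_cons (d : ℤ × LTree × LTree) (l : List (ℤ × LTree × LTree))
    (Qs : List LTree) : plug (d :: l) Qs = plug l [plugNode d Qs] := rfl

theorem plug_append (l l' : List (ℤ × LTree × LTree)) (Qs : List LTree) :
    plug (l ++ l') Qs = plug l' (plug l Qs) := by simp [plug]

/-- At a vertex of the ancestral line, the walk tours the positive subtrees on the left, which
rotates them behind the others, and then enters the child on the line. The vertex left behind
becomes the last child of that child, with its right part first, then `Qs`, then its left part: this
is one step of `plug`. -/
theorem HitDec.exists_reach {t : LTree} {l : List (ℤ × LTree × LTree)} (h : HitDec t l)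
    (hf : t.IsFinite) (Qs : List LTree) : ∃ t', plug l Qs = [t'] ∧ t'.rootLabel = 0 ∧
      Reach (node t.rootLabel (t.children ++ Qs)) t' := by
  induction h generalizing Qs with
  | root t h => exact ⟨_, rfl, rfl, by simpa [plugNode, h] using Reach.refl _⟩
  | child x bs c cs l hx hb hc ih =>
    have hf' := hf.of_mem
    obtain ⟨t', h1, h2, h3⟩ := ih (hf' c (by simp)) [plugNode (x, node x cs, node x bs) Qs]
    refine ⟨t', h1, h2, ?_⟩
    have e1 : Reach (node x (bs ++ (c :: cs ++ Qs))) (node x (c :: cs ++ Qs ++ bs)) :=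
      reach_append hx.ne' (fun d hd => ⟨hf' d (by simp [hd]), hb d hd⟩) _
    have e2 := reach_node_cons (y := c.rootLabel) hx.ne' c.children (cs ++ Qs ++ bs)
    rw [node_children] at e2
    simp only [plugNode, children_node] at h3
    simp only [rootLabel_node, children_node, List.append_assoc, List.cons_append] at e1 e2 h3 ⊢
    exact (e1.trans e2).trans h3

/-- The tip `Qs` gathers all that lies outside `L i`. It is left unspecified, because only the
beginning of the new spine matters in the limit. -/
theorem exists_plug_eq_firstZero_of_hitDec {P : ℕ → LTree} {s : ℕ → ℤ} {L R : ℕ → LTree}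
    (hP : ∀ i, P i = node (s i) ((L i).children ++ P (i + 1) :: (R i).children))
    (hs : ∀ i, (L i).rootLabel = s i) {i : ℕ} {l : List (ℤ × LTree × LTree)}
    (hf : ∀ j, (L j).IsFinite) (hpos : ∀ j < i, (L j).Positive) (h : HitDec (L i) l) :
    ∃ Qs, plug l Qs = [(P 0).firstZero] := by
  -- The induction needs extra children `Es` at the end: when the walk moves to the next spine
  -- vertex, the part of the tree left behind hangs from it as its last child.
  suffices H : ∀ Es, ∃ Qs t', plug l Qs = [t'] ∧ t'.rootLabel = 0 ∧
      Reach (node (s 0) ((L 0).children ++ P 1 :: (R 0).children ++ Es)) t' by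
    obtain ⟨Qs, t', h1, h2, h3⟩ := H []
    rw [List.append_nil, ← hP 0] at h3
    exact ⟨Qs, by rw [h3.firstZero_eq h2, h1]⟩
  induction i generalizing P s L R with
  | zero =>
    intro Es
    obtain ⟨t', h1, h2, h3⟩ := h.exists_reach (hf 0) (P 1 :: (R 0).children ++ Es)
    exact ⟨_, t', h1, h2, by simpa [hs] using h3⟩
  | succ i ih =>
    intro Es
    have h0 := hpos 0 (by omega)
    rw [← node_children (L 0), positive_node, hs] at h0
    have hf0 := hf 0
    rw [← node_children (L 0)] at hf0
    obtain ⟨Qs, t', h1, h2, h3⟩ := ih (P := fun i => P (i + 1)) (s := fun i => s (i + 1))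
      (L := fun i => L (i + 1)) (R := fun i => R (i + 1)) (fun i => hP (i + 1))
      (fun i => hs (i + 1)) (fun i => hf (i + 1)) (fun j hj => hpos (j + 1) (by omega)) h
      [node (s 0) ((R 0).children ++ Es ++ (L 0).children)]
    refine ⟨Qs, t', h1, h2, ?_⟩
    have e1 : Reach (node (s 0) ((L 0).children ++ (P 1 :: (R 0).children ++ Es)))
        (node (s 0) (P 1 :: (R 0).children ++ Es ++ (L 0).children)) :=
      reach_append h0.1.ne' (fun d hd => ⟨hf0.of_mem d hd, h0.2 d hd⟩) _
    have e2 := reach_node_cons (y := s 1) h0.1.ne'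
      ((L 1).children ++ P 2 :: (R 1).children) ((R 0).children ++ Es ++ (L 0).children)
    rw [← hP 1] at e2
    simp only [List.append_assoc, List.cons_append] at e1 e2 h3 ⊢
    exact (e1.trans e2).trans h3

/-! ### Comparison of trees along ancestral lines -/

/-- The list `f n, …, f 0`. -/
def revList {α : Type*} (f : ℕ → α) : ℕ → List α
  | 0 => [f 0]
  | n + 1 => f (n + 1) :: revList f n

theorem length_revList {α : Type*} (f : ℕ → α) (n : ℕ) : (revList f n).length = n + 1 := by
  induction n with
  | zero => rfl
  | succ n ih => simp [revList, ih]

theorem forall₂_revList {α β : Type*} {r : α → β → Prop} {f : ℕ → α} {g : ℕ → β} {n : ℕ} :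
    List.Forall₂ r (revList f n) (revList g n) ↔ ∀ i ≤ n, r (f i) (g i) := by
  induction n with
  | zero => simp [revList]
  | succ n ih =>
    rw [revList, revList, List.forall₂_cons, ih]
    constructor
    · rintro ⟨h1, h2⟩ i hi
      rcases Nat.le_succ_iff.1 hi with hi | rfl
      · exact h2 i hi
      · exact h1
    · exact fun h => ⟨h _ le_rfl, fun i hi => h i (by omega)⟩

/-- The limit tree is written in the same form as the re-rooted tree, so that `close_of_plug` can
compare them. -/
theorem plug_revList {P : ℕ → LTree} {s : ℕ → ℤ} {L R : ℕ → LTree}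
    (hP : ∀ i, P i = node (s i) ((L i).children ++ P (i + 1) :: (R i).children)) (n : ℕ) :
    plug (revList (fun i => (s i, L i, R i)) n) [P (n + 1)] = [P 0] := by
  induction n with
  | zero => simp [revList, plugNode, hP 0]
  | succ n ih =>
    rw [revList, plug_cons, ← ih]
    congr 2
    simp [plugNode, hP (n + 1)]

/-- Two spine vertices have the same label and close left and right subtrees. -/
def DataClose (r : ℕ) (d d' : ℤ × LTree × LTree) : Prop :=
  d.1 = d'.1 ∧ Close r d.2.1 d'.2.1 ∧ Close r d.2.2 d'.2.2

theorem close_plugNode {r e : ℕ} {d d' : ℤ × LTree × LTree} (h : DataClose r d d')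
    {Qs Qs' : List LTree} (hQ : List.Forall₂ (Close e) Qs Qs') :
    Close (min (e + 1) r) (plugNode d Qs) (plugNode d' Qs') := by
  obtain ⟨x, L, R⟩ := d
  obtain ⟨x', L', R'⟩ := d'
  obtain ⟨rfl, hL, hR⟩ := h
  rcases r with _ | _ | r
  · simpa using close_zero _ _
  · exact Close.mono (min_le_right _ _) (close_one_node.2 rfl)
  · refine Close.mono (e := min e (r + 1) + 1) (by omega) (close_succ_node ?_)
    refine List.rel_append (List.rel_append ?_ ?_) ?_
    · exact hL.children.imp fun _ _ h => h.mono (min_le_right _ _)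
    · exact hQ.imp fun _ _ h => h.mono (min_le_left _ _)
    · exact hR.children.imp fun _ _ h => h.mono (min_le_right _ _)

theorem forall₂_close_plug {r e : ℕ} {l l' : List (ℤ × LTree × LTree)}
    (h : List.Forall₂ (DataClose r) l l') {Qs Qs' : List LTree}
    (hQ : List.Forall₂ (Close (min e r)) Qs Qs') :
    List.Forall₂ (Close (min (e + l.length) r)) (plug l Qs) (plug l' Qs') := by
  induction h generalizing e Qs Qs' with
  | nil => simpa using hQ
  | cons h _ ih =>
    refine (ih (e := e + 1) (.cons ((close_plugNode h hQ).mono (by omega)) .nil)).imp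
      fun _ _ h => h.mono ?_
    simp only [List.length_cons]
    omega

/-- Each element of `l` puts one more generation between the root and the tip, so that arbitrary
tips cannot be seen up to depth `l.length`. -/
theorem close_of_plug {r : ℕ} {l l' : List (ℤ × LTree × LTree)}
    (h : List.Forall₂ (DataClose r) l l') (hl : l ≠ []) (hr : r ≤ l.length) {Qs Qs' : List LTree}
    {t t' : LTree} (ht : plug l Qs = [t]) (ht' : plug l' Qs' = [t']) : Close r t t' := by
  cases h with
  | nil => exact absurd rfl hl
  | @cons d d' l l' hd h =>
    rw [plug_cons] at ht ht'
    -- The tips are unrelated, but the vertex that carries them has a prescribed label: this gives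
    -- the depth one from which the count starts.
    have h1 : Close 1 (plugNode d Qs) (plugNode d' Qs') := close_one_node.2 hd.1
    have := forall₂_close_plug (e := 1) h (.cons (h1.mono (min_le_left _ _)) .nil)
    rw [ht, ht', List.forall₂_cons] at this
    exact this.1.mono (by simp at hr; omega)

/-! ### Galton-Watson trees: branching property, symmetry, probability of positivity. -/

/-! ### The decomposition of a Galton-Watson tree at its root -/

/-- The offspring law. -/
noncomputable def geoHalf : Measure ℕ := geometricMeasure ⟨1 / 2, by norm_num, by norm_num⟩

instance : IsProbabilityMeasure geoHalf := by unfold geoHalf; infer_instance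

/-- The law of the numbers of children and label increments that encode a Galton-Watson tree. -/
noncomputable def gwNoise : Measure (List ℕ → ℕ × Fin 3) :=
  Measure.infinitePi fun _ : List ℕ => geoHalf.prod (PMF.uniformOfFintype (Fin 3)).toMeasure

instance : IsProbabilityMeasure gwNoise := by unfold gwNoise; infer_instance

theorem gw_eq_map (x : ℤ) : gw x = gwNoise.map (gwTree x) := rfl

theorem geoHalf_singleton (n : ℕ) : geoHalf {n} = (2⁻¹ : ℝ≥0∞) ^ (n + 1) := by
  have hp : (⟨1 / 2, by norm_num, by norm_num⟩ : unitInterval) ≠ 0 := by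
    intro h
    simpa using congrArg Subtype.val h
  rw [geoHalf, geometricMeasure_singleton hp]
  have : (1 - (1 / 2 : ℝ)) ^ n * (1 / 2) = (2⁻¹ : ℝ) ^ (n + 1) := by
    rw [pow_succ]; norm_num
  change ENNReal.ofReal ((1 - (1 / 2 : ℝ)) ^ n * (1 / 2)) = _
  rw [this, ENNReal.ofReal_pow (by norm_num), ENNReal.ofReal_inv_of_pos (by norm_num)]
  simp

/-- A word is empty or of the form `a :: v`. An i.i.d. family over words is therefore one entry at
the root and, independently, a sequence of independent copies of the family: this is the branching
property. -/
theorem gwNoise_map_split :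
    gwNoise.map (fun ω => (ω [], fun (a : ℕ) (v : List ℕ) => ω (a :: v))) =
      (geoHalf.prod (PMF.uniformOfFintype (Fin 3)).toMeasure).prod
        (Measure.infinitePi fun _ : ℕ => gwNoise) := by
  set m := geoHalf.prod (PMF.uniformOfFintype (Fin 3)).toMeasure with hm
  let J : (ℕ × Fin 3) × (ℕ × List ℕ → ℕ × Fin 3) → List ℕ → ℕ × Fin 3 := fun p u =>
    match u with
    | [] => p.1
    | a :: v => p.2 (a, v)
  have hJ : Measurable J := by
    refine measurable_pi_lambda _ fun u => ?_
    cases u with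
    | nil => exact measurable_fst
    | cons a v => exact (measurable_pi_apply (a, v)).comp measurable_snd
  have h1 : (m.prod (Measure.infinitePi fun _ : ℕ × List ℕ => m)).map J = gwNoise := by
    refine Measure.eq_infinitePi _ fun s t ht => ?_
    classical
    rw [Measure.map_apply hJ (.pi (Finset.countable_toSet _) fun _ _ => ht _)]
    have hinj : Function.Injective fun p : ℕ × List ℕ => p.1 :: p.2 := fun p q h => by
      simp only [List.cons.injEq] at h
      exact Prod.ext h.1 h.2
    have : J ⁻¹' Set.pi s t = {r | [] ∈ s → r ∈ t []} ×ˢ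
        Set.pi (s.preimage (fun p : ℕ × List ℕ => p.1 :: p.2) hinj.injOn)
          (fun p : ℕ × List ℕ => t (p.1 :: p.2)) := by
      ext p
      simp only [Set.mem_preimage, Set.mem_pi, Finset.mem_coe, Set.mem_prod, Set.mem_ofPred_eq,
        Finset.mem_preimage]
      constructor
      · exact fun h => ⟨h [], fun q hq => h _ hq⟩
      · rintro ⟨h1, h2⟩ u hu
        cases u with
        | nil => exact h1 hu
        | cons a v => exact h2 (a, v) hu
    rw [this, Measure.prod_prod, Measure.infinitePi_pi _ fun _ _ => ht _,
      Finset.prod_preimage' (fun p : ℕ × List ℕ => p.1 :: p.2) s hinj.injOn (fun u => m (t u))]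
    have hr : m {r | [] ∈ s → r ∈ t []} = ∏ u ∈ s with u = [], m (t u) := by
      by_cases h : [] ∈ s
      · have : {u ∈ s | u = []} = {[]} := by
          ext u; simp only [Finset.mem_filter, Finset.mem_singleton]
          exact ⟨fun hu => hu.2, fun hu => ⟨hu ▸ h, hu⟩⟩
        rw [this]; simp [h]
      · have : {u ∈ s | u = []} = ∅ := by
          ext u; simp only [Finset.mem_filter, Finset.notMem_empty, iff_false]
          exact fun hu => h (hu.2 ▸ hu.1)
        rw [this]; simp [h]
    rw [hr, ← Finset.prod_filter_mul_prod_filter_not s (fun u => u = [])]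
    congr 1
    refine Finset.prod_congr (Finset.filter_congr fun u _ => ?_) fun _ _ => rfl
    cases u <;> simp
  have h2 : (m.prod (Measure.infinitePi fun _ : ℕ × List ℕ => m)).map
      (Prod.map id (MeasurableEquiv.curry ℕ (List ℕ) (ℕ × Fin 3))) =
      m.prod (Measure.infinitePi fun _ : ℕ => gwNoise) := by
    rw [← Measure.map_prod_map _ _ measurable_id (MeasurableEquiv.measurable _), Measure.map_id,
      Measure.infinitePi_map_curry (fun _ _ => m)]
    rfl
  rw [← h2]
  conv_lhs => rw [← h1]
  rw [Measure.map_map ?_ hJ]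
  · rfl
  · refine (measurable_pi_apply _).prodMk ?_
    exact measurable_pi_lambda _ fun a => measurable_pi_lambda _ fun v => measurable_pi_apply _

/-- The tree encoded by the number `n` of children of the root and the trees `f a` attached to
them. -/
def ofSeq (x : ℤ) (p : ℕ × (ℕ → LTree)) : LTree := node x ((List.range p.1).map p.2)

theorem measurable_ofSeq (x : ℤ) : Measurable (ofSeq x) := by
  refine measurable_of_lab _ fun u o => ?_
  cases u with
  | nil => exact MeasurableSet.const (some x = o)
  | cons a w =>
    have : {p : ℕ × (ℕ → LTree) | (ofSeq x p).lab (a :: w) = o} =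
        ({p | a < p.1} ∩ {p | (p.2 a).lab w = o}) ∪ ({p | a < p.1}ᶜ ∩ {_p | none = o}) := by
      ext p
      by_cases h : a < p.1 <;> simp [ofSeq, h]
    rw [this]
    have h1 : MeasurableSet {p : ℕ × (ℕ → LTree) | a < p.1} :=
      measurableSet_lt measurable_const measurable_fst
    exact (h1.inter (((measurable_pi_apply a).comp measurable_snd) (measurableSet_lab w o))).union
      (h1.compl.inter (MeasurableSet.const _))

theorem gwTree_eq_ofSeq (x : ℤ) (ω : List ℕ → ℕ × Fin 3) :
    gwTree x ω = ofSeq x ((ω []).1, fun a =>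
      gwTree (x + (((ω [a]).2 : ℕ) : ℤ) - 1) fun v => ω (a :: v)) := by
  ext1; funext u
  cases u with
  | nil => rfl
  | cons a w =>
    change gwLab x ω (a :: w) = _
    by_cases h : a < (ω []).1
    · simp [gwLab, ofSeq, h]; rfl
    · simp [gwLab, ofSeq, h]

/-- The law of the subtrees at the children of the root of a Galton-Watson tree with root label
`x`. -/
noncomputable def gwChild (x : ℤ) : Measure LTree :=
  gwNoise.map fun ω => gwTree (x + (((ω []).2 : ℕ) : ℤ) - 1) ω

theorem measurable_gwTree_child (x : ℤ) : Measurable fun ω : List ℕ → ℕ × Fin 3 =>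
    gwTree (x + (((ω []).2 : ℕ) : ℤ) - 1) ω := by
  have : Measurable fun p : (List ℕ → ℕ × Fin 3) × Fin 3 =>
      gwTree (x + ((p.2 : ℕ) : ℤ) - 1) p.1 :=
    measurable_from_prod_countable_left fun e => measurable_gwTree (x + ((e : ℕ) : ℤ) - 1)
  exact this.comp (measurable_id.prodMk (measurable_snd.comp (measurable_pi_apply [])))

instance (x : ℤ) : IsProbabilityMeasure (gwChild x) :=
  Measure.isProbabilityMeasure_map (measurable_gwTree_child x).aemeasurable

theorem gw_eq_map_ofSeq (x : ℤ) :
    gw x = (geoHalf.prod (Measure.infinitePi fun _ : ℕ => gwChild x)).map (ofSeq x) := by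
  have h : gwTree x = ofSeq x ∘ (Prod.map Prod.fst fun (f : ℕ → List ℕ → ℕ × Fin 3) a =>
      gwTree (x + (((f a []).2 : ℕ) : ℤ) - 1) (f a)) ∘
      fun ω => (ω [], fun (a : ℕ) (v : List ℕ) => ω (a :: v)) := by
    funext ω
    exact gwTree_eq_ofSeq x ω
  have hm : Measurable fun (f : ℕ → List ℕ → ℕ × Fin 3) (a : ℕ) =>
      gwTree (x + (((f a []).2 : ℕ) : ℤ) - 1) (f a) :=
    measurable_pi_lambda _ fun a => (measurable_gwTree_child x).comp (measurable_pi_apply a)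
  have hs : Measurable fun ω : List ℕ → ℕ × Fin 3 =>
      (ω [], fun (a : ℕ) (v : List ℕ) => ω (a :: v)) :=
    (measurable_pi_apply _).prodMk
      (measurable_pi_lambda _ fun a => measurable_pi_lambda _ fun v => measurable_pi_apply _)
  rw [gw_eq_map, h, ← Measure.map_map (measurable_ofSeq x) ((measurable_fst.prodMap hm).comp hs),
    ← Measure.map_map (measurable_fst.prodMap hm) hs, gwNoise_map_split,
    ← Measure.map_prod_map _ _ measurable_fst hm]
  congr 2
  · exact Measure.fst_prod
  · rw [Measure.infinitePi_map_pi (fun _ : ℕ => gwNoise) fun _ => measurable_gwTree_child x]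
    rfl

theorem gw_apply (x : ℤ) {S : Set LTree} (hS : MeasurableSet S) :
    gw x S = ∑' n : ℕ, (2⁻¹ : ℝ≥0∞) ^ (n + 1) *
      (Measure.infinitePi fun _ : ℕ => gwChild x) {f | ofSeq x (n, f) ∈ S} := by
  rw [gw_eq_map_ofSeq, Measure.map_apply (measurable_ofSeq x) hS,
    Measure.prod_apply ((measurable_ofSeq x) hS), lintegral_countable']
  refine tsum_congr fun n => ?_
  rw [geoHalf_singleton, mul_comm]
  rfl

/-- A tree `gwTree y ω` never reads the increment stored at its own root. This increment is
independent of the tree and serves as the step from the parent. -/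
theorem gwChild_apply (x : ℤ) {C : Set LTree} (hC : MeasurableSet C) :
    gwChild x C = (gw (x - 1) C + gw x C + gw (x + 1) C) / 3 := by
  set F := Measure.infinitePi fun _ : ℕ => gwNoise with hF
  set U := (PMF.uniformOfFintype (Fin 3)).toMeasure with hU
  have hs : Measurable fun ω : List ℕ → ℕ × Fin 3 =>
      (ω [], fun (a : ℕ) (v : List ℕ) => ω (a :: v)) :=
    (measurable_pi_apply _).prodMk
      (measurable_pi_lambda _ fun a => measurable_pi_lambda _ fun v => measurable_pi_apply _)
  let G : ℤ → ℕ → (ℕ → List ℕ → ℕ × Fin 3) → LTree := fun y n f =>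
    ofSeq y (n, fun a => gwTree (y + (((f a []).2 : ℕ) : ℤ) - 1) (f a))
  have hG : ∀ y, Measurable fun p : (ℕ × Fin 3) × (ℕ → List ℕ → ℕ × Fin 3) =>
      G y p.1.1 p.2 := fun y => (measurable_ofSeq y).comp
    ((measurable_fst.comp measurable_fst).prodMk (measurable_pi_lambda _ fun a =>
      (measurable_gwTree_child y).comp ((measurable_pi_apply a).comp measurable_snd)))
  have key : ∀ e : Fin 3, ∀ y, gwNoise {ω | (ω []).2 = e ∧ gwTree y ω ∈ C} = gw y C / 3 := by
    intro e y
    have h1 : gwNoise {ω | (ω []).2 = e ∧ gwTree y ω ∈ C} = ((geoHalf.prod U).prod F)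
        {p | p.1.2 = e ∧ G y p.1.1 p.2 ∈ C} := by
      rw [← gwNoise_map_split, Measure.map_apply hs]
      · congr 1; ext ω
        simp only [Set.mem_ofPred_eq, Set.mem_preimage, gwTree_eq_ofSeq y ω, G]
      · exact ((measurable_snd.comp measurable_fst) (measurableSet_singleton e)).inter (hG y hC)
    have h2 : gw y C = ((geoHalf.prod U).prod F) {p | G y p.1.1 p.2 ∈ C} := by
      rw [gw_eq_map, Measure.map_apply (measurable_gwTree y) hC, ← gwNoise_map_split,
        Measure.map_apply hs]
      swap
      · exact hG y hC
      congr 1; ext ω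
      simp only [Set.mem_ofPred_eq, Set.mem_preimage, gwTree_eq_ofSeq y ω, G]
    have hUe : U {e} = 3⁻¹ := by simp [hU]
    have m1 : MeasurableSet {p : (ℕ × Fin 3) × (ℕ → List ℕ → ℕ × Fin 3) |
        p.1.2 = e ∧ G y p.1.1 p.2 ∈ C} :=
      ((measurable_snd.comp measurable_fst) (measurableSet_singleton e)).inter (hG y hC)
    have m2 : MeasurableSet {p : (ℕ × Fin 3) × (ℕ → List ℕ → ℕ × Fin 3) |
        G y p.1.1 p.2 ∈ C} := hG y hC
    rw [h1, h2, Measure.prod_apply_symm m1, Measure.prod_apply_symm m2, div_eq_mul_inv, ← lintegral_mul_const' _ _ (by simp)]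
    refine lintegral_congr fun f => ?_
    have e1 : (fun a : ℕ × Fin 3 => (a, f)) ⁻¹' {p | p.1.2 = e ∧ G y p.1.1 p.2 ∈ C} =
        {n | G y n f ∈ C} ×ˢ {e} := by
      ext a; simp [and_comm]
    have e2 : (fun a : ℕ × Fin 3 => (a, f)) ⁻¹' {p | G y p.1.1 p.2 ∈ C} =
        {n | G y n f ∈ C} ×ˢ Set.univ := by
      ext a; simp
    rw [e1, e2, Measure.prod_prod, Measure.prod_prod, hUe, measure_univ, mul_one]
  have hU3 : ((fun ω : List ℕ → ℕ × Fin 3 => gwTree (x + (((ω []).2 : ℕ) : ℤ) - 1) ω) ⁻¹' C) =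
      ⋃ e : Fin 3, {ω | (ω []).2 = e ∧ gwTree (x + ((e : ℕ) : ℤ) - 1) ω ∈ C} := by
    ext ω; simp
  rw [gwChild, Measure.map_apply (measurable_gwTree_child x) hC, hU3, measure_iUnion]
  · rw [tsum_fintype, Fin.sum_univ_three, key, key, key, ENNReal.div_add_div_same,
      ENNReal.div_add_div_same]
    simp only [Fin.val_zero, Fin.val_one, Fin.val_two, Nat.cast_zero, Nat.cast_one, Nat.cast_ofNat]
    congr 4 <;> ring_nf
  · intro e e' hee'
    refine Set.disjoint_left.2 fun ω h h' => hee' ?_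
    rw [← h.1, ← h'.1]
  · intro e
    exact ((measurable_snd.comp (measurable_pi_apply [])) (measurableSet_singleton e)).inter
      (measurable_gwTree _ hC)

/-- The children of the root belong to given sets, one after the other. -/
theorem gw_forall₂_children (x : ℤ) (Cs : List (Set LTree)) (hC : ∀ C ∈ Cs, MeasurableSet C) :
    gw x {t | List.Forall₂ (fun c C => c ∈ C) t.children Cs} =
      (2⁻¹ : ℝ≥0∞) ^ (Cs.length + 1) * (Cs.map fun C => gwChild x C).prod := by
  have hset : ∀ n f, ofSeq x (n, f) ∈
      {t : LTree | List.Forall₂ (fun c C => c ∈ C) t.children Cs} ↔ n = Cs.length ∧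
        f ∈ Set.pi (Finset.range Cs.length) fun i => (Cs[i]?).getD Set.univ := by
    intro n f
    rw [Set.mem_ofPred_eq, ofSeq, children_node, List.forall₂_iff_get]
    simp only [List.length_map, List.length_range, Set.mem_pi, Finset.mem_coe, Finset.mem_range]
    constructor
    · rintro ⟨rfl, h⟩
      exact ⟨rfl, fun i hi => by simpa [hi] using h i hi hi⟩
    · rintro ⟨rfl, h⟩
      exact ⟨rfl, fun i hi _ => by simpa [hi] using h i hi⟩
  have hmeas : ∀ i ∈ Finset.range Cs.length, MeasurableSet ((Cs[i]?).getD Set.univ) := by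
    intro i hi
    have hi' := Finset.mem_range.1 hi
    simpa [hi'] using hC _ (List.getElem_mem hi')
  have hS : MeasurableSet {t : LTree | List.Forall₂ (fun c C => c ∈ C) t.children Cs} := by
    have : {t : LTree | List.Forall₂ (fun c C => c ∈ C) t.children Cs} =
        {t | t.deg [] = Cs.length} ∩ ⋂ i ∈ Finset.range Cs.length,
          (fun t : LTree => t.subtree [i]) ⁻¹' ((Cs[i]?).getD Set.univ) := by
      ext t
      simp only [Set.mem_ofPred_eq, List.forall₂_iff_get, length_children, Set.mem_inter_iff,
        Set.mem_iInter, Finset.mem_range, Set.mem_preimage]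
      refine and_congr_right fun hd => ⟨fun h i hi => ?_, fun h i h1 h2 => ?_⟩
      · simpa [hi, getElem_children] using h i (hd ▸ hi) hi
      · simpa [h2, getElem_children] using h i h2
    rw [this]
    refine ((measurable_deg []) (measurableSet_singleton _)).inter ?_
    exact Finset.measurableSet_biInter _ fun i hi => (continuous_subtree [i]).measurable (hmeas i hi)
  rw [gw_apply x hS, tsum_eq_single Cs.length]
  · congr 1
    have : {f | ofSeq x (Cs.length, f) ∈
        {t : LTree | List.Forall₂ (fun c C => c ∈ C) t.children Cs}} =
        Set.pi (Finset.range Cs.length) fun i => (Cs[i]?).getD Set.univ := by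
      ext f
      rw [Set.mem_ofPred_eq, hset]
      simp
    rw [this, Measure.infinitePi_pi _ hmeas, Finset.prod_range, ← Fin.prod_univ_getElem,
      ← (finCongr (List.length_map (as := Cs) fun C => gwChild x C)).symm.prod_comp]
    simp
  · intro n hn
    have : {f | ofSeq x (n, f) ∈
        {t : LTree | List.Forall₂ (fun c C => c ∈ C) t.children Cs}} = ∅ := by
      ext f
      rw [Set.mem_ofPred_eq, hset]
      simp [hn]
    rw [this, measure_empty, mul_zero]

/-! ### Distinguished children of the root -/

/-- The sequence made of the first `a` terms of `p.1`, of `p.2.1` and of the terms of `p.2.2`. -/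
def spliceSeq {X : Type*} (a : ℕ) (p : (ℕ → X) × X × (ℕ → X)) (i : ℕ) : X :=
  if i < a then p.1 i else if i = a then p.2.1 else p.2.2 (i - (a + 1))

theorem spliceSeq_add {X : Type*} (a : ℕ) (p : (ℕ → X) × X × (ℕ → X)) (i : ℕ) :
    spliceSeq a p (i + (a + 1)) = p.2.2 i := by
  rw [spliceSeq, if_neg (by omega), if_neg (by omega), Nat.add_sub_cancel]

theorem measurable_spliceSeq {X : Type*} [MeasurableSpace X] (a : ℕ) :
    Measurable (spliceSeq (X := X) a) := by
  refine measurable_pi_lambda _ fun i => ?_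
  unfold spliceSeq
  split_ifs <;> fun_prop

/-- An i.i.d. sequence is split into its first `a` terms, the term of rank `a` and the following
ones, which are independent. -/
theorem infinitePi_map_spliceSeq {X : Type*} [MeasurableSpace X] (ν : Measure X)
    [IsProbabilityMeasure ν] (a : ℕ) :
    ((Measure.infinitePi fun _ : ℕ => ν).prod (ν.prod (Measure.infinitePi fun _ : ℕ => ν))).map
      (spliceSeq a) = Measure.infinitePi fun _ : ℕ => ν := by
  classical
  refine Measure.eq_infinitePi _ fun s t ht => ?_
  have hinj : Function.Injective fun i : ℕ => i + (a + 1) := add_left_injective _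
  rw [Measure.map_apply (measurable_spliceSeq a) (.pi (Finset.countable_toSet _) fun _ _ => ht _)]
  have : spliceSeq a ⁻¹' Set.pi s t =
      Set.pi (s.filter (· < a)) t ×ˢ ({c | a ∈ s → c ∈ t a} ×ˢ
        Set.pi (s.preimage (fun i => i + (a + 1)) hinj.injOn) (fun i => t (i + (a + 1)))) := by
    ext p
    simp only [Set.mem_preimage, Set.mem_pi, Finset.mem_coe, Set.mem_prod, Set.mem_ofPred_eq,
      Finset.mem_preimage, Finset.mem_filter]
    constructor
    · intro h
      refine ⟨fun i hi => ?_, fun ha => ?_, fun i hi => ?_⟩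
      · simpa [spliceSeq, hi.2] using h i hi.1
      · simpa [spliceSeq] using h a ha
      · simpa [spliceSeq_add] using h _ hi
    · rintro ⟨h1, h2, h3⟩ i hi
      by_cases ha : i < a
      · simpa [spliceSeq, ha] using h1 i ⟨hi, ha⟩
      · by_cases ha' : i = a
        · subst ha'; simpa [spliceSeq] using h2 hi
        · obtain ⟨j, rfl⟩ : ∃ j, i = j + (a + 1) := ⟨i - (a + 1), by omega⟩
          simpa [spliceSeq_add] using h3 j hi
  rw [this, Measure.prod_prod, Measure.prod_prod, Measure.infinitePi_pi _ fun _ _ => ht _,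
    Measure.infinitePi_pi _ fun _ _ => ht _,
    Finset.prod_preimage' (fun i => i + (a + 1)) s hinj.injOn (fun i => ν (t i)),
    ← Finset.prod_filter_mul_prod_filter_not s (· < a)]
  congr 1
  have h3 : ν {c | a ∈ s → c ∈ t a} = ∏ i ∈ s with i = a, ν (t i) := by
    by_cases h : a ∈ s <;> simp [h, Finset.filter_eq']
  rw [h3, ← Finset.prod_filter_mul_prod_filter_not (s.filter fun i => ¬ i < a) (· = a),
    Finset.filter_filter, Finset.filter_filter]
  congr 1
  · refine Finset.prod_congr (Finset.filter_congr fun i _ => ?_) fun _ _ => rfl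
    omega
  · refine Finset.prod_congr (Finset.filter_congr fun i _ => ?_) fun _ _ => rfl
    simp only [Set.mem_range]
    exact ⟨fun ⟨y, hy⟩ => by omega, fun h => ⟨i - (a + 1), by omega⟩⟩

/-- The trees with a child `c` of the root such that the root with the subtrees on the left of `c`
belongs to `B`, the subtree at `c` belongs to `C`, and the root with the subtrees on the right of
`c` belongs to `A`. -/
def splitSet (B C A : Set LTree) : Set LTree :=
  {t | ∃ x bs c cs, t = node x (bs ++ c :: cs) ∧ node x bs ∈ B ∧ c ∈ C ∧ node x cs ∈ A}

/-- The trees of `splitSet B C A` with a distinguished child of rank `a`. -/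
def splitSetAt (a : ℕ) (B C A : Set LTree) : Set LTree :=
  {t | a < t.deg [] ∧ node t.rootLabel (t.children.take a) ∈ B ∧ t.subtree [a] ∈ C ∧
    node t.rootLabel (t.children.drop (a + 1)) ∈ A}

theorem mem_splitSetAt {a : ℕ} {B C A : Set LTree} {t : LTree} :
    t ∈ splitSetAt a B C A ↔ ∃ x bs c cs, t = node x (bs ++ c :: cs) ∧ bs.length = a ∧
      node x bs ∈ B ∧ c ∈ C ∧ node x cs ∈ A := by
  constructor
  · rintro ⟨h, hB, hC, hA⟩
    refine ⟨_, _, _, _, ?_, ?_, hB, hC, hA⟩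
    · have h' : a < t.children.length := by simpa using h
      rw [← getElem_children t a h', List.cons_getElem_drop_succ, List.take_append_drop,
        node_children]
    · simp [h.le]
  · rintro ⟨x, bs, c, cs, rfl, rfl, hB, hC, hA⟩
    refine ⟨by simp [deg_node], by simpa using hB, ?_, by simpa using hA⟩
    rw [← getElem_children _ _ (by simp)]
    simpa using hC

theorem splitSet_eq_iUnion (B C A : Set LTree) :
    splitSet B C A = ⋃ a, splitSetAt a B C A := by
  ext t
  simp only [Set.mem_iUnion, mem_splitSetAt]
  constructor
  · rintro ⟨x, bs, c, cs, h1, h⟩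
    exact ⟨_, x, bs, c, cs, h1, rfl, h⟩
  · rintro ⟨_, x, bs, c, cs, h1, _, h⟩
    exact ⟨x, bs, c, cs, h1, h⟩

theorem measurableSet_splitSetAt (a : ℕ) {B C A : Set LTree} (hB : MeasurableSet B)
    (hC : MeasurableSet C) (hA : MeasurableSet A) : MeasurableSet (splitSetAt a B C A) := by
  have h1 : MeasurableSet {t : LTree | a < t.deg []} :=
    measurableSet_lt measurable_const (measurable_deg [])
  exact h1.inter (((continuous_take a).measurable hB).inter
    (((continuous_subtree [a]).measurable hC).inter ((continuous_drop (a + 1)).measurable hA)))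

theorem measurableSet_splitSet {B C A : Set LTree} (hB : MeasurableSet B)
    (hC : MeasurableSet C) (hA : MeasurableSet A) : MeasurableSet (splitSet B C A) := by
  rw [splitSet_eq_iUnion]
  exact MeasurableSet.iUnion fun a => measurableSet_splitSetAt a hB hC hA

/-- Memorylessness of the geometric law: `2^{-(a+1+b)-1} = 2^{-(a+1)} 2^{-(b+1)}`, so that the
numbers `a` and `b` of children on both sides of a distinguished one have the weights of two
independent offspring numbers. The sum over `b` gives the factor for `A`; the one over `a`, which
gives the factor for `B`, is taken in `gw_splitSet`. -/
theorem gw_splitSetAt (x : ℤ) (a : ℕ) {B C A : Set LTree} (hB : MeasurableSet B)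
    (hC : MeasurableSet C) (hA : MeasurableSet A) :
    gw x (splitSetAt a B C A) = (2⁻¹ : ℝ≥0∞) ^ (a + 1) *
      (Measure.infinitePi fun _ : ℕ => gwChild x) {f | ofSeq x (a, f) ∈ B} * gwChild x C *
        gw x A := by
  set F := Measure.infinitePi fun _ : ℕ => gwChild x with hF
  have hof : ∀ n, Measurable fun f : ℕ → LTree => ofSeq x (n, f) := fun n =>
    (measurable_ofSeq x).comp (measurable_const.prodMk measurable_id)
  have key : ∀ b, F {f | ofSeq x (b + (a + 1), f) ∈ splitSetAt a B C A} =
      F {f | ofSeq x (a, f) ∈ B} * (gwChild x C * F {f | ofSeq x (b, f) ∈ A}) := by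
    intro b
    rw [← Measure.prod_prod, ← Measure.prod_prod]
    conv_lhs => rw [hF, ← infinitePi_map_spliceSeq (gwChild x) a]
    rw [Measure.map_apply (measurable_spliceSeq a)]
    swap
    · exact hof _ (measurableSet_splitSetAt a hB hC hA)
    congr 1
    ext p
    simp only [Set.mem_preimage, Set.mem_ofPred_eq, Set.mem_prod, ofSeq]
    have e : (List.range (b + (a + 1))).map (spliceSeq a p) =
        ((List.range a).map p.1 ++ [p.2.1]) ++ (List.range b).map p.2.2 := by
      rw [add_comm, List.range_add, List.map_append, List.range_succ, List.map_append, List.map_map]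
      congr 1
      · congr 1
        · refine List.map_congr_left fun i hi => ?_
          simp [spliceSeq, List.mem_range.1 hi]
        · simp [spliceSeq]
      · refine List.map_congr_left fun i _ => ?_
        rw [Function.comp_apply, add_comm, spliceSeq_add]
    have e1 : (node x (((List.range a).map p.1 ++ [p.2.1]) ++ (List.range b).map p.2.2)).subtree [a]
        = p.2.1 := by
      rw [← getElem_children _ _ (by simp)]
      simp
    rw [e, splitSetAt, Set.mem_ofPred_eq, rootLabel_node, children_node, e1,
      List.drop_left' (by simp), List.append_assoc, List.take_left' (by simp), deg_node]
    simp
  have hzero : ∀ n, n < a + 1 → F {f | ofSeq x (n, f) ∈ splitSetAt a B C A} = 0 := by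
    intro n hn
    have : {f | ofSeq x (n, f) ∈ splitSetAt a B C A} = ∅ := by
      ext f
      simp only [Set.mem_ofPred_eq, splitSetAt, ofSeq, deg_node, Set.mem_empty_iff_false, iff_false]
      rintro ⟨h, _⟩
      simp at h; omega
    rw [this, measure_empty]
  have hsupp : Function.support (fun n : ℕ => (2⁻¹ : ℝ≥0∞) ^ (n + 1) *
      F {f | ofSeq x (n, f) ∈ splitSetAt a B C A}) ⊆ Set.range fun b => b + (a + 1) := by
    intro n hn
    refine ⟨n - (a + 1), ?_⟩
    by_contra h
    refine hn ?_
    dsimp only at h ⊢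
    rw [hzero n (by omega), mul_zero]
  rw [gw_apply x (measurableSet_splitSetAt a hB hC hA), gw_apply x hA, ← ENNReal.tsum_mul_left,
    ← (add_left_injective (a + 1)).tsum_eq hsupp]
  refine tsum_congr fun b => ?_
  rw [key, show b + (a + 1) + 1 = (b + 1) + (a + 1) by ring, pow_add]
  ring

/-- The subtrees on both sides of a child of the root are Galton-Watson trees. -/
theorem gw_splitSet (x : ℤ) {B C A : Set LTree} (hB : MeasurableSet B) (hC : MeasurableSet C)
    (hA : MeasurableSet A) (hBp : B ⊆ {t | t.Positive}) (hCp : C ⊆ {t | ¬ t.Positive}) :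
    gw x (splitSet B C A) = gw x B * gwChild x C * gw x A := by
  rw [splitSet_eq_iUnion, measure_iUnion]
  · simp only [gw_splitSetAt x _ hB hC hA, ENNReal.tsum_mul_right]
    rw [gw_apply x hB]
  -- The rank of the distinguished child is unique: this child is the first one that is not
  -- positive.
  · intro a a' haa'
    refine Set.disjoint_left.2 fun t h h' => haa' ?_
    obtain ⟨y, bs, c, cs, rfl, rfl, hb, hc, -⟩ := mem_splitSetAt.1 h
    obtain ⟨y', bs', c', cs', ht, rfl, hb', hc', -⟩ := mem_splitSetAt.1 h'
    obtain ⟨-, ht⟩ := node_inj.1 ht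
    rw [(append_cons_inj_of_positive ht (positive_node.1 (hBp hb)).2 (positive_node.1 (hBp hb')).2
      (hCp hc) (hCp hc')).1]
  · exact fun a => measurableSet_splitSetAt a hB hC hA

theorem measurableSet_forall_children {C : Set LTree} (hC : MeasurableSet C) :
    MeasurableSet {t : LTree | ∀ c ∈ t.children, c ∈ C} := by
  have : {t : LTree | ∀ c ∈ t.children, c ∈ C} =
      ⋂ i : ℕ, {t : LTree | i < t.deg []}ᶜ ∪ (fun t : LTree => t.subtree [i]) ⁻¹' C := by
    ext t
    simp only [children, List.forall_mem_map, List.mem_range, Set.mem_ofPred_eq, Set.mem_iInter,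
      Set.mem_union, Set.mem_compl_iff, Set.mem_preimage]
    exact forall_congr' fun i => imp_iff_not_or
  rw [this]
  refine MeasurableSet.iInter fun i => MeasurableSet.union ?_ ((continuous_subtree [i]).measurable hC)
  exact (measurableSet_lt measurable_const (measurable_deg [])).compl

/-- Generating function of the offspring law: the series with terms `2^{-(n+1)} p^n` has sum `1/(2 -
p)`. -/
theorem gw_forall_children (x : ℤ) {C : Set LTree} (hC : MeasurableSet C) :
    (gw x).real {t | ∀ c ∈ t.children, c ∈ C} * (2 - (gwChild x).real C) = 1 := by
  have h1 : gw x {t | ∀ c ∈ t.children, c ∈ C} =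
      ∑' n : ℕ, (2⁻¹ : ℝ≥0∞) ^ (n + 1) * (gwChild x C) ^ n := by
    rw [gw_apply x (measurableSet_forall_children hC)]
    refine tsum_congr fun n => ?_
    have : {f | ofSeq x (n, f) ∈ {t : LTree | ∀ c ∈ t.children, c ∈ C}} =
        Set.pi (Finset.range n) fun _ => C := by
      ext f
      simp [ofSeq, Set.mem_pi]
    rw [this, Measure.infinitePi_pi _ fun _ _ => hC]
    simp
  have h2 : (gw x).real {t | ∀ c ∈ t.children, c ∈ C} =
      ∑' n : ℕ, 2⁻¹ * (2⁻¹ * (gwChild x).real C) ^ n := by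
    rw [measureReal_def, h1, ENNReal.tsum_toReal_eq]
    · refine tsum_congr fun n => ?_
      rw [ENNReal.toReal_mul, ENNReal.toReal_pow, ENNReal.toReal_pow, ENNReal.toReal_inv,
        measureReal_def]
      rw [mul_pow, pow_succ, ENNReal.toReal_ofNat]; ring
    · exact fun n => ENNReal.mul_ne_top (by simp) (ENNReal.pow_ne_top (measure_ne_top _ _))
  have hp : (gwChild x).real C ≤ 1 := measureReal_le_one
  have hp0 : 0 ≤ (gwChild x).real C := measureReal_nonneg
  rw [h2, tsum_mul_left, tsum_geometric_of_lt_one (by positivity) (by linarith)]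
  have : (2 - (gwChild x).real C) ≠ 0 := by linarith
  have h3 : 1 - 2⁻¹ * (gwChild x).real C = (2 - (gwChild x).real C) * 2⁻¹ := by ring
  rw [h3, mul_inv, inv_inv]
  field_simp

theorem gwChild_real (x : ℤ) {C : Set LTree} (hC : MeasurableSet C) :
    (gwChild x).real C = ((gw (x - 1)).real C + (gw x).real C + (gw (x + 1)).real C) / 3 := by
  rw [measureReal_def, gwChild_apply x hC, ENNReal.toReal_div, ENNReal.toReal_add (by simp) (by simp),
    ENNReal.toReal_add (by simp) (by simp)]
  rfl

/-! ### Elementary properties of Galton-Watson trees -/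

theorem ae_gw_of_forall {x : ℤ} {p : LTree → Prop} (hp : MeasurableSet {t | p t})
    (h : ∀ ω, p (gwTree x ω)) : ∀ᵐ t ∂(gw x), p t := by
  rw [gw_eq_map, ae_map_iff (measurable_gwTree x).aemeasurable hp]
  exact ae_of_all _ h

theorem gw_rootLabel (x : ℤ) : ∀ᵐ t ∂(gw x), t.rootLabel = x :=
  ae_gw_of_forall (measurable_rootLabel (measurableSet_singleton x)) fun _ => rfl

theorem measurableSet_wellLabeled : MeasurableSet {t : LTree | t.WellLabeled} := by
  have : {t : LTree | t.WellLabeled} = ⋂ u : List ℕ, ⋂ i : ℕ, ⋂ x : ℤ, ⋂ y : ℤ,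
      {t | t.lab u = some x → t.lab (u ++ [i]) = some y → |y - x| ≤ 1} := by
    ext t; simp [WellLabeled]
  rw [this]
  refine MeasurableSet.iInter fun u => MeasurableSet.iInter fun i => MeasurableSet.iInter fun x =>
    MeasurableSet.iInter fun y => measurableSet_of_close (u.length + 2) fun t t' h ht hx hy => ?_
  exact ht (by rw [h u (by omega), hx]) (by rw [h (u ++ [i]) (by simp), hy])

theorem gw_wellLabeled (x : ℤ) : ∀ᵐ t ∂(gw x), t.WellLabeled := by
  refine ae_gw_of_forall measurableSet_wellLabeled fun ω => ?_
  have step : ∀ u i y z (x : ℤ) (ω : List ℕ → ℕ × Fin 3), gwLab x ω u = some y →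
      gwLab x ω (u ++ [i]) = some z → |z - y| ≤ 1 := by
    intro u i y z
    induction u with
    | nil =>
      intro x ω hy hz
      simp only [gwLab, Option.some.injEq, List.nil_append] at hy hz
      split_ifs at hz with h
      subst hy
      have := (ω [i]).2.isLt
      simp only [Option.some.injEq] at hz
      rw [abs_le]; omega
    | cons a w ih =>
      intro x ω hy hz
      rw [List.cons_append] at hz
      rw [gwLab] at hy hz
      split_ifs at hy hz with h
      exact ih _ _ hy hz
  exact fun u i y z hy hz => step u i y z x ω hy hz

theorem gw_map_addLabel (x k : ℤ) : (gw x).map (addLabel k) = gw (x + k) := by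
  rw [gw_eq_map, gw_eq_map, Measure.map_map (continuous_addLabel k).measurable (measurable_gwTree x)]
  congr 1
  funext ω
  ext1; funext u
  change (gwLab x ω u).map (· + k) = gwLab (x + k) ω u
  induction u generalizing x ω with
  | nil => rfl
  | cons a w ih =>
    rw [gwLab, gwLab]
    split_ifs
    · rw [ih]; congr 1; ring
    · rfl

/-- Labels play no role, so the probabilities satisfy `q_{n+1} = 1/(2 - q_n)` with `q_0 = 0`. -/
theorem gw_heightLT (x : ℤ) (n : ℕ) : (gw x).real {t | t.HeightLT n} = n / (n + 1) := by
  induction n generalizing x with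
  | zero =>
    have : {t : LTree | t.HeightLT 0} = ∅ := by
      ext t; simpa using not_heightLT_zero t
    simp [this]
  | succ n ih =>
    have : {t : LTree | t.HeightLT (n + 1)} =
        {t : LTree | ∀ c ∈ t.children, c ∈ {c : LTree | c.HeightLT n}} := by
      ext t
      rw [Set.mem_ofPred_eq, ← node_children t, heightLT_succ_node]
      simp
    have h := gw_forall_children x (measurableSet_heightLT n)
    rw [← this, gwChild_real x (measurableSet_heightLT n), ih, ih, ih] at h
    have : (0 : ℝ) < n + 1 := by positivity
    have h2 : (2 - ((n : ℝ) / (n + 1) + n / (n + 1) + n / (n + 1)) / 3) = (n + 2) / (n + 1) := by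
      field_simp; ring
    rw [h2] at h
    push_cast
    field_simp at h ⊢
    linarith

theorem gw_isFinite (x : ℤ) : ∀ᵐ t ∂(gw x), t.IsFinite := by
  have h : ∀ n : ℕ, (gw x).real {t | ¬ t.IsFinite} ≤ 1 / ((n : ℝ) + 1) := by
    intro n
    have h1 : (gw x).real {t | t.HeightLT n}ᶜ = 1 - n / (n + 1) := by
      rw [probReal_compl_eq_one_sub (measurableSet_heightLT n), gw_heightLT]
    have h2 : (1 : ℝ) - n / (n + 1) = 1 / (n + 1) := by field_simp; ring
    rw [← h2, ← h1]
    exact measureReal_mono fun t ht h => ht ⟨n, h⟩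
  have h0 : (gw x).real {t | ¬ t.IsFinite} = 0 :=
    le_antisymm (ge_of_tendsto' tendsto_one_div_add_atTop_nhds_zero_nat h) measureReal_nonneg
  rwa [measureReal_eq_zero_iff] at h0

/-- The distance is ultrametric: two such sets with a common point are nested. -/
theorem isPiSystem_close : IsPiSystem {S | ∃ d b, S = {t | Close d t b}} := by
  rintro _ ⟨d, b, rfl⟩ _ ⟨e, b', rfl⟩ ⟨t, h1, h2⟩
  rcases le_total d e with h | h
  · refine ⟨e, b', Set.inter_eq_right.2 fun s hs => ?_⟩
    exact ((Close.trans hs h2.symm).mono h).trans h1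
  · refine ⟨d, b, Set.inter_eq_left.2 fun s hs => ?_⟩
    exact ((Close.trans hs h1.symm).mono h).trans h2

theorem generateFrom_close :
    (inferInstance : MeasurableSpace LTree) =
      MeasurableSpace.generateFrom {S | ∃ d b, S = {t | Close d t b}} := by
  refine TopologicalSpace.IsTopologicalBasis.borel_eq_generateFrom ?_
  refine TopologicalSpace.isTopologicalBasis_of_isOpen_of_nhds ?_ ?_
  · rintro _ ⟨d, b, rfl⟩
    exact isOpen_of_close fun t ht => ⟨d, fun t' h => h.symm.trans ht⟩
  · intro t U ht hU
    obtain ⟨d, hd⟩ := exists_close_of_isOpen hU ht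
    exact ⟨_, ⟨d, t, rfl⟩, Close.refl d t, fun s hs => hd s (Close.symm hs)⟩

theorem ext_of_close {μ ν : Measure LTree} [IsProbabilityMeasure μ] [IsProbabilityMeasure ν]
    (h : ∀ d b, μ {t | Close d t b} = ν {t | Close d t b}) : μ = ν :=
  ext_of_generate_finite _ generateFrom_close isPiSystem_close
    (by rintro _ ⟨d, b, rfl⟩; exact h d b) (by simp)

/-- By induction on the depth: the probability of a list of children is a product, which is
insensitive to the reversal of the list. -/
theorem gw_map_mirror (x : ℤ) : (gw x).map mirror = gw x := by
  have : IsProbabilityMeasure ((gw x).map mirror) :=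
    Measure.isProbabilityMeasure_map continuous_mirror.measurable.aemeasurable
  refine ext_of_close fun d b => ?_
  rw [Measure.map_apply continuous_mirror.measurable (measurableSet_close d b)]
  change gw x {t | Close d t.mirror b} = _
  clear this
  induction d generalizing x b with
  | zero => simp [close_zero]
  | succ d ih =>
    obtain ⟨y, bs, rfl⟩ := b.exists_eq_node
    cases d with
    | zero =>
      congr 1; ext t
      obtain ⟨z, cs, rfl⟩ := t.exists_eq_node
      simp only [Set.mem_ofPred_eq, mirror_node, zero_add, close_one_node]
    | succ d =>
      by_cases hxy : x = y
      · subst hxy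
        have h1 : gw x {t | Close (d + 1 + 1) t.mirror (node x bs)} =
            gw x {t | List.Forall₂ (fun c C => c ∈ C) t.children
              (bs.reverse.map fun b => {c | Close (d + 1) c.mirror b})} := by
          refine measure_congr ((gw_rootLabel x).mono fun t ht => ?_)
          obtain ⟨z, cs, rfl⟩ := t.exists_eq_node
          obtain rfl : z = x := ht
          refine propext ?_
          change Close (d + 1 + 1) _ _ ↔ List.Forall₂ _ _ _
          rw [mirror_node, close_add_two_node, List.forall₂_map_right_iff, children_node,
            ← List.forall₂_reverse_iff, List.reverse_reverse, List.forall₂_map_left_iff]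
          simp
        have h2 : gw x {t | Close (d + 1 + 1) t (node x bs)} =
            gw x {t | List.Forall₂ (fun c C => c ∈ C) t.children
              (bs.map fun b => {c | Close (d + 1) c b})} := by
          refine measure_congr ((gw_rootLabel x).mono fun t ht => ?_)
          obtain ⟨z, cs, rfl⟩ := t.exists_eq_node
          obtain rfl : z = x := ht
          refine propext ?_
          change Close (d + 1 + 1) _ _ ↔ List.Forall₂ _ _ _
          rw [close_add_two_node, List.forall₂_map_right_iff, children_node]
          simp
        have hm : ∀ b, MeasurableSet {c : LTree | Close (d + 1) c.mirror b} := fun b =>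
          continuous_mirror.measurable (measurableSet_close (d + 1) b)
        have e : ∀ b, gwChild x {c | Close (d + 1) c.mirror b} =
            gwChild x {c | Close (d + 1) c b} := fun b => by
          rw [gwChild_apply x (hm b), gwChild_apply x (measurableSet_close _ _), ih, ih, ih]
        rw [h1, h2, gw_forall₂_children, gw_forall₂_children]
        · simp only [List.map_map, Function.comp_def, List.length_map, List.length_reverse, e,
            List.map_reverse, List.prod_reverse]
        · intro C hC
          obtain ⟨b, -, rfl⟩ := List.mem_map.1 hC
          exact measurableSet_close _ _
        · intro C hC
          obtain ⟨b, -, rfl⟩ := List.mem_map.1 hC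
          exact hm b
      · have h1 : ∀ᵐ t ∂(gw x), t ∉ {t : LTree | Close (d + 1 + 1) t.mirror (node y bs)} := by
          filter_upwards [gw_rootLabel x] with t ht h
          exact hxy (ht ▸ Close.rootLabel_eq h)
        have h2 : ∀ᵐ t ∂(gw x), t ∉ {t : LTree | Close (d + 1 + 1) t (node y bs)} := by
          filter_upwards [gw_rootLabel x] with t ht h
          exact hxy (ht ▸ Close.rootLabel_eq h)
        rw [measure_eq_zero_iff_ae_notMem.2 h1, measure_eq_zero_iff_ae_notMem.2 h2]

/-! ### The probability that all labels are positive -/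

/-- A maximum principle on the nonnegative integers. -/
theorem eq_zero_of_abs_le_average {D c : ℕ → ℝ} (h0 : D 0 = 0) (hlim : Tendsto D atTop (𝓝 0))
    (hc : ∀ n, c (n + 1) < 1) (hc0 : ∀ n, 0 ≤ c (n + 1))
    (h : ∀ n, |D (n + 1)| ≤ c (n + 1) * ((|D n| + |D (n + 1)| + |D (n + 2)|) / 3)) (n : ℕ) :
    D n = 0 := by
  by_contra hn
  have hpos : 0 < |D n| := abs_pos.2 hn
  have hlim' : Tendsto (fun m => |D m|) atTop (𝓝 0) := by simpa using hlim.abs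
  obtain ⟨N, hN⟩ := eventually_atTop.1 (hlim'.eventually (gt_mem_nhds hpos))
  -- Beyond `N` the values are smaller than `|D n|`, so the maximum over this finite range is a
  -- global one. At a positive global maximum, the factor `c < 1` contradicts the averaging
  -- inequality.
  obtain ⟨z, hz, hmax⟩ := Finset.exists_max_image (Finset.range (N + n + 1)) (fun m => |D m|)
    ⟨n, by simp⟩
  have hnz : |D n| ≤ |D z| := hmax n (by simp)
  have hall : ∀ m, |D m| ≤ |D z| := by
    intro m
    by_cases hm : m < N + n + 1
    · exact hmax m (by simpa using hm)
    · exact (hN m (by omega)).le.trans hnz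
  have hz0 : 0 < |D z| := hpos.trans_le hnz
  cases z with
  | zero => simp [h0] at hz0
  | succ z =>
    have h1 := h z
    have h2 := hall z
    have h3 := hall (z + 2)
    have h4 : c (z + 1) * ((|D z| + |D (z + 1)| + |D (z + 2)|) / 3) ≤ c (z + 1) * |D (z + 1)| :=
      mul_le_mul_of_nonneg_left (by linarith) (hc0 z)
    have h5 : c (z + 1) * |D (z + 1)| < 1 * |D (z + 1)| := mul_lt_mul_of_pos_right (hc z) hz0
    linarith

/-- The probability that all labels are positive, for a root label `x ≥ 0`. -/
noncomputable def posProb (x : ℝ) : ℝ := x * (x + 3) / ((x + 1) * (x + 2))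

theorem posProb_lt_one {x : ℝ} (hx : 0 ≤ x) : posProb x < 1 := by
  rw [posProb, div_lt_one (by positivity)]
  nlinarith

theorem posProb_nonneg {x : ℝ} (hx : 0 ≤ x) : 0 ≤ posProb x := by
  unfold posProb; positivity

theorem posProb_pos {x : ℝ} (hx : 0 < x) : 0 < posProb x := by
  unfold posProb; positivity

theorem one_sub_posProb {x : ℝ} (hx : 0 ≤ x) : 1 - posProb x = 2 / ((x + 1) * (x + 2)) := by
  unfold posProb
  field_simp
  ring

/-- The explicit function satisfies `w = 1/(2 - average of w)`, the equation that
`gw_forall_children` imposes on the probability of positivity. -/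
theorem posProb_succ_mul {x : ℝ} (hx : 0 ≤ x) :
    posProb (x + 1) * (2 - (posProb x + posProb (x + 1) + posProb (x + 2)) / 3) = 1 := by
  unfold posProb
  field_simp
  ring

theorem gw_positive_of_nonpos {x : ℤ} (hx : x ≤ 0) : gw x {t | t.Positive} = 0 := by
  rw [measure_eq_zero_iff_ae_notMem]
  filter_upwards [gw_rootLabel x] with t ht h
  have := h [] t.rootLabel t.lab_nil
  omega

/-- The trees with positive labels up to height `n`. -/
def posUpTo : ℕ → Set LTree
  | 0 => {t | 0 < t.rootLabel}
  | n + 1 => {t | 0 < t.rootLabel ∧ ∀ c ∈ t.children, c ∈ posUpTo n}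

theorem measurableSet_posUpTo (n : ℕ) : MeasurableSet (posUpTo n) := by
  induction n with
  | zero => exact measurable_rootLabel measurableSet_Ioi
  | succ n ih => exact (measurable_rootLabel measurableSet_Ioi).inter (measurableSet_forall_children ih)

theorem posUpTo_succ_subset (n : ℕ) : posUpTo (n + 1) ⊆ posUpTo n := by
  induction n with
  | zero => exact fun t ht => ht.1
  | succ n ih => exact fun t ht => ⟨ht.1, fun c hc => ih (ht.2 c hc)⟩

theorem positive_iff_children {t : LTree} :
    t.Positive ↔ 0 < t.rootLabel ∧ ∀ c ∈ t.children, c.Positive := by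
  rw [← positive_node, node_children]

theorem setOf_positive_eq_iInter : {t : LTree | t.Positive} = ⋂ n, posUpTo n := by
  ext t
  rw [Set.mem_iInter]
  constructor
  · intro h n
    rw [Set.mem_ofPred_eq, positive_iff_children] at h
    induction n generalizing t with
    | zero => exact h.1
    | succ n ih => exact ⟨h.1, fun c hc => ih c (positive_iff_children.1 (h.2 c hc))⟩
  · intro h u x hu
    have key : ∀ u (t : LTree), t ∈ posUpTo u.length → ∀ x, t.lab u = some x → 0 < x := by
      intro u
      induction u with
      | nil =>
        intro t ht x hx
        rw [lab_nil, Option.some.injEq] at hx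
        exact hx ▸ ht
      | cons a w ih =>
        intro t ht x hx
        obtain ⟨y, cs, rfl⟩ := t.exists_eq_node
        have hcs := ht.2
        rw [children_node] at hcs
        by_cases ha : a < cs.length
        · exact ih _ (hcs _ (List.getElem_mem ha)) x (by simpa [ha] using hx)
        · simp [ha] at hx
    exact key u t (h _) x hu

theorem gw_real_mul_of_children {x : ℤ} (hx : 0 < x) {S C : Set LTree} (hC : MeasurableSet C)
    (h : ∀ t, t ∈ S ↔ 0 < t.rootLabel ∧ ∀ c ∈ t.children, c ∈ C) :
    (gw x).real S *
      (2 - ((gw (x - 1)).real C + (gw x).real C + (gw (x + 1)).real C) / 3) = 1 := by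
  have : (gw x).real S = (gw x).real {t | ∀ c ∈ t.children, c ∈ C} := by
    refine measureReal_congr ((gw_rootLabel x).mono fun t ht => propext ?_)
    exact (h t).trans (and_iff_right (by rw [ht]; exact hx))
  rw [this, ← gwChild_real x hC, gw_forall_children x hC]

/-- The probabilities for `posUpTo n` are the iterates, started from `1` at positive labels, of an
increasing map that fixes `posProb`; they stay above the fixed point. This bound forces the
probability of positivity to tend to `1`, the boundary condition at infinity needed for uniqueness.
-/
theorem le_gw_posUpTo (n m : ℕ) : posProb m ≤ (gw m).real (posUpTo n) := by
  induction n generalizing m with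
  | zero =>
    cases m with
    | zero => simp [posProb]
    | succ m =>
      have : (gw (m + 1 : ℕ)).real (posUpTo 0) = 1 := by
        rw [measureReal_def, ENNReal.toReal_eq_one_iff, ← mem_ae_iff_prob_eq_one₀
          (measurableSet_posUpTo 0).nullMeasurableSet]
        filter_upwards [gw_rootLabel (m + 1 : ℕ)] with t ht
        change 0 < t.rootLabel
        rw [ht]; positivity
      rw [this]
      exact (posProb_lt_one (by positivity)).le
  | succ n ih =>
    cases m with
    | zero => simp [posProb]
    | succ m =>
      have h := gw_real_mul_of_children (x := (m + 1 : ℕ)) (by positivity)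
        (measurableSet_posUpTo n) (S := posUpTo (n + 1)) fun t => Iff.rfl
      have h1 := ih m
      have h2 := ih (m + 1)
      have h3 := ih (m + 2)
      push_cast at h h1 h2 h3 ⊢
      rw [add_sub_cancel_right, show (m : ℤ) + 1 + 1 = m + 2 by ring] at h
      have h4 := posProb_succ_mul (x := (m : ℝ)) (by positivity)
      have h5 : 0 < posProb ((m : ℝ) + 1) := posProb_pos (by positivity)
      have h6 : (0 : ℝ) ≤ (gw ((m : ℤ) + 1)).real (posUpTo (n + 1)) := measureReal_nonneg
      set a := (posProb m + posProb (m + 1 : ℝ) + posProb (m + 2 : ℝ)) / 3 with ha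
      set b := ((gw (m : ℤ)).real (posUpTo n) + (gw ((m : ℤ) + 1)).real (posUpTo n) +
        (gw ((m : ℤ) + 2)).real (posUpTo n)) / 3 with hb
      have hab : a ≤ b := by rw [ha, hb]; linarith
      by_contra! hlt
      have h8 : (0 : ℝ) < 2 - b := by
        by_contra! hb'
        have := mul_nonpos_of_nonneg_of_nonpos h6 hb'
        linarith
      have h9 := mul_lt_mul_of_pos_right hlt h8
      have h10 := mul_le_mul_of_nonneg_left (show 2 - b ≤ 2 - a by linarith) h5.le
      linarith

/-- The probability that all labels of a Galton-Watson tree are positive. -/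
theorem gw_positive (n : ℕ) : (gw n).real {t | t.Positive} = posProb n := by
  have hle : ∀ m : ℕ, posProb m ≤ (gw m).real {t | t.Positive} := by
    intro m
    rw [setOf_positive_eq_iInter]
    have := tendsto_measure_iInter_atTop (μ := gw m) (s := posUpTo)
      (fun n => (measurableSet_posUpTo n).nullMeasurableSet)
      (antitone_nat_of_succ_le posUpTo_succ_subset) ⟨0, measure_ne_top _ _⟩
    exact ge_of_tendsto' ((ENNReal.tendsto_toReal (measure_ne_top _ _)).comp this)
      fun n => le_gw_posUpTo n m
  have h := eq_zero_of_abs_le_average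
    (D := fun m : ℕ => (gw m).real {t | t.Positive} - posProb m) (c := fun m => posProb m) ?_ ?_ ?_
    ?_ ?_ n
  · linarith
  · simp [posProb, measureReal_def, gw_positive_of_nonpos (le_refl (0 : ℤ))]
  · have hz : Tendsto (fun m : ℕ => 2 * (1 / ((m : ℝ) + 1))) atTop (𝓝 0) := by
      simpa using tendsto_one_div_add_atTop_nhds_zero_nat.const_mul (2 : ℝ)
    refine squeeze_zero (fun m => sub_nonneg.2 (hle m)) (fun m => ?_) hz
    have h1 : (gw m).real {t | t.Positive} ≤ 1 := measureReal_le_one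
    have h2 := one_sub_posProb (x := (m : ℝ)) (by positivity)
    have h3 : 2 / (((m : ℝ) + 1) * (m + 2)) ≤ 2 * (1 / ((m : ℝ) + 1)) := by
      rw [← div_div, mul_one_div]
      exact div_le_self (by positivity) (by linarith [Nat.cast_nonneg (α := ℝ) m])
    linarith
  · exact fun m => posProb_lt_one (by positivity)
  · exact fun m => posProb_nonneg (by positivity)
  · intro m
    have h := gw_real_mul_of_children (x := (m + 1 : ℕ)) (by positivity)
      measurableSet_positive (S := {t | t.Positive}) fun t => positive_iff_children
    have h4 := posProb_succ_mul (x := (m : ℝ)) (by positivity)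
    have h5 : 0 ≤ posProb ((m : ℝ) + 1) := posProb_nonneg (by positivity)
    have h6 : (0 : ℝ) ≤ (gw ((m : ℤ) + 1)).real {t | t.Positive} := measureReal_nonneg
    have h7 : (gw ((m : ℤ) + 1)).real {t | t.Positive} ≤ 1 := measureReal_le_one
    push_cast at h ⊢
    rw [add_sub_cancel_right, show (m : ℤ) + 1 + 1 = m + 2 by ring] at h
    set W0 := (gw (m : ℤ)).real {t | t.Positive}
    set W1 := (gw ((m : ℤ) + 1)).real {t | t.Positive}
    set W2 := (gw ((m : ℤ) + 2)).real {t | t.Positive}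
    -- Both terms are inverses of `2 - average`. The difference of two inverses is their product
    -- times the difference of the averages, which is the contraction required by the maximum
    -- principle.
    have e : W1 - posProb (m + 1 : ℝ) = posProb (m + 1 : ℝ) * (W1 * (((W0 - posProb m) +
        (W1 - posProb (m + 1 : ℝ)) + (W2 - posProb (m + 2 : ℝ))) / 3)) := by
      linear_combination posProb (m + 1 : ℝ) * h - W1 * h4
    conv_lhs => rw [e, abs_mul, abs_of_nonneg h5]
    refine mul_le_mul_of_nonneg_left ?_ h5
    rw [abs_mul, abs_of_nonneg h6, abs_div, abs_of_pos (show (0 : ℝ) < 3 by norm_num)]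
    refine (mul_le_of_le_one_left (by positivity) h7).trans ?_
    gcongr
    exact abs_add_three _ _ _

theorem gw_not_positive (n : ℕ) : (gw n).real {t | ¬ t.Positive} = 1 - posProb n := by
  rw [← gw_positive n, ← probReal_compl_eq_one_sub measurableSet_positive]
  rfl

/-! ### The law of the ancestral line of the first zero, as a Doob transform. -/

/-! ### The ancestral line of the first vertex with label `0` -/

/-- A label and a pair of trees satisfy the specification `e`. -/
def Fits (e : ℤ × Set LTree × Set LTree) (d : ℤ × LTree × LTree) : Prop :=
  d.1 = e.1 ∧ d.2.1 ∈ e.2.1 ∧ d.2.2 ∈ e.2.2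

/-- The trees in which the first vertex with label `0` has height `n + m` and in which its first
ancestors, up to the `n`-th one, fit the specifications `e`. -/
def hitSetAt (e : ℕ → ℤ × Set LTree × Set LTree) (n m : ℕ) : Set LTree :=
  {t | ∃ l1 l2, HitDec t (l1 ++ l2) ∧ l1.length = m ∧ List.Forall₂ Fits (revList e n) l2}

/-- The trees that have a first vertex with label `0`, the first ancestors of which, up to the
`n`-th one, fit the specifications `e`. -/
def hitSet (e : ℕ → ℤ × Set LTree × Set LTree) (n : ℕ) : Set LTree :=
  {t | ∃ l1 l2, HitDec t (l1 ++ l2) ∧ List.Forall₂ Fits (revList e n) l2}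

theorem hitSet_eq_iUnion (e : ℕ → ℤ × Set LTree × Set LTree) (n : ℕ) :
    hitSet e n = ⋃ m, hitSetAt e n m := by
  ext t
  simp only [hitSet, hitSetAt, Set.mem_iUnion, Set.mem_ofPred_eq]
  exact ⟨fun ⟨l1, l2, h, h'⟩ => ⟨_, l1, l2, h, rfl, h'⟩,
    fun ⟨_, l1, l2, h, _, h'⟩ => ⟨l1, l2, h, h'⟩⟩

theorem hitSet_subset (e : ℕ → ℤ × Set LTree × Set LTree) (n : ℕ) :
    hitSet e n ⊆ {t | ¬ t.Positive} := fun _ ⟨_, _, h, _⟩ => h.not_positive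

theorem hitSetAt_subset (e : ℕ → ℤ × Set LTree × Set LTree) (n m : ℕ) :
    hitSetAt e n m ⊆ {t | ¬ t.Positive} := fun _ ⟨_, _, h, _⟩ => h.not_positive

theorem hitDec_singleton {t : LTree} {d : ℤ × LTree × LTree} (h : HitDec t [d]) :
    t.rootLabel = 0 ∧ d = (0, t, node 0 []) := by
  cases h with
  | root _ h => exact ⟨h, rfl⟩
  | child x bs c cs l hx hb hc => cases hc

theorem hitDec_cons_cons {t : LTree} {d d' : ℤ × LTree × LTree} {l : List (ℤ × LTree × LTree)}
    (h : HitDec t (d :: d' :: l)) : ∃ x bs c cs, t = node x (bs ++ c :: cs) ∧ 0 < x ∧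
      (∀ b ∈ bs, b.Positive) ∧ HitDec c (d' :: l) ∧ d = (x, node x cs, node x bs) := by
  cases h with
  | child x bs c cs l hx hb hc => exact ⟨x, bs, c, cs, rfl, hx, hb, hc, rfl⟩

theorem revList_ne_nil {α : Type*} (f : ℕ → α) (n : ℕ) : revList f n ≠ [] := by
  cases n <;> simp [revList]

theorem hitSetAt_zero_zero (e : ℕ → ℤ × Set LTree × Set LTree) :
    hitSetAt e 0 0 = {t | t.rootLabel = 0 ∧ Fits (e 0) (0, t, node 0 [])} := by
  ext t
  constructor
  · rintro ⟨l1, l2, h, h1, h2⟩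
    obtain rfl := List.length_eq_zero_iff.1 h1
    rw [revList, List.forall₂_cons_left_iff] at h2
    obtain ⟨d, l, hd, hl, rfl⟩ := h2
    obtain rfl := List.forall₂_nil_left_iff.1 hl
    obtain ⟨h', rfl⟩ := hitDec_singleton h
    exact ⟨h', hd⟩
  · rintro ⟨h, hd⟩
    exact ⟨[], [_], .root t h, rfl, .cons hd .nil⟩

/-- Here the root is the topmost prescribed ancestor. As in `HitDec`, the second component of `e`
describes the right of the line, and the third one the left, where positivity comes from `v` being
the first zero. -/
theorem hitSetAt_succ_zero (e : ℕ → ℤ × Set LTree × Set LTree) (n : ℕ) :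
    hitSetAt e (n + 1) 0 = {t | t.rootLabel = (e (n + 1)).1 ∧ 0 < t.rootLabel} ∩
      splitSet ((e (n + 1)).2.2 ∩ {t | t.Positive}) (hitSetAt e n 0) (e (n + 1)).2.1 := by
  ext t
  constructor
  · rintro ⟨l1, l2, h, h1, h2⟩
    obtain rfl := List.length_eq_zero_iff.1 h1
    rw [revList, List.forall₂_cons_left_iff] at h2
    obtain ⟨d, l, hd, hl, rfl⟩ := h2
    cases l with
    | nil => exact absurd (List.forall₂_nil_right_iff.1 hl) (revList_ne_nil e n)
    | cons d' l =>
      obtain ⟨x, bs, c, cs, rfl, hx, hb, hc, rfl⟩ := hitDec_cons_cons h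
      exact ⟨⟨hd.1, hx⟩, x, bs, c, cs, rfl, ⟨hd.2.2, positive_node.2 ⟨hx, hb⟩⟩,
        ⟨[], _, hc, rfl, hl⟩, hd.2.1⟩
  · rintro ⟨⟨h1, hx⟩, x, bs, c, cs, rfl, ⟨hB, hb⟩, ⟨l1, l2, hc, hl1, hl⟩, hA⟩
    obtain rfl := List.length_eq_zero_iff.1 hl1
    exact ⟨[], _, .child x bs c cs _ hx (positive_node.1 hb).2 hc, rfl, .cons ⟨h1, hA, hB⟩ hl⟩

theorem hitSetAt_succ (e : ℕ → ℤ × Set LTree × Set LTree) (n m : ℕ) :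
    hitSetAt e n (m + 1) = {t | 0 < t.rootLabel} ∩
      splitSet {t | t.Positive} (hitSetAt e n m) Set.univ := by
  ext t
  constructor
  · rintro ⟨l1, l2, h, h1, h2⟩
    cases l1 with
    | nil => simp at h1
    | cons d l1 =>
      rw [List.cons_append] at h
      cases hl : l1 ++ l2 with
      | nil =>
        obtain ⟨-, rfl⟩ := List.append_eq_nil_iff.1 hl
        exact absurd (List.forall₂_nil_right_iff.1 h2) (revList_ne_nil e n)
      | cons d' l =>
        rw [hl] at h
        obtain ⟨x, bs, c, cs, rfl, hx, hb, hc, rfl⟩ := hitDec_cons_cons h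
        rw [← hl] at hc
        exact ⟨hx, x, bs, c, cs, rfl, positive_node.2 ⟨hx, hb⟩,
          ⟨l1, l2, hc, by simpa using h1, h2⟩, trivial⟩
  · rintro ⟨hx, x, bs, c, cs, rfl, hb, ⟨l1, l2, hc, hl1, hl⟩, -⟩
    exact ⟨_ :: l1, l2, .child x bs c cs _ hx (positive_node.1 hb).2 hc, by simp [hl1], hl⟩

/-- The root either is the topmost prescribed ancestor, or is an ancestor without constraint, and
then its child on the line satisfies the same event. This self-similarity produces a linear equation
in the root label. -/
theorem hitSet_eq_union (e : ℕ → ℤ × Set LTree × Set LTree) (n : ℕ) :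
    hitSet e n = hitSetAt e n 0 ∪ {t | 0 < t.rootLabel} ∩
      splitSet {t | t.Positive} (hitSet e n) Set.univ := by
  have h : ∀ t, t ∈ splitSet {t | t.Positive} (hitSet e n) Set.univ ↔
      ∃ m, t ∈ splitSet {t | t.Positive} (hitSetAt e n m) Set.univ := by
    intro t
    rw [hitSet_eq_iUnion]
    constructor
    · rintro ⟨x, bs, c, cs, h1, h2, h3, h4⟩
      obtain ⟨m, hm⟩ := Set.mem_iUnion.1 h3
      exact ⟨m, x, bs, c, cs, h1, h2, hm, h4⟩
    · rintro ⟨m, x, bs, c, cs, h1, h2, h3, h4⟩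
      exact ⟨x, bs, c, cs, h1, h2, Set.mem_iUnion.2 ⟨m, h3⟩, h4⟩
  ext t
  rw [Set.mem_union, Set.mem_inter_iff, h]
  conv_lhs => rw [hitSet_eq_iUnion, Set.mem_iUnion]
  constructor
  · rintro ⟨m, hm⟩
    cases m with
    | zero => exact .inl hm
    | succ m =>
      rw [hitSetAt_succ] at hm
      exact .inr ⟨hm.1, m, hm.2⟩
  · rintro (hm | ⟨h1, m, hm⟩)
    · exact ⟨0, hm⟩
    · exact ⟨m + 1, by rw [hitSetAt_succ]; exact ⟨h1, hm⟩⟩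

/-- The decomposition is unique, and its length determines the number of ancestors above the
prescribed ones. -/
theorem hitSetAt_disjoint (e : ℕ → ℤ × Set LTree × Set LTree) (n : ℕ) {m m' : ℕ} (h : m ≠ m') :
    Disjoint (hitSetAt e n m) (hitSetAt e n m') := by
  refine Set.disjoint_left.2 fun t ht ht' => h ?_
  obtain ⟨l1, l2, h1, rfl, h2⟩ := ht
  obtain ⟨l1', l2', h1', rfl, h2'⟩ := ht'
  have e1 := congrArg List.length (h1.unique h1')
  have e2 := h2.length_eq
  have e3 := h2'.length_eq
  simp only [List.length_append] at e1
  omega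

/-- Different specifications at the same heights define disjoint sets of trees, unless they are
compatible. -/
theorem exists_fits_of_mem_hitSet {e e' : ℕ → ℤ × Set LTree × Set LTree} {n : ℕ} {t : LTree}
    (h : t ∈ hitSet e n) (h' : t ∈ hitSet e' n) :
    ∀ i ≤ n, ∃ d, Fits (e i) d ∧ Fits (e' i) d := by
  obtain ⟨l1, l2, h1, h2⟩ := h
  obtain ⟨l1', l2', h1', h2'⟩ := h'
  have hl : l2.length = l2'.length := by
    rw [← h2.length_eq, ← h2'.length_eq, length_revList, length_revList]
  obtain ⟨-, rfl⟩ := List.append_inj' (h1.unique h1') hl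
  have key : ∀ (l : List (ℤ × LTree × LTree)) (a b : List (ℤ × Set LTree × Set LTree)),
      List.Forall₂ Fits a l → List.Forall₂ Fits b l →
      List.Forall₂ (fun e e' => ∃ d, Fits e d ∧ Fits e' d) a b := by
    intro l
    induction l with
    | nil =>
      intro a b ha hb
      obtain rfl := List.forall₂_nil_right_iff.1 ha
      obtain rfl := List.forall₂_nil_right_iff.1 hb
      exact .nil
    | cons d l ih =>
      intro a b ha hb
      obtain ⟨a, as, h1, h2, rfl⟩ := List.forall₂_cons_right_iff.1 ha
      obtain ⟨b, bs, h1', h2', rfl⟩ := List.forall₂_cons_right_iff.1 hb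
      exact .cons ⟨d, h1, h1'⟩ (ih _ _ h2 h2')
  exact forall₂_revList.1 (key _ _ _ h2 h2')

theorem measurableSet_hitSetAt {e : ℕ → ℤ × Set LTree × Set LTree}
    (hA : ∀ i, MeasurableSet (e i).2.1) (hB : ∀ i, MeasurableSet (e i).2.2) (n m : ℕ) :
    MeasurableSet (hitSetAt e n m) := by
  induction m with
  | succ m ih =>
    rw [hitSetAt_succ]
    exact (measurable_rootLabel measurableSet_Ioi).inter
      (measurableSet_splitSet measurableSet_positive ih .univ)
  | zero =>
    induction n with
    | zero =>
      have : hitSetAt e 0 0 = {t | t.rootLabel = 0} ∩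
          ({_t | 0 = (e 0).1} ∩ ((e 0).2.1 ∩ {_t | node 0 [] ∈ (e 0).2.2})) := by
        rw [hitSetAt_zero_zero]; rfl
      rw [this]
      exact (measurable_rootLabel (measurableSet_singleton 0)).inter
        ((MeasurableSet.const _).inter ((hA 0).inter (MeasurableSet.const _)))
    | succ n ih =>
      rw [hitSetAt_succ_zero]
      refine MeasurableSet.inter (MeasurableSet.inter (measurable_rootLabel
        (measurableSet_singleton _)) (measurable_rootLabel measurableSet_Ioi)) ?_
      exact measurableSet_splitSet ((hB _).inter measurableSet_positive) ih (hA _)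

theorem measurableSet_hitSet {e : ℕ → ℤ × Set LTree × Set LTree}
    (hA : ∀ i, MeasurableSet (e i).2.1) (hB : ∀ i, MeasurableSet (e i).2.2) (n : ℕ) :
    MeasurableSet (hitSet e n) := by
  rw [hitSet_eq_iUnion]
  exact MeasurableSet.iUnion fun m => measurableSet_hitSetAt hA hB n m

theorem rootLabel_of_mem_hitSetAt_zero {e : ℕ → ℤ × Set LTree × Set LTree} {n : ℕ} {t : LTree}
    (h : t ∈ hitSetAt e n 0) : t.rootLabel = (e n).1 := by
  cases n with
  | zero => rw [hitSetAt_zero_zero] at h; rw [h.1]; exact h.2.1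
  | succ n => rw [hitSetAt_succ_zero] at h; exact h.1.1

theorem gw_hitSetAt_zero_of_ne {e : ℕ → ℤ × Set LTree × Set LTree} {n : ℕ} {z : ℤ}
    (hz : z ≠ (e n).1) : (gw z).real (hitSetAt e n 0) = 0 := by
  rw [measureReal_eq_zero_iff, measure_eq_zero_iff_ae_notMem]
  filter_upwards [gw_rootLabel z] with t ht h
  exact hz (ht ▸ rootLabel_of_mem_hitSetAt_zero h)

/-- A root label that is positive can be added to the description of an event. -/
theorem gw_real_rootLabel_inter {z : ℤ} {p : ℤ → Prop} (hp : p z) (S : Set LTree) :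
    (gw z).real ({t | p t.rootLabel} ∩ S) = (gw z).real S := by
  refine measureReal_congr ((gw_rootLabel z).mono fun t ht => propext ?_)
  exact and_iff_right (show p t.rootLabel by rw [ht]; exact hp)

theorem gw_real_splitSet (x : ℤ) {B C A : Set LTree} (hB : MeasurableSet B) (hC : MeasurableSet C)
    (hA : MeasurableSet A) (hBp : B ⊆ {t | t.Positive}) (hCp : C ⊆ {t | ¬ t.Positive}) :
    (gw x).real (splitSet B C A) = (gw x).real B * (gwChild x).real C * (gw x).real A := by
  simp only [measureReal_def, gw_splitSet x hB hC hA hBp hCp, ENNReal.toReal_mul]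

/-- Of the three possible labels of the child on the line, only the prescribed one contributes. -/
theorem gw_hitSetAt_succ_zero {e : ℕ → ℤ × Set LTree × Set LTree}
    (hA : ∀ i, MeasurableSet (e i).2.1) (hB : ∀ i, MeasurableSet (e i).2.2) (n : ℕ)
    (hpos : 0 < (e (n + 1)).1) :
    (gw (e (n + 1)).1).real (hitSetAt e (n + 1) 0) =
      (gw (e (n + 1)).1).real ((e (n + 1)).2.2 ∩ {t | t.Positive}) *
        (if |(e (n + 1)).1 - (e n).1| ≤ 1 then (gw (e n).1).real (hitSetAt e n 0) / 3 else 0) *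
          (gw (e (n + 1)).1).real (e (n + 1)).2.1 := by
  set y := (e (n + 1)).1 with hy
  have hm := measurableSet_hitSetAt hA hB n 0
  rw [hitSetAt_succ_zero, gw_real_rootLabel_inter (p := fun r => r = y ∧ 0 < r) ⟨rfl, hpos⟩,
    gw_real_splitSet y ((hB _).inter measurableSet_positive) hm (hA _)
      Set.inter_subset_right (hitSetAt_subset e n 0)]
  congr 2
  rw [gwChild_real y hm]
  have h0 := fun z => gw_hitSetAt_zero_of_ne (e := e) (n := n) (z := z)
  split_ifs with h
  · have : (e n).1 = y - 1 ∨ (e n).1 = y ∨ (e n).1 = y + 1 := by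
      rw [abs_le] at h; omega
    rcases this with h1 | h1 | h1
    · rw [h0 y (by omega), h0 (y + 1) (by omega), ← h1]; ring
    · rw [h0 (y - 1) (by omega), h0 (y + 1) (by omega), h1]; ring
    · rw [h0 (y - 1) (by omega), h0 y (by omega), ← h1]; ring
  · rw [abs_le] at h
    rw [h0 (y - 1) (by omega), h0 y (by omega), h0 (y + 1) (by omega)]
    ring

/-- Above the prescribed part, the right side is free and the left side has to be positive: a step
of the line is a uniform step weighted by `posProb`. -/
theorem gw_hitSet_succ {e : ℕ → ℤ × Set LTree × Set LTree}
    (hA : ∀ i, MeasurableSet (e i).2.1) (hB : ∀ i, MeasurableSet (e i).2.2) (n m : ℕ) :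
    (gw (m + 1 : ℕ)).real (hitSet e n) = (gw (m + 1 : ℕ)).real (hitSetAt e n 0) +
      posProb (m + 1 : ℕ) * (((gw m).real (hitSet e n) + (gw (m + 1 : ℕ)).real (hitSet e n) +
        (gw (m + 2 : ℕ)).real (hitSet e n)) / 3) := by
  have hm := measurableSet_hitSet hA hB n
  have hdisj : Disjoint (hitSetAt e n 0) ({t : LTree | 0 < t.rootLabel} ∩
      splitSet {t | t.Positive} (hitSet e n) Set.univ) := by
    refine Set.disjoint_left.2 fun t ht ht' => ?_
    obtain ⟨x, bs, c, cs, h1, h2, h3, h4⟩ := ht'.2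
    rw [hitSet_eq_iUnion] at h3
    obtain ⟨m, hm⟩ := Set.mem_iUnion.1 h3
    have : t ∈ hitSetAt e n (m + 1) := by
      rw [hitSetAt_succ]; exact ⟨ht'.1, x, bs, c, cs, h1, h2, hm, h4⟩
    exact Set.disjoint_left.1 (hitSetAt_disjoint e n (Nat.succ_ne_zero m).symm) ht this
  conv_lhs => rw [hitSet_eq_union]
  rw [measureReal_union hdisj ((measurable_rootLabel measurableSet_Ioi).inter
      (measurableSet_splitSet measurableSet_positive hm .univ)),
    gw_real_rootLabel_inter (p := fun r => 0 < r) (by positivity),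
    gw_real_splitSet _ measurableSet_positive hm .univ subset_rfl (hitSet_subset e n),
    gwChild_real _ hm, gw_positive]
  push_cast
  rw [add_sub_cancel_right, show (m : ℤ) + 1 + 1 = m + 2 by ring]
  simp

/-! ### Explicit solution of the recursion -/

/-- A harmonic function for the random walk weighted by `posProb`. -/
def harmPoly (x : ℝ) : ℝ := x * (x + 3) * (2 * x + 3)

/-- The solution of the recursion with a unit source at `p + 1`. -/
noncomputable def greenFun (p z : ℕ) : ℝ :=
  3 / (20 * posProb (p + 1)) * (harmPoly (min z (p + 1) : ℕ) * (1 - posProb (max z (p + 1) : ℕ)))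

/-- Both `harmPoly` and `1 - posProb` solve the equation without source. Their Wronskian `harmPoly
(z+1) * (1 - posProb z) - harmPoly z * (1 - posProb (z+1))` is constant, equal to its value
`harmPoly 1 = 20` at `z = 0`; the prefactor of `greenFun` normalizes the jump at `p + 1`. -/
theorem greenFun_succ (p m : ℕ) : greenFun p (m + 1) = (if m = p then 1 else 0) +
    posProb (m + 1 : ℕ) * ((greenFun p m + greenFun p (m + 1) + greenFun p (m + 2)) / 3) := by
  unfold greenFun
  have hp : (0 : ℝ) ≤ p := by positivity
  have hm : (0 : ℝ) ≤ m := by positivity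
  rcases lt_trichotomy m p with h | rfl | h
  · rw [if_neg h.ne, min_eq_left (by omega), min_eq_left (by omega), min_eq_left (by omega),
      max_eq_right (by omega), max_eq_right (by omega), max_eq_right (by omega)]
    push_cast
    unfold harmPoly posProb
    field_simp
    ring
  · rw [if_pos rfl, min_eq_left (by omega), min_eq_left (by omega), min_eq_right (by omega),
      max_eq_right (by omega), max_eq_right (by omega), max_eq_left (by omega)]
    push_cast
    unfold harmPoly posProb
    field_simp
    ring
  · rw [if_neg h.ne', min_eq_right (by omega), min_eq_right (by omega), min_eq_right (by omega),
      max_eq_left (by omega), max_eq_left (by omega), max_eq_left (by omega)]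
    push_cast
    unfold harmPoly posProb
    field_simp
    ring

theorem tendsto_one_sub_posProb : Tendsto (fun m : ℕ => 1 - posProb m) atTop (𝓝 0) := by
  have hz : Tendsto (fun m : ℕ => 2 * (1 / ((m : ℝ) + 1))) atTop (𝓝 0) := by
    simpa using tendsto_one_div_add_atTop_nhds_zero_nat.const_mul (2 : ℝ)
  refine squeeze_zero (fun m => sub_nonneg.2 (posProb_lt_one (by positivity)).le) (fun m => ?_) hz
  rw [one_sub_posProb (by positivity), ← div_div, mul_one_div]
  exact div_le_self (by positivity) (by linarith [Nat.cast_nonneg (α := ℝ) m])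

/-- This gives the decay at infinity that makes the solution of the recursion unique. -/
theorem gw_hitSet_le (e : ℕ → ℤ × Set LTree × Set LTree) (n m : ℕ) :
    (gw m).real (hitSet e n) ≤ 1 - posProb m := by
  rw [← gw_not_positive]
  exact measureReal_mono (hitSet_subset e n)

/-- Both sides solve the same equation and vanish at `0` and at infinity, so the maximum principle
identifies them. -/
theorem gw_hitSet_eq_greenFun {e : ℕ → ℤ × Set LTree × Set LTree}
    (hA : ∀ i, MeasurableSet (e i).2.1) (hB : ∀ i, MeasurableSet (e i).2.2) (n p : ℕ)
    (hp : (e n).1 = (p + 1 : ℕ)) (h0 : (gw 0).real (hitSet e n) = 0) (m : ℕ) :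
    (gw m).real (hitSet e n) = (gw (e n).1).real (hitSetAt e n 0) * greenFun p m := by
  set K := (gw (e n).1).real (hitSetAt e n 0) with hK
  have hlimG : Tendsto (greenFun p) atTop (𝓝 0) := by
    have h1 : Tendsto (fun z : ℕ => 3 / (20 * posProb (p + 1)) * (harmPoly (p + 1 : ℕ) *
        (1 - posProb z))) atTop (𝓝 0) := by
      simpa using (tendsto_one_sub_posProb.const_mul (harmPoly (p + 1 : ℕ))).const_mul
        (3 / (20 * posProb (p + 1)))
    refine h1.congr' ?_
    filter_upwards [eventually_ge_atTop (p + 1)] with z hz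
    rw [greenFun, min_eq_right hz, max_eq_left hz]
  have hlim : Tendsto (fun m : ℕ => (gw m).real (hitSet e n)) atTop (𝓝 0) :=
    squeeze_zero (fun _ => measureReal_nonneg) (gw_hitSet_le e n) tendsto_one_sub_posProb
  have hK1 : ∀ m : ℕ, (gw (m + 1 : ℕ)).real (hitSetAt e n 0) = K * if m = p then 1 else 0 := by
    intro m
    split_ifs with h
    · rw [hK, hp, h, mul_one]
    · rw [mul_zero]
      exact gw_hitSetAt_zero_of_ne (by rw [hp]; intro h'; exact h (by omega))
  have h := eq_zero_of_abs_le_average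
    (D := fun m : ℕ => (gw m).real (hitSet e n) - K * greenFun p m) (c := fun m => posProb m)
    ?_ ?_ ?_ ?_ ?_ m
  · exact sub_eq_zero.1 h
  · simp [h0, greenFun, harmPoly]
  · simpa using hlim.sub (hlimG.const_mul K)
  · exact fun m => posProb_lt_one (by positivity)
  · exact fun m => posProb_nonneg (by positivity)
  · intro m
    have e1 := gw_hitSet_succ hA hB n m
    have e2 := greenFun_succ p m
    rw [hK1] at e1
    have h5 : 0 ≤ posProb ((m + 1 : ℕ) : ℝ) := posProb_nonneg (by positivity)
    have e3 : (gw (m + 1 : ℕ)).real (hitSet e n) - K * greenFun p (m + 1) =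
        posProb (m + 1 : ℕ) * ((((gw m).real (hitSet e n) - K * greenFun p m) +
          ((gw (m + 1 : ℕ)).real (hitSet e n) - K * greenFun p (m + 1)) +
          ((gw (m + 2 : ℕ)).real (hitSet e n) - K * greenFun p (m + 2))) / 3) := by
      linear_combination e1 - K * e2
    conv_lhs => rw [e3, abs_mul, abs_of_nonneg h5]
    refine mul_le_mul_of_nonneg_left ?_ h5
    rw [abs_div, abs_of_pos (show (0 : ℝ) < 3 by norm_num)]
    gcongr
    exact abs_add_three _ _ _

/-! ### Weights of finite pieces of spines -/

/-- The probability that the first `n + 1` spine vertices fit the specifications `e`, for an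
inhomogeneous Markov chain of spine labels started from `x₀` with transition probabilities `Q i`, and
conditionally independent left and right subtrees with laws `lam i x` and `rho i x`. -/
noncomputable def spineWeight (x₀ : ℤ) (Q : ℕ → ℤ → ℤ → ℝ≥0∞) (lam rho : ℕ → ℤ → Measure LTree)
    (e : ℕ → ℤ × Set LTree × Set LTree) (n : ℕ) : ℝ≥0∞ :=
  ((if (e 0).1 = x₀ then 1 else 0) * ∏ i ∈ Finset.range n, Q i (e i).1 (e (i + 1)).1) *
    ∏ i ∈ Finset.range (n + 1), lam i (e i).1 (e i).2.1 * rho i (e i).1 (e i).2.2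

theorem spineWeight_succ (x₀ : ℤ) (Q : ℕ → ℤ → ℤ → ℝ≥0∞) (lam rho : ℕ → ℤ → Measure LTree)
    (e : ℕ → ℤ × Set LTree × Set LTree) (n : ℕ) :
    spineWeight x₀ Q lam rho e (n + 1) = spineWeight x₀ Q lam rho e n *
      (Q n (e n).1 (e (n + 1)).1 *
        (lam (n + 1) (e (n + 1)).1 (e (n + 1)).2.1 * rho (n + 1) (e (n + 1)).1 (e (n + 1)).2.2)) := by
  rw [spineWeight, spineWeight, Finset.prod_range_succ, Finset.prod_range_succ _ (n + 1)]
  ring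

/-- The transition probabilities of the spine labels of the limit tree. -/
noncomputable def limitStep (i : ℕ) (x y : ℤ) : ℝ≥0∞ :=
  if i = 0 then (if y = 1 then 1 else 0) else besselStep x y

/-- The laws of the right subtrees of the limit tree. -/
noncomputable def limitRho (i : ℕ) (x : ℤ) : Measure LTree :=
  if i = 0 then Measure.dirac (node 0 []) else gwPos x

/-- The probability that the first `n + 1` spine vertices of the limit tree fit `e`. -/
noncomputable def limitWeight (e : ℕ → ℤ × Set LTree × Set LTree) (n : ℕ) : ℝ≥0∞ :=
  spineWeight 0 limitStep (fun _ x => gw x) limitRho e n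

theorem gwPos_of_nonpos {x : ℤ} (hx : x ≤ 0) : gwPos x = 0 := by
  rw [gwPos, cond_eq_zero]
  exact .inr (gw_positive_of_nonpos hx)

theorem gwPos_real (n : ℕ) (B : Set LTree) :
    (gwPos n).real B = (gw n).real (B ∩ {t | t.Positive}) / posProb n := by
  rw [measureReal_def, gwPos, cond_apply measurableSet_positive, ENNReal.toReal_mul,
    ENNReal.toReal_inv, ← measureReal_def, gw_positive, Set.inter_comm, mul_comm, div_eq_mul_inv]
  rfl

/-- The chain `X̃` is the Doob transform by `harmPoly` of the walk with uniform steps weighted by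
`posProb`. The identity is what explains the rational transition probabilities. -/
theorem besselStep_toReal (a b : ℕ) :
    (besselStep (a + 1 : ℕ) (b + 1 : ℕ)).toReal =
      if |((b + 1 : ℕ) : ℤ) - ((a + 1 : ℕ) : ℤ)| ≤ 1 then
        posProb (a + 1) / 3 * (harmPoly (b + 1) / harmPoly (a + 1)) else 0 := by
  unfold besselStep
  rw [if_neg (by omega)]
  have ha : (0 : ℝ) ≤ a := by positivity
  split_ifs with h1 h2 h3 h4 h5 h6
  · obtain rfl : b = a + 1 := by omega
    rw [ENNReal.toReal_ofReal (by positivity)]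
    unfold posProb harmPoly
    push_cast
    field_simp
    ring
  · exact absurd (by rw [h1]; simp) h2
  · obtain rfl : b = a := by omega
    rw [ENNReal.toReal_ofReal (by positivity)]
    unfold posProb harmPoly
    push_cast
    field_simp
  · exact absurd (by rw [h3]; simp) h4
  · obtain rfl : a = b + 1 := by omega
    have : (0 : ℝ) ≤ b := by positivity
    rw [ENNReal.toReal_ofReal]
    · unfold posProb harmPoly
      push_cast
      field_simp
      ring
    · push_cast
      rw [add_sub_cancel_right]
      positivity
  · exact absurd (by rw [h5]; simp) h6
  · rename_i h7
    rw [abs_le] at h7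
    omega
  · simp

theorem hitSet_eq_empty {e : ℕ → ℤ × Set LTree × Set LTree} {n : ℕ} (h : (e (n + 1)).1 ≤ 0) :
    hitSet e (n + 1) = ∅ := by
  rw [hitSet_eq_iUnion, Set.iUnion_eq_empty]
  intro m
  induction m with
  | zero =>
    rw [hitSetAt_succ_zero, Set.eq_empty_iff_forall_notMem]
    rintro t ⟨⟨h1, h2⟩, -⟩
    omega
  | succ m ih =>
    rw [hitSetAt_succ, ih, Set.eq_empty_iff_forall_notMem]
    rintro t ⟨-, x, bs, c, cs, -, -, h, -⟩
    exact h

theorem gw_zero_hitSet (e : ℕ → ℤ × Set LTree × Set LTree) (n : ℕ) :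
    (gw 0).real (hitSet e (n + 1)) = 0 := by
  rw [measureReal_eq_zero_iff, measure_eq_zero_iff_ae_notMem]
  filter_upwards [gw_rootLabel 0] with t ht h
  rw [hitSet_eq_union, hitSetAt_succ_zero] at h
  rcases h with h | h
  · exact h.1.2.ne' ht
  · exact h.1.ne' ht

theorem limitWeight_zero_toReal {e : ℕ → ℤ × Set LTree × Set LTree} (h0 : (e 0).1 = 0)
    (hB : MeasurableSet (e 0).2.2) :
    (limitWeight e 0).toReal = (gw (e 0).1).real (hitSetAt e 0 0) := by
  have : (gw (e 0).1).real (hitSetAt e 0 0) =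
      (gw (e 0).1).real {t | t ∈ (e 0).2.1 ∧ node 0 [] ∈ (e 0).2.2} := by
    rw [hitSetAt_zero_zero]
    refine measureReal_congr ((gw_rootLabel _).mono fun t ht => propext ?_)
    exact ⟨fun h => h.2.2, fun h => ⟨by rw [ht, h0], h0.symm, h⟩⟩
  rw [this]
  by_cases hb : node 0 [] ∈ (e 0).2.2
  · simp [limitWeight, spineWeight, h0, limitRho, hb, Measure.dirac_apply' _ hB, measureReal_def]
  · simp [limitWeight, spineWeight, h0, limitRho, hb, Measure.dirac_apply' _ hB, measureReal_def]

theorem limitWeight_succ_toReal (e : ℕ → ℤ × Set LTree × Set LTree) (n p : ℕ)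
    (hp : (e (n + 1)).1 = (p + 1 : ℕ)) :
    (limitWeight e (n + 1)).toReal = (limitWeight e n).toReal *
      ((limitStep n (e n).1 (e (n + 1)).1).toReal * ((gw (e (n + 1)).1).real (e (n + 1)).2.1 *
        ((gw (e (n + 1)).1).real ((e (n + 1)).2.2 ∩ {t | t.Positive}) / posProb (p + 1)))) := by
  rw [limitWeight, spineWeight_succ, ENNReal.toReal_mul, ENNReal.toReal_mul, ENNReal.toReal_mul]
  have : (limitRho (n + 1) (e (n + 1)).1 (e (n + 1)).2.2).toReal =
      (gw (e (n + 1)).1).real ((e (n + 1)).2.2 ∩ {t | t.Positive}) / posProb (p + 1) := by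
    have := gwPos_real (p + 1) (e (n + 1)).2.2
    rw [limitRho, if_neg (Nat.succ_ne_zero n), hp, ← measureReal_def, this]
    push_cast
    rfl
  rw [this]
  rfl

theorem limitWeight_eq_zero {e : ℕ → ℤ × Set LTree × Set LTree} {n : ℕ}
    (h : (e (n + 1)).1 ≤ 0) : limitWeight e (n + 1) = 0 := by
  rw [limitWeight, spineWeight_succ, limitRho, if_neg (Nat.succ_ne_zero n), gwPos_of_nonpos h]
  simp

/-- The ratios of `harmPoly` along the path telescope, leaving its value at the last label over
`harmPoly 1 = 20`. Each right tree conditioned to be positive contributes a factor `1 / posProb`,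
compensated by the weight of the next step, except at the last vertex. The remaining factor `3`
comes from the first step, which is deterministic in the limit and has probability `1/3` in the
Galton-Watson tree. -/
theorem limitWeight_toReal {e : ℕ → ℤ × Set LTree × Set LTree}
    (hA : ∀ i, MeasurableSet (e i).2.1) (hB : ∀ i, MeasurableSet (e i).2.2) (h0 : (e 0).1 = 0)
    (n p : ℕ) (hp : (e (n + 1)).1 = (p + 1 : ℕ)) :
    (limitWeight e (n + 1)).toReal = (gw (e (n + 1)).1).real (hitSetAt e (n + 1) 0) *
      (3 * harmPoly (p + 1) / (20 * posProb (p + 1))) := by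
  have hw : posProb ((p : ℝ) + 1) ≠ 0 := (posProb_pos (by positivity)).ne'
  induction n generalizing p with
  | zero =>
    rw [gw_hitSetAt_succ_zero hA hB 0 (by rw [hp]; positivity), limitWeight_succ_toReal e 0 p hp,
      limitWeight_zero_toReal h0 (hB 0), limitStep, if_pos rfl, h0, hp]
    by_cases hp0 : p = 0
    · subst hp0
      have : harmPoly ((0 : ℕ) + 1) = 20 := by norm_num [harmPoly]
      rw [this]
      norm_num [h0]
      field_simp
      ring
    · rw [if_neg (by omega), if_neg (by rw [abs_le]; omega)]
      simp
  | succ n ih =>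
    have hn : limitStep (n + 1) (e (n + 1)).1 (e (n + 2)).1 =
        besselStep (e (n + 1)).1 (e (n + 2)).1 := by
      rw [limitStep, if_neg (Nat.succ_ne_zero n)]
    rw [gw_hitSetAt_succ_zero hA hB (n + 1) (by rw [hp]; positivity),
      limitWeight_succ_toReal e (n + 1) p hp, hn]
    by_cases hq : 0 < (e (n + 1)).1
    · obtain ⟨q, hq⟩ : ∃ q : ℕ, (e (n + 1)).1 = (q + 1 : ℕ) :=
        ⟨((e (n + 1)).1 - 1).toNat, by omega⟩
      have hwq : posProb ((q : ℝ) + 1) ≠ 0 := (posProb_pos (by positivity)).ne'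
      have hhq : harmPoly ((q : ℝ) + 1) ≠ 0 := by unfold harmPoly; positivity
      rw [ih q hq hwq]
      have hb := besselStep_toReal q p
      rw [← hq, ← hp] at hb
      rw [hb]
      split_ifs
      · field_simp
      · ring
    · have h1 : hitSetAt e (n + 1) 0 = ∅ := by
        have := hitSet_eq_empty (not_lt.1 hq)
        rw [hitSet_eq_iUnion, Set.iUnion_eq_empty] at this
        exact this 0
      rw [limitWeight_eq_zero (not_lt.1 hq), h1]
      simp

/-- Conditionally on having a label that is not positive, and for a large root label, the
neighbourhood of the first vertex with label `0` of a Galton-Watson tree has the law of the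
neighbourhood of the root of the limit tree. -/
theorem gw_hitSet {e : ℕ → ℤ × Set LTree × Set LTree}
    (hA : ∀ i, MeasurableSet (e i).2.1) (hB : ∀ i, MeasurableSet (e i).2.2) (h0 : (e 0).1 = 0)
    (n m : ℕ) (hm : (e (n + 1)).1 ≤ m) :
    (gw m).real (hitSet e (n + 1)) =
      (limitWeight e (n + 1)).toReal * (gw m).real {t | ¬ t.Positive} := by
  by_cases hq : 0 < (e (n + 1)).1
  · obtain ⟨p, hp⟩ : ∃ p : ℕ, (e (n + 1)).1 = (p + 1 : ℕ) :=
      ⟨((e (n + 1)).1 - 1).toNat, by omega⟩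
    -- Since `p + 1 ≤ m`, the label `m` enters the Green function only through `1 - posProb m`, and
    -- the other factor is that of `limitWeight_toReal`. The identity is exact, not asymptotic.
    rw [gw_hitSet_eq_greenFun hA hB (n + 1) p hp (gw_zero_hitSet e n), limitWeight_toReal hA hB h0 n p hp,
      greenFun, min_eq_right (by omega), max_eq_left (by omega), gw_not_positive]
    push_cast
    ring
  · rw [hitSet_eq_empty (not_lt.1 hq), limitWeight_eq_zero (not_lt.1 hq)]
    simp

theorem le_of_limitWeight_ne_zero {e : ℕ → ℤ × Set LTree × Set LTree} {n : ℕ}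
    (h : limitWeight e n ≠ 0) : (e 0).1 = 0 ∧ (e n).1 ≤ n := by
  induction n with
  | zero =>
    have : (e 0).1 = 0 := by
      by_contra h0
      simp [limitWeight, spineWeight, h0] at h
    exact ⟨this, this.le⟩
  | succ n ih =>
    have h' := h
    rw [limitWeight, spineWeight_succ] at h'
    obtain ⟨h0, hn⟩ := ih (left_ne_zero_of_mul h')
    refine ⟨h0, ?_⟩
    have hs : limitStep n (e n).1 (e (n + 1)).1 ≠ 0 :=
      left_ne_zero_of_mul (right_ne_zero_of_mul h')
    by_contra! hlt
    refine hs ?_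
    push_cast at hlt
    unfold limitStep besselStep
    split_ifs <;> first | rfl | omega

/-! ### Trees with one spine as sequences of labels and side trees. -/

/-! ### Spines -/

@[simp] theorem length_spineWord (j : ℕ → ℕ) (i : ℕ) : (spineWord j i).length = i := by
  simp [spineWord]

theorem spineWord_succ (j : ℕ → ℕ) (i : ℕ) : spineWord j (i + 1) = spineWord j i ++ [j i] := by
  simp [spineWord, List.range_succ]

theorem spineWord_succ' (j : ℕ → ℕ) (i : ℕ) :
    spineWord j (i + 1) = j 0 :: spineWord (fun n => j (n + 1)) i := by
  simp [spineWord, List.range_succ_eq_map, Function.comp_def]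

theorem spineWord_add (j : ℕ → ℕ) (i n : ℕ) :
    spineWord j (i + n) = spineWord j i ++ spineWord (fun m => j (i + m)) n := by
  simp [spineWord, List.range_add, Function.comp_def]

/-- The vertex `u` has descendants at all generations. -/
def InfBelow (t : LTree) (u : List ℕ) : Prop :=
  ∀ n, ∃ w : List ℕ, w.length = n ∧ (t.lab (u ++ w)).isSome

theorem IsSpine.infBelow {t : LTree} {j : ℕ → ℕ} (h : t.IsSpine j) (i : ℕ) :
    t.InfBelow (spineWord j i) := fun n =>
  ⟨spineWord (fun m => j (i + m)) n, by simp, by rw [← spineWord_add]; exact h _⟩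

/-- If no child had descendants at all generations, the largest of finitely many extinction heights
would bound the height below `u`. -/
theorem InfBelow.exists_child {t : LTree} {u : List ℕ} (h : t.InfBelow u) :
    ∃ a, t.InfBelow (u ++ [a]) := by
  by_contra! hne
  have h1 : ∀ a, ∃ n, ∀ w : List ℕ, w.length = n → ¬ (t.lab (u ++ [a] ++ w)).isSome := by
    intro a
    have := hne a
    simp only [InfBelow, not_forall, not_exists, not_and] at this
    exact this
  choose n hn using h1
  have hu : (t.lab u).isSome := by
    obtain ⟨w, hw, h⟩ := h 0
    obtain rfl := List.length_eq_zero_iff.1 hw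
    simpa using h
  obtain ⟨w, hw, hs⟩ := h ((Finset.range (t.deg u)).sup n + 1)
  cases w with
  | nil => simp at hw
  | cons a w =>
    have ha : a < t.deg u := by
      rw [← t.lab_append_isSome hu]
      refine t.lab_isSome_of_append (u ++ [a]) w ?_
      simpa using hs
    have hle : n a ≤ w.length := by
      have : n a ≤ (Finset.range (t.deg u)).sup n := Finset.le_sup (Finset.mem_range.2 ha)
      simp at hw; omega
    refine hn a (w.take (n a)) (by simp [hle]) (t.lab_isSome_of_append _ (w.drop (n a)) ?_)
    simpa using hs

/-- König's lemma. -/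
theorem InfBelow.exists_isSpine {t : LTree} {u : List ℕ} (h : t.InfBelow u) :
    ∃ j, t.IsSpine j ∧ spineWord j u.length = u := by
  have key : ∀ v : {u // t.InfBelow u}, ∃ a, t.InfBelow (v.1 ++ [a]) := fun v => v.2.exists_child
  choose a ha using key
  let W : ℕ → {u // t.InfBelow u} := fun n => Nat.rec ⟨u, h⟩ (fun _ v => ⟨v.1 ++ [a v], ha v⟩) n
  have hW : ∀ n, (W (n + 1)).1 = (W n).1 ++ [a (W n)] := fun n => rfl
  have hlen : ∀ n, (W n).1.length = u.length + n := by
    intro n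
    induction n with
    | zero => rfl
    | succ n ih => rw [hW, List.length_append, ih]; rfl
  have hpre : ∀ m n, m ≤ n → (W m).1 <+: (W n).1 := by
    intro m n hmn
    induction n, hmn using Nat.le_induction with
    | base => exact List.prefix_rfl
    | succ n _ ih => exact ih.trans (by rw [hW]; exact List.prefix_append _ _)
  let j : ℕ → ℕ := fun i => ((W (i + 1)).1[i]?).getD 0
  have hj : ∀ i, spineWord j i = (W i).1.take i := by
    intro i
    refine List.ext_getElem (by simp [hlen]) fun k h1 h2 => ?_
    have hk : k < i := by simpa using h1
    have h3 : k < (W (k + 1)).1.length := by have := hlen (k + 1); omega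
    have := (hpre (k + 1) i hk).getElem h3
    simp [spineWord, j, h3, this]
  refine ⟨j, fun i => ?_, ?_⟩
  · rw [hj]
    refine t.lab_isSome_of_append _ ((W i).1.drop i) ?_
    rw [List.take_append_drop]
    obtain ⟨w, hw, hs⟩ := (W i).2 0
    obtain rfl := List.length_eq_zero_iff.1 hw
    simpa using hs
  · rw [hj]
    obtain ⟨v, hv⟩ := hpre 0 u.length (Nat.zero_le _)
    rw [← hv]
    exact List.take_left' rfl

theorem spineWord_inj {j j' : ℕ → ℕ} (h : ∀ i, spineWord j i = spineWord j' i) : j = j' := by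
  funext i
  have := h (i + 1)
  rw [spineWord_succ, spineWord_succ] at this
  simpa using (List.append_inj' this rfl).2

/-- By König's lemma, a statement about infinite sequences becomes one with quantifiers over words
only, which is why the event is measurable. -/
theorem existsUnique_isSpine_iff {t : LTree} :
    (∃! j, t.IsSpine j) ↔ ∀ n, ∃! u : List ℕ, u.length = n ∧ t.InfBelow u := by
  constructor
  · rintro ⟨j, hj, huniq⟩ n
    refine ⟨spineWord j n, ⟨by simp, hj.infBelow n⟩, ?_⟩
    rintro u ⟨rfl, hu⟩
    obtain ⟨j', hj', h⟩ := hu.exists_isSpine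
    rw [← h, huniq j' hj', length_spineWord]
  · intro h
    obtain ⟨u, ⟨-, hu⟩, -⟩ := h 0
    obtain ⟨j, hj, -⟩ := hu.exists_isSpine
    refine ⟨j, hj, fun j' hj' => spineWord_inj fun i => ?_⟩
    exact (h i).unique ⟨by simp, hj'.infBelow i⟩ ⟨by simp, hj.infBelow i⟩

theorem measurableSet_infBelow (u : List ℕ) : MeasurableSet {t : LTree | t.InfBelow u} := by
  have : {t : LTree | t.InfBelow u} = ⋂ n : ℕ, ⋃ w : List ℕ, ⋃ _ : w.length = n,
      {t | t.lab (u ++ w) = none}ᶜ := by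
    ext t
    simp [InfBelow, Option.isSome_iff_ne_none]
  rw [this]
  exact MeasurableSet.iInter fun n => MeasurableSet.iUnion fun w => MeasurableSet.iUnion fun _ =>
    (measurableSet_lab _ _).compl

/-! ### Decomposition along the spine -/

/-- The label of the `i`-th spine vertex and the subtrees on both sides. -/
noncomputable def spineData (t : LTree) (i : ℕ) : ℤ × LTree × LTree :=
  (t.spineLabel i, t.leftTree i, t.rightTree i)

/-- The trees `P i` are the successive subtrees at the vertices of a line of descent, along which
the labels and the trees on both sides are given by `δ`. -/
def IsChain (P : ℕ → LTree) (δ : ℕ → ℤ × LTree × LTree) : Prop :=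
  ∀ i, P i = node (δ i).1 ((δ i).2.1.children ++ P (i + 1) :: (δ i).2.2.children)

theorem IsChain.shift {P : ℕ → LTree} {δ : ℕ → ℤ × LTree × LTree} (h : IsChain P δ) :
    IsChain (fun i => P (i + 1)) (fun i => δ (i + 1)) := fun i => h (i + 1)

/-- The recursive equation is contracting: agreement to depth `d` one step further gives agreement
to depth `d + 1`. -/
theorem IsChain.unique {P P' : ℕ → LTree} {δ : ℕ → ℤ × LTree × LTree} (h : IsChain P δ)
    (h' : IsChain P' δ) : P 0 = P' 0 := by
  refine eq_of_forall_close fun d => ?_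
  induction d generalizing P P' δ with
  | zero => exact close_zero _ _
  | succ d ih =>
    rw [h 0, h' 0]
    exact close_succ_node (List.rel_append (forall₂_close_refl _ _)
      (.cons (ih h.shift h'.shift) (forall₂_close_refl _ _)))

theorem isSpine_spine {t : LTree} (h : ∃! j, t.IsSpine j) : t.IsSpine t.spine :=
  Classical.epsilon_spec h.exists

theorem isChain_spineData {t : LTree} (h : ∃! j, t.IsSpine j) :
    IsChain (fun i => t.spineSubtree i) t.spineData := by
  intro i
  have hs := isSpine_spine h
  have h1 : t.spine i < (t.spineSubtree i).deg [] := by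
    rw [← lab_singleton_isSome, spineSubtree, lab_subtree t (hs i), ← spineWord_succ]
    exact hs (i + 1)
  have h1' : t.spine i < (t.spineSubtree i).children.length := by simpa using h1
  have h2 : (t.spineSubtree i).children[t.spine i] = t.spineSubtree (i + 1) := by
    rw [getElem_children]
    ext1; funext w
    rw [lab_subtree _ ((lab_singleton_isSome _ _).2 h1), spineSubtree, lab_subtree t (hs i),
      spineSubtree, lab_subtree t (hs (i + 1)), spineWord_succ]
    simp
  simp only [spineData, leftTree, rightTree, children_node]
  rw [← h2, List.cons_getElem_drop_succ, List.take_append_drop, spineLabel, node_children]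

theorem spineSubtree_zero (t : LTree) : t.spineSubtree 0 = t := by
  ext1; funext w
  rw [spineSubtree, spineWord, List.range_zero, List.map_nil, lab_subtree t t.root_isSome]
  rfl

theorem rootLabel_eq_spineLabel_zero (t : LTree) : t.rootLabel = t.spineLabel 0 := by
  rw [spineLabel, spineSubtree_zero]

/-- Labels and side trees that come from a well-labeled tree with one spine. -/
structure GoodData (δ : ℕ → ℤ × LTree × LTree) : Prop where
  step : ∀ i, |(δ (i + 1)).1 - (δ i).1| ≤ 1
  left_root : ∀ i, (δ i).2.1.rootLabel = (δ i).1
  left_finite : ∀ i, (δ i).2.1.IsFinite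
  left_wellLabeled : ∀ i, (δ i).2.1.WellLabeled
  right_root : ∀ i, (δ i).2.2.rootLabel = (δ i).1
  right_finite : ∀ i, (δ i).2.2.IsFinite
  right_wellLabeled : ∀ i, (δ i).2.2.WellLabeled

theorem GoodData.shift {δ : ℕ → ℤ × LTree × LTree} (h : GoodData δ) :
    GoodData fun i => δ (i + 1) :=
  ⟨fun _ => h.step _, fun _ => h.left_root _, fun _ => h.left_finite _,
    fun _ => h.left_wellLabeled _, fun _ => h.right_root _, fun _ => h.right_finite _,
    fun _ => h.right_wellLabeled _⟩

theorem IsChain.lab_spineWord {P : ℕ → LTree} {δ : ℕ → ℤ × LTree × LTree} (h : IsChain P δ)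
    (i : ℕ) (w : List ℕ) :
    (P 0).lab (spineWord (fun i => (δ i).2.1.deg []) i ++ w) = (P i).lab w := by
  induction i generalizing P δ with
  | zero => rfl
  | succ i ih =>
    rw [spineWord_succ', h 0, List.cons_append, lab_node_cons, ← length_children,
      List.getElem?_append_right le_rfl, Nat.sub_self, List.getElem?_cons_zero, Option.bind_some]
    exact ih h.shift

theorem IsChain.isSpine {P : ℕ → LTree} {δ : ℕ → ℤ × LTree × LTree} (h : IsChain P δ) :
    (P 0).IsSpine fun i => (δ i).2.1.deg [] := fun i => by
  have := h.lab_spineWord i []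
  rw [List.append_nil] at this
  rw [this]
  exact (P i).root_isSome

theorem IsFinite.not_isSpine {t : LTree} (h : t.IsFinite) (j : ℕ → ℕ) : ¬ t.IsSpine j := by
  intro hj
  obtain ⟨n, hn⟩ := h
  simpa [hn (spineWord j n) (by simp)] using hj n

theorem IsSpine.child {x : ℤ} {cs : List LTree} {j : ℕ → ℕ} (h : (node x cs).IsSpine j) :
    ∃ hj : j 0 < cs.length, (cs[j 0]).IsSpine fun i => j (i + 1) := by
  have h1 : j 0 < cs.length := by
    have := h 1
    by_contra hlt
    simp [spineWord, hlt] at this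
  refine ⟨h1, fun i => ?_⟩
  have := h (i + 1)
  rw [spineWord_succ'] at this
  simpa [h1] using this

/-- The side trees are finite, so an infinite line of descent has to enter the child `P 1`. -/
theorem IsChain.step_of_isSpine {P : ℕ → LTree} {δ : ℕ → ℤ × LTree × LTree} (h : IsChain P δ)
    (hL0 : (δ 0).2.1.IsFinite) (hR0 : (δ 0).2.2.IsFinite) {j : ℕ → ℕ} (hj : (P 0).IsSpine j) :
    j 0 = (δ 0).2.1.deg [] ∧ (P 1).IsSpine fun i => j (i + 1) := by
  rw [h 0] at hj
  obtain ⟨h1, h2⟩ := hj.child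
  rw [← node_children (δ 0).2.1] at hL0
  rw [← node_children (δ 0).2.2] at hR0
  rcases lt_trichotomy (j 0) ((δ 0).2.1.children.length) with hlt | heq | hgt
  · rw [List.getElem_append_left hlt] at h2
    exact absurd h2 ((hL0.of_mem _ (List.getElem_mem hlt)).not_isSpine _)
  · refine ⟨by rw [heq, length_children], ?_⟩
    simpa [heq] using h2
  · have hm : ((δ 0).2.1.children ++ P (0 + 1) :: (δ 0).2.2.children)[j 0] ∈
        (δ 0).2.2.children := by
      rw [List.getElem_append_right hgt.le, List.getElem_cons]
      rw [dif_neg (by omega)]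
      exact List.getElem_mem _
    exact absurd h2 ((hR0.of_mem _ hm).not_isSpine _)

theorem IsChain.eq_of_isSpine {P : ℕ → LTree} {δ : ℕ → ℤ × LTree × LTree} (h : IsChain P δ)
    (hδ : GoodData δ) {j : ℕ → ℕ} (hj : (P 0).IsSpine j) (i : ℕ) : j i = (δ i).2.1.deg [] := by
  have key := h.step_of_isSpine (hδ.left_finite 0) (hδ.right_finite 0) hj
  induction i generalizing P δ j with
  | zero => exact key.1
  | succ i ih =>
    exact ih h.shift hδ.shift (j := fun i => j (i + 1)) key.2
      (h.shift.step_of_isSpine (hδ.left_finite 1) (hδ.right_finite 1) key.2)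

theorem IsChain.existsUnique_isSpine {P : ℕ → LTree} {δ : ℕ → ℤ × LTree × LTree}
    (h : IsChain P δ) (hδ : GoodData δ) : ∃! j, (P 0).IsSpine j :=
  ⟨_, h.isSpine, fun _ hj => funext fun i => h.eq_of_isSpine hδ hj i⟩

theorem IsChain.rootLabel_eq {P : ℕ → LTree} {δ : ℕ → ℤ × LTree × LTree} (h : IsChain P δ)
    (i : ℕ) : (P i).rootLabel = (δ i).1 := by
  rw [h i, rootLabel_node]

/-- The child on the spine is set apart, because its well-labeledness is what the induction in
`IsChain.wellLabeled` supplies. -/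
theorem IsChain.child_wellLabeled {P : ℕ → LTree} {δ : ℕ → ℤ × LTree × LTree} (h : IsChain P δ)
    (hδ : GoodData δ) : ∀ c ∈ (δ 0).2.1.children ++ P (0 + 1) :: (δ 0).2.2.children,
      |c.rootLabel - (δ 0).1| ≤ 1 ∧ (c.WellLabeled ∨ c = P 1) := by
  have hL := hδ.left_wellLabeled 0
  have hR := hδ.right_wellLabeled 0
  rw [← node_children (δ 0).2.1, hδ.left_root, wellLabeled_node] at hL
  rw [← node_children (δ 0).2.2, hδ.right_root, wellLabeled_node] at hR
  intro c hc
  rw [List.mem_append, List.mem_cons] at hc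
  rcases hc with hc | rfl | hc
  · exact (hL c hc).imp_right Or.inl
  · exact ⟨by rw [h.rootLabel_eq]; exact hδ.step 0, Or.inr rfl⟩
  · exact (hR c hc).imp_right Or.inl

theorem IsChain.wellLabeled {P : ℕ → LTree} {δ : ℕ → ℤ × LTree × LTree} (h : IsChain P δ)
    (hδ : GoodData δ) : (P 0).WellLabeled := by
  intro u
  induction u generalizing P δ with
  | nil =>
    intro i x y hx hy
    rw [h 0, lab_node_nil, Option.some_inj] at hx
    rw [h 0, List.nil_append, lab_node_cons, Option.bind_eq_some_iff] at hy
    obtain ⟨c, hc, hy⟩ := hy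
    rw [lab_nil, Option.some_inj] at hy
    rw [← hx, ← hy]
    exact (h.child_wellLabeled hδ c (List.mem_of_getElem? hc)).1
  | cons a w ih =>
    intro i x y hx hy
    rw [h 0, lab_node_cons, Option.bind_eq_some_iff] at hx
    rw [h 0, List.cons_append, lab_node_cons, Option.bind_eq_some_iff] at hy
    obtain ⟨c, hc, hx⟩ := hx
    obtain ⟨c', hc', hy⟩ := hy
    obtain rfl : c = c' := Option.some_inj.1 (hc.symm.trans hc')
    rcases (h.child_wellLabeled hδ c (List.mem_of_getElem? hc)).2 with hw | rfl
    · exact hw _ _ _ _ hx hy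
    · exact ih h.shift hδ.shift _ _ _ hx hy

theorem IsChain.spine_eq {P : ℕ → LTree} {δ : ℕ → ℤ × LTree × LTree}
    (h : IsChain P δ) (hδ : GoodData δ) : (P 0).spine = fun i => (δ i).2.1.deg [] :=
  funext fun i => h.eq_of_isSpine hδ (isSpine_spine (h.existsUnique_isSpine hδ)) i

theorem IsChain.spineSubtree_eq {P : ℕ → LTree} {δ : ℕ → ℤ × LTree × LTree}
    (h : IsChain P δ) (hδ : GoodData δ) (i : ℕ) : (P 0).spineSubtree i = P i := by
  ext1; funext w
  rw [spineSubtree, lab_subtree _ (isSpine_spine (h.existsUnique_isSpine hδ) i), h.spine_eq hδ,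
    h.lab_spineWord]

theorem IsChain.spineData_eq {P : ℕ → LTree} {δ : ℕ → ℤ × LTree × LTree}
    (h : IsChain P δ) (hδ : GoodData δ) : (P 0).spineData = δ := by
  funext i
  have h1 : (P 0).spineLabel i = (δ i).1 := by
    rw [spineLabel, h.spineSubtree_eq hδ, h.rootLabel_eq]
  refine Prod.ext h1 (Prod.ext ?_ ?_)
  · change node _ _ = _
    rw [h1, h.spineSubtree_eq hδ, h.spine_eq hδ, h i, children_node]
    dsimp only
    rw [← length_children, List.take_left, ← hδ.left_root, node_children]
  · change node _ _ = _
    rw [h1, h.spineSubtree_eq hδ, h.spine_eq hδ, h i, children_node]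
    dsimp only
    rw [← length_children, ← hδ.right_root]
    rw [List.append_cons, List.drop_left' (by simp), node_children]

theorem IsChain.mem_oneSpine {P : ℕ → LTree} {δ : ℕ → ℤ × LTree × LTree}
    (h : IsChain P δ) (hδ : GoodData δ) : P 0 ∈ oneSpine (δ 0).1 :=
  ⟨h.wellLabeled hδ, h.rootLabel_eq 0, h.existsUnique_isSpine hδ⟩

/-! ### Gluing trees along a spine -/

/-- The labels of the tree with spine labels and side trees given by `δ`. -/
noncomputable def glueLab : List ℕ → (ℕ → ℤ × LTree × LTree) → Option ℤ
  | [], δ => some (δ 0).1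
  | a :: w, δ =>
    if a < (δ 0).2.1.deg [] then (δ 0).2.1.lab (a :: w)
    else if a = (δ 0).2.1.deg [] then glueLab w fun i => δ (i + 1)
    else (δ 0).2.2.lab ((a - ((δ 0).2.1.deg [] + 1)) :: w)

/-- The tree with spine labels and side trees given by `δ`. -/
noncomputable def glue (δ : ℕ → ℤ × LTree × LTree) : LTree where
  lab u := glueLab u δ
  root_isSome := rfl
  children_isSome u := by
    induction u generalizing δ with
    | nil =>
      refine ⟨(δ 0).2.1.deg [] + 1 + (δ 0).2.2.deg [], fun i => ?_⟩
      have hL := lab_singleton_isSome (δ 0).2.1 i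
      have hR := lab_singleton_isSome (δ 0).2.2 (i - ((δ 0).2.1.deg [] + 1))
      simp only [List.nil_append, glueLab, Option.isSome_some, true_and]
      split_ifs with h1 h2
      · rw [hL]; omega
      · simp [h2]; omega
      · rw [hR]; omega
    | cons a w ih =>
      simp only [List.cons_append, glueLab]
      split_ifs with h1 h2
      · exact (δ 0).2.1.children_isSome (a :: w)
      · exact ih _
      · exact (δ 0).2.2.children_isSome (_ :: w)

theorem isChain_glue (δ : ℕ → ℤ × LTree × LTree) :
    IsChain (fun i => glue fun n => δ (i + n)) δ := by
  intro i
  ext1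
  funext w
  cases w with
  | nil => rfl
  | cons a w =>
    rw [lab_node_cons]
    change glueLab _ _ = _
    have key : ∀ (t : LTree) (b : ℕ), (t.children[b]?).bind (fun c => c.lab w) = t.lab (b :: w) := by
      intro t b
      conv_rhs => rw [← node_children t]
      rw [lab_node_cons]
    simp only [glueLab, Nat.add_zero]
    split_ifs with h1 h2
    · rw [List.getElem?_append_left (by simpa using h1), key]
    · subst h2
      rw [← length_children, List.getElem?_append_right le_rfl, Nat.sub_self,
        List.getElem?_cons_zero, Option.bind_some]
      simp only [glue, Nat.add_comm, Nat.add_left_comm]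
    · rw [List.getElem?_append_right (by simp; omega), ← key, length_children]
      obtain ⟨m, hm⟩ : ∃ m, a - (δ i).2.1.deg [] = m + 1 := ⟨a - (δ i).2.1.deg [] - 1, by omega⟩
      rw [hm, List.getElem?_cons_succ, show a - ((δ i).2.1.deg [] + 1) = m by omega]

theorem IsChain.eq_glue {P : ℕ → LTree} {δ : ℕ → ℤ × LTree × LTree} (h : IsChain P δ) :
    P 0 = glue δ := by
  have := h.unique (isChain_glue δ)
  simpa using this

theorem glue_spineData {t : LTree} (h : ∃! j, t.IsSpine j) : glue t.spineData = t := by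
  rw [← (isChain_spineData h).eq_glue, spineSubtree_zero]

theorem GoodData.spineData_glue {δ : ℕ → ℤ × LTree × LTree} (h : GoodData δ) :
    (glue δ).spineData = δ := by
  have := (isChain_glue δ).spineData_eq h
  simpa using this

theorem GoodData.glue_mem_oneSpine {δ : ℕ → ℤ × LTree × LTree} (h : GoodData δ) :
    glue δ ∈ oneSpine (δ 0).1 := by
  have := (isChain_glue δ).mem_oneSpine h
  simpa using this

theorem measurable_glue : Measurable glue := by
  refine measurable_of_lab _ fun u o => ?_
  change MeasurableSet {δ | glueLab u δ = o}
  induction u with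
  | nil =>
    exact (measurable_fst.comp (measurable_pi_apply 0))
      (MeasurableSet.of_discrete (s := {x : ℤ | some x = o}))
  | cons a w ih =>
    have hL : Measurable fun δ : ℕ → ℤ × LTree × LTree => (δ 0).2.1 :=
      measurable_fst.comp (measurable_snd.comp (measurable_pi_apply 0))
    have hR : Measurable fun δ : ℕ → ℤ × LTree × LTree => (δ 0).2.2 :=
      measurable_snd.comp (measurable_snd.comp (measurable_pi_apply 0))
    have hd : Measurable fun δ : ℕ → ℤ × LTree × LTree => (δ 0).2.1.deg [] :=
      (measurable_deg []).comp hL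
    have hs : Measurable fun (δ : ℕ → ℤ × LTree × LTree) (i : ℕ) => δ (i + 1) :=
      measurable_pi_lambda _ fun i => measurable_pi_apply _
    have : {δ | glueLab (a :: w) δ = o} = ⋃ d : ℕ, {δ | (δ 0).2.1.deg [] = d} ∩
        (if a < d then {δ | (δ 0).2.1.lab (a :: w) = o} else if a = d then
          (fun δ i => δ (i + 1)) ⁻¹' {δ | glueLab w δ = o}
          else {δ | (δ 0).2.2.lab ((a - (d + 1)) :: w) = o}) := by
      ext δ
      simp only [Set.mem_iUnion, Set.mem_inter_iff, Set.mem_ofPred_eq, exists_eq_left', glueLab]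
      split_ifs <;> rfl
    rw [this]
    refine MeasurableSet.iUnion fun d => (hd (measurableSet_singleton d)).inter ?_
    split_ifs
    · exact hL (measurableSet_lab _ _)
    · exact hs ih
    · exact hR (measurableSet_lab _ _)

/-! ### Existence and uniqueness of the laws of the infinite trees. -/

/-! ### Laws of trees with one spine -/

theorem measurableSet_existsUnique_isSpine : MeasurableSet {t : LTree | ∃! j, t.IsSpine j} := by
  have : {t : LTree | ∃! j, t.IsSpine j} = ⋂ n : ℕ, ⋃ u : List ℕ,
      {t | u.length = n ∧ t.InfBelow u} ∩
        ⋂ v : List ℕ, {t | (v.length = n ∧ t.InfBelow v) → v = u} := by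
    ext t
    simp only [existsUnique_isSpine_iff, Set.mem_ofPred_eq, Set.mem_inter_iff,
      Set.mem_iInter, Set.mem_iUnion]
    rfl
  have hm : ∀ (u : List ℕ) (n : ℕ), MeasurableSet {t : LTree | u.length = n ∧ t.InfBelow u} :=
    fun u n => (MeasurableSet.const _).inter (measurableSet_infBelow u)
  rw [this]
  refine MeasurableSet.iInter fun n => MeasurableSet.iUnion fun u => (hm u n).inter
      (MeasurableSet.iInter fun v => ?_)
  exact (hm v n).imp (MeasurableSet.const _)

theorem measurableSet_oneSpine (x : ℤ) : MeasurableSet (oneSpine x) :=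
  measurableSet_wellLabeled.inter ((measurable_rootLabel (measurableSet_singleton x)).inter
    measurableSet_existsUnique_isSpine)

theorem spineWord_spine_eq_iff {t : LTree} (h : ∃! j, t.IsSpine j) (u : List ℕ) :
    spineWord t.spine u.length = u ↔ t.InfBelow u := by
  constructor
  · intro hu
    rw [← hu]
    exact (isSpine_spine h).infBelow _
  · intro hu
    exact (existsUnique_isSpine_iff.1 h u.length).unique
      ⟨by simp, (isSpine_spine h).infBelow _⟩ ⟨rfl, hu⟩

/-- The sequence `spine` is obtained by choice. On the event of a unique spine it is nevertheless
determined by the words with descendants at all generations, and there are only countably many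
words. -/
theorem measurableSet_inter_spineData (i : ℕ) {A : Set (ℤ × LTree × LTree)}
    (hA : MeasurableSet A) :
    MeasurableSet ({t : LTree | ∃! j, t.IsSpine j} ∩ {t | t.spineData i ∈ A}) := by
  let F : List ℕ → ℕ → LTree → ℤ × LTree × LTree := fun u a t =>
    ((t.subtree u).rootLabel, node (t.subtree u).rootLabel ((t.subtree u).children.take a),
      node (t.subtree u).rootLabel ((t.subtree u).children.drop (a + 1)))
  have hF : ∀ u a, Measurable (F u a) := fun u a =>
    (measurable_rootLabel.comp (continuous_subtree u).measurable).prodMk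
      (((continuous_take a).measurable.comp (continuous_subtree u).measurable).prodMk
        ((continuous_drop (a + 1)).measurable.comp (continuous_subtree u).measurable))
  have : {t : LTree | ∃! j, t.IsSpine j} ∩ {t | t.spineData i ∈ A} =
      {t : LTree | ∃! j, t.IsSpine j} ∩ ⋃ u : List ℕ, ⋃ a : ℕ,
        {t | u.length = i ∧ t.InfBelow (u ++ [a])} ∩ F u a ⁻¹' A := by
    ext t
    simp only [Set.mem_inter_iff, Set.mem_iUnion, Set.mem_ofPred_eq, Set.mem_preimage]
    refine and_congr_right fun ht => ⟨fun h => ?_, ?_⟩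
    · refine ⟨spineWord t.spine i, t.spine i, ⟨by simp, ?_⟩, h⟩
      rw [← spineWord_succ]
      exact (isSpine_spine ht).infBelow _
    · rintro ⟨u, a, ⟨rfl, hu⟩, h⟩
      have h1 := (spineWord_spine_eq_iff ht _).2 hu
      rw [List.length_append, List.length_singleton, spineWord_succ] at h1
      obtain ⟨h2, h3⟩ := List.append_inj' h1 rfl
      have h3 : t.spine u.length = a := by simpa using h3
      have : F u a t = t.spineData u.length := by
        simp only [F, spineData, leftTree, rightTree, spineLabel, spineSubtree, h2, h3]
      rwa [← this]
  rw [this]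
  exact measurableSet_existsUnique_isSpine.inter (MeasurableSet.iUnion fun u =>
    MeasurableSet.iUnion fun a => ((MeasurableSet.const _).inter (measurableSet_infBelow _)).inter
      (hF u a hA))

theorem aemeasurable_spineData {ν : Measure LTree} (h : ∀ᵐ t ∂ν, ∃! j, t.IsSpine j) :
    AEMeasurable spineData ν := by
  classical
  refine ⟨fun t => if ∃! j, t.IsSpine j then t.spineData else fun _ => (0, node 0 [], node 0 []),
    measurable_pi_iff.2 fun i A hA => ?_, ?_⟩
  · have : (fun t : LTree => (if ∃! j, t.IsSpine j then t.spineData else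
        fun _ => (0, node 0 [], node 0 [])) i) ⁻¹' A =
        ({t : LTree | ∃! j, t.IsSpine j} ∩ {t | t.spineData i ∈ A}) ∪
        ({t : LTree | ∃! j, t.IsSpine j}ᶜ ∩ {_t | ((0 : ℤ), node 0 [], node 0 []) ∈ A}) := by
      ext t
      by_cases ht : ∃! j, t.IsSpine j <;> simp [ht]
    rw [this]
    exact (measurableSet_inter_spineData i hA).union
      (measurableSet_existsUnique_isSpine.compl.inter (MeasurableSet.const _))
  · filter_upwards [h] with t ht
    simp [ht]

/-- On sets of full measure, `glue` and `spineData` are inverse to each other. A characterization by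
spine data thus gives existence and uniqueness of the law of the tree at once. -/
theorem eq_map_glue_iff {D : Measure (ℕ → ℤ × LTree × LTree)} {x : ℤ}
    (hD : ∀ᵐ δ ∂D, GoodData δ ∧ (δ 0).1 = x) (ν : Measure LTree) :
    ((∀ᵐ t ∂ν, t ∈ oneSpine x) ∧ ν.map spineData = D) ↔ ν = D.map glue := by
  constructor
  · rintro ⟨h, rfl⟩
    have h1 : ∀ᵐ t ∂ν, ∃! j, t.IsSpine j := h.mono fun t ht => ht.2.2
    rw [AEMeasurable.map_map_of_aemeasurable measurable_glue.aemeasurable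
      (aemeasurable_spineData h1)]
    have : glue ∘ spineData =ᵐ[ν] id := h1.mono fun t ht => glue_spineData ht
    rw [Measure.map_congr this, Measure.map_id]
  · rintro rfl
    have h0 : ∀ᵐ t ∂(D.map glue), t ∈ oneSpine x := by
      refine (ae_map_iff measurable_glue.aemeasurable (measurableSet_oneSpine x)).2 ?_
      filter_upwards [hD] with δ hδ
      rw [← hδ.2]
      exact hδ.1.glue_mem_oneSpine
    refine ⟨h0, ?_⟩
    rw [AEMeasurable.map_map_of_aemeasurable
      (aemeasurable_spineData (h0.mono fun t ht => ht.2.2)) measurable_glue.aemeasurable]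
    have : spineData ∘ glue =ᵐ[D] id := hD.mono fun δ hδ => hδ.1.spineData_glue
    rw [Measure.map_congr this, Measure.map_id]

/-! ### Laws of spine labels and side trees -/

/-- Under `D`, the labels form a Markov chain with transition probabilities `Q`, started from `x₀`,
given which the trees on both sides are independent with laws `lam i x` and `rho i x`. -/
def HasSpineLaw (D : Measure (ℕ → ℤ × LTree × LTree)) (x₀ : ℤ) (Q : ℕ → ℤ → ℤ → ℝ≥0∞)
    (lam rho : ℕ → ℤ → Measure LTree) : Prop :=
  ∀ (e : ℕ → ℤ × Set LTree × Set LTree) (n : ℕ), (∀ i, MeasurableSet (e i).2.1) →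
    (∀ i, MeasurableSet (e i).2.2) → D {δ | ∀ i ≤ n, Fits (e i) (δ i)} = spineWeight x₀ Q lam rho e n

/-- The first labels, and zeros after them. -/
def extendPath {n : ℕ} (s : Fin (n + 1) → ℤ) (j : ℕ) : ℤ := if h : j < n + 1 then s ⟨j, h⟩ else 0

theorem measurable_spineFst (i : ℕ) : Measurable fun δ : ℕ → ℤ × LTree × LTree => (δ i).1 :=
  measurable_fst.comp (measurable_pi_apply i)

theorem measurable_spineLeft (i : ℕ) : Measurable fun δ : ℕ → ℤ × LTree × LTree => (δ i).2.1 :=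
  measurable_fst.comp (measurable_snd.comp (measurable_pi_apply i))

theorem measurable_spineRight (i : ℕ) : Measurable fun δ : ℕ → ℤ × LTree × LTree => (δ i).2.2 :=
  measurable_snd.comp (measurable_snd.comp (measurable_pi_apply i))

theorem setOf_path_eq {n : ℕ} (s : Fin (n + 1) → ℤ) :
    {δ : ℕ → ℤ × LTree × LTree | ∀ j ≤ n, (δ j).1 = extendPath s j} =
      (fun δ (j : Fin (n + 1)) => (δ j).1) ⁻¹' {s} := by
  ext δ
  simp only [Set.mem_ofPred_eq, Set.mem_preimage, Set.mem_singleton_iff, funext_iff]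
  constructor
  · intro h j
    rw [h j (by omega), extendPath, dif_pos j.2]
  · intro h j hj
    have := h ⟨j, by omega⟩
    rw [extendPath, dif_pos (by omega), ← this]

/-- Summation over the countably many label paths reduces events whose conditions depend on the
labels to cylinder events. -/
theorem measure_eq_tsum_path (D : Measure (ℕ → ℤ × LTree × LTree)) (n : ℕ)
    (E : Set (ℕ → ℤ × LTree × LTree)) :
    D E = ∑' s : Fin (n + 1) → ℤ, D ({δ | ∀ j ≤ n, (δ j).1 = extendPath s j} ∩ E) := by
  have hm : Measurable fun (δ : ℕ → ℤ × LTree × LTree) (j : Fin (n + 1)) => (δ j).1 :=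
    measurable_pi_lambda _ fun j => measurable_spineFst j
  have h := tsum_measure_preimage_singleton (μ := D.restrict E)
    (s := (Set.univ : Set (Fin (n + 1) → ℤ))) Set.countable_univ
    (f := fun δ (j : Fin (n + 1)) => (δ j).1) fun s _ => hm (measurableSet_singleton s)
  rw [Set.preimage_univ, Measure.restrict_apply_univ, tsum_univ
    (fun s => (D.restrict E) ((fun δ (j : Fin (n + 1)) => (δ j).1) ⁻¹' {s}))] at h
  rw [← h]
  refine tsum_congr fun s => ?_
  rw [Measure.restrict_apply (hm (measurableSet_singleton s)), setOf_path_eq]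

theorem measurableSet_fits {e : ℤ × Set LTree × Set LTree} (hA : MeasurableSet e.2.1)
    (hB : MeasurableSet e.2.2) : MeasurableSet {d | Fits e d} :=
  (measurable_fst (measurableSet_singleton e.1)).inter
    ((measurable_fst.comp measurable_snd hA).inter (measurable_snd.comp measurable_snd hB))

theorem measurableSet_forall_fits {e : ℕ → ℤ × Set LTree × Set LTree}
    (hA : ∀ i, MeasurableSet (e i).2.1) (hB : ∀ i, MeasurableSet (e i).2.2) (n : ℕ) :
    MeasurableSet {δ : ℕ → ℤ × LTree × LTree | ∀ i ≤ n, Fits (e i) (δ i)} := by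
  have : {δ : ℕ → ℤ × LTree × LTree | ∀ i ≤ n, Fits (e i) (δ i)} =
      ⋂ i : ℕ, ⋂ _ : i ≤ n, (fun δ => δ i) ⁻¹' {d | Fits (e i) d} := by
    ext; simp
  rw [this]
  exact MeasurableSet.iInter fun i => MeasurableSet.iInter fun _ =>
    measurable_pi_apply i (measurableSet_fits (hA i) (hB i))

/-- The events that describe finitely many spine labels and side trees. -/
def spineCylinders : Set (Set (ℕ → ℤ × LTree × LTree)) :=
  {S | ∃ (e : ℕ → ℤ × Set LTree × Set LTree) (n : ℕ), (∀ i, MeasurableSet (e i).2.1) ∧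
    (∀ i, MeasurableSet (e i).2.2) ∧ S = {δ | ∀ i ≤ n, Fits (e i) (δ i)}}

theorem isPiSystem_spineCylinders : IsPiSystem spineCylinders := by
  rintro _ ⟨e, n, hA, hB, rfl⟩ _ ⟨e', n', hA', hB', rfl⟩ ⟨δ, h1, h2⟩
  let A : ℕ → Set LTree := fun i =>
    (if i ≤ n then (e i).2.1 else Set.univ) ∩ (if i ≤ n' then (e' i).2.1 else Set.univ)
  let B : ℕ → Set LTree := fun i =>
    (if i ≤ n then (e i).2.2 else Set.univ) ∩ (if i ≤ n' then (e' i).2.2 else Set.univ)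
  -- The common point `δ` supplies labels that agree with both specifications.
  refine ⟨fun i => ((δ i).1, A i, B i), max n n', fun i => ?_, fun i => ?_, ?_⟩
  · dsimp only [A]
    split_ifs <;> simp [hA, hA', MeasurableSet.inter]
  · dsimp only [B]
    split_ifs <;> simp [hB, hB', MeasurableSet.inter]
  · ext δ'
    simp only [Set.mem_inter_iff, Set.mem_ofPred_eq, Fits, A, B]
    constructor
    · rintro ⟨h3, h4⟩ i hi
      refine ⟨?_, ⟨?_, ?_⟩, ?_, ?_⟩
      · rcases le_max_iff.1 hi with h | h
        · rw [(h3 i h).1, (h1 i h).1]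
        · rw [(h4 i h).1, (h2 i h).1]
      all_goals split_ifs with h
      exacts [(h3 i h).2.1, trivial, (h4 i h).2.1, trivial, (h3 i h).2.2, trivial,
        (h4 i h).2.2, trivial]
    · intro h
      constructor
      · intro i hi
        obtain ⟨h3, h4, h5⟩ := h i (le_max_of_le_left hi)
        rw [if_pos hi] at h4 h5
        exact ⟨h3.trans (h1 i hi).1, h4.1, h5.1⟩
      · intro i hi
        obtain ⟨h3, h4, h5⟩ := h i (le_max_of_le_right hi)
        rw [if_pos hi] at h4 h5
        exact ⟨h3.trans (h2 i hi).1, h4.2, h5.2⟩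

theorem generateFrom_spineCylinders :
    (inferInstance : MeasurableSpace (ℕ → ℤ × LTree × LTree)) =
      MeasurableSpace.generateFrom spineCylinders := by
  refine le_antisymm ?_ (MeasurableSpace.generateFrom_le ?_)
  · have key : ∀ (i : ℕ) (Z : Set ℤ) (A B : Set LTree), MeasurableSet A → MeasurableSet B →
        MeasurableSet[MeasurableSpace.generateFrom spineCylinders]
          {δ : ℕ → ℤ × LTree × LTree | (δ i).1 ∈ Z ∧ (δ i).2.1 ∈ A ∧ (δ i).2.2 ∈ B} := by
      intro i Z A B hA hB
      have : {δ : ℕ → ℤ × LTree × LTree | (δ i).1 ∈ Z ∧ (δ i).2.1 ∈ A ∧ (δ i).2.2 ∈ B} =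
          ⋃ s : Fin (i + 1) → ℤ, ⋃ _ : s (Fin.last i) ∈ Z, {δ | ∀ j ≤ i,
            Fits (extendPath s j, if j = i then A else Set.univ, if j = i then B else Set.univ)
              (δ j)} := by
        ext δ
        simp only [Set.mem_iUnion, Set.mem_ofPred_eq, Fits]
        constructor
        · intro h
          refine ⟨fun j => (δ j).1, by simpa using h.1, fun j hj => ⟨?_, ?_, ?_⟩⟩
          · simp [extendPath, Nat.lt_succ_of_le hj]
          · split_ifs with hji
            · subst hji; exact h.2.1
            · trivial
          · split_ifs with hji
            · subst hji; exact h.2.2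
            · trivial
        · rintro ⟨s, hs, h⟩
          have := h i le_rfl
          rw [extendPath, dif_pos (Nat.lt_succ_self i)] at this
          simp only [if_true] at this
          exact ⟨by rw [this.1]; exact hs, this.2⟩
      rw [this]
      refine MeasurableSet.iUnion fun s => MeasurableSet.iUnion fun _ =>
        MeasurableSpace.measurableSet_generateFrom ⟨_, i, fun j => ?_, fun j => ?_, rfl⟩
      · dsimp only; split_ifs <;> simp [hA]
      · dsimp only; split_ifs <;> simp [hB]
    refine iSup_le fun i => ?_
    rw [← measurable_iff_comap_le]
    refine Measurable.prodMk (fun Z _ => ?_) (Measurable.prodMk (fun A hA => ?_) fun B hB => ?_)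
    · have := key i Z Set.univ Set.univ .univ .univ
      simp only [Set.mem_univ, and_true] at this
      exact this
    · have := key i Set.univ A Set.univ hA .univ
      simp only [Set.mem_univ, and_true, true_and] at this
      exact this
    · have := key i Set.univ Set.univ B .univ hB
      simp only [Set.mem_univ, true_and] at this
      exact this
  · rintro _ ⟨e, n, hA, hB, rfl⟩
    exact measurableSet_forall_fits hA hB n

theorem HasSpineLaw.unique {D D' : Measure (ℕ → ℤ × LTree × LTree)} [IsProbabilityMeasure D]
    [IsProbabilityMeasure D'] {x₀ : ℤ} {Q : ℕ → ℤ → ℤ → ℝ≥0∞} {lam rho : ℕ → ℤ → Measure LTree}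
    (h : HasSpineLaw D x₀ Q lam rho) (h' : HasSpineLaw D' x₀ Q lam rho) : D = D' := by
  refine ext_of_generate_finite _ generateFrom_spineCylinders isPiSystem_spineCylinders ?_ (by simp)
  rintro _ ⟨e, n, hA, hB, rfl⟩
  rw [h e n hA hB, h' e n hA hB]

/-! ### Construction -/

section construction

variable (x₀ : ℤ) (q : ℕ → ℤ → Measure ℤ) (lam rho : ℕ → ℤ → Measure LTree)

/-- The label of the `i`-th spine vertex, if `ω (i, x)` is the next label and the side trees of
the `i`-th spine vertex when its label is `x`. -/
def chainLabel (ω : ℕ × ℤ → ℤ × LTree × LTree) : ℕ → ℤ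
  | 0 => x₀
  | i + 1 => (ω (i, chainLabel ω i)).1

/-- The spine labels and side trees, if `ω (i, x)` is the next label and the side trees of
the `i`-th spine vertex when its label is `x`. -/
def chainData (ω : ℕ × ℤ → ℤ × LTree × LTree) (i : ℕ) : ℤ × LTree × LTree :=
  (chainLabel x₀ ω i, (ω (i, chainLabel x₀ ω i)).2)

/-- The law of the spine labels and side trees. -/
noncomputable def chainMeasure : Measure (ℕ → ℤ × LTree × LTree) :=
  (Measure.infinitePi fun p : ℕ × ℤ => (q p.1 p.2).prod ((lam p.1 p.2).prod (rho p.1 p.2))).map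
    (chainData x₀)

theorem measurable_chainLabel (i : ℕ) :
    Measurable fun ω : ℕ × ℤ → ℤ × LTree × LTree => chainLabel x₀ ω i := by
  induction i with
  | zero => exact measurable_const
  | succ i ih =>
    intro Z hZ
    have : (fun ω : ℕ × ℤ → ℤ × LTree × LTree => chainLabel x₀ ω (i + 1)) ⁻¹' Z =
        ⋃ x : ℤ, {ω | chainLabel x₀ ω i = x} ∩ (fun ω => ω (i, x)) ⁻¹' (Prod.fst ⁻¹' Z) := by
      ext ω; simp [chainLabel]
    rw [this]
    exact MeasurableSet.iUnion fun x => (ih (measurableSet_singleton x)).inter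
      (measurable_pi_apply _ (measurable_fst hZ))

theorem measurable_chainData :
    Measurable (chainData x₀ : (ℕ × ℤ → ℤ × LTree × LTree) → ℕ → ℤ × LTree × LTree) := by
  refine measurable_pi_iff.2 fun i => (measurable_chainLabel x₀ i).prodMk fun A hA => ?_
  have : (fun ω : ℕ × ℤ → ℤ × LTree × LTree => (ω (i, chainLabel x₀ ω i)).2) ⁻¹' A =
      ⋃ x : ℤ, {ω | chainLabel x₀ ω i = x} ∩ (fun ω => ω (i, x)) ⁻¹' (Prod.snd ⁻¹' A) := by
    ext ω; simp
  rw [this]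
  exact MeasurableSet.iUnion fun x => (measurable_chainLabel x₀ i (measurableSet_singleton x)).inter
      (measurable_pi_apply _ (measurable_snd hA))

variable [∀ i x, IsProbabilityMeasure (q i x)] [∀ i x, IsProbabilityMeasure (lam i x)]
  [∀ i x, IsProbabilityMeasure (rho i x)]

instance : IsProbabilityMeasure (chainMeasure x₀ q lam rho) :=
  Measure.isProbabilityMeasure_map (measurable_chainData x₀).aemeasurable

/-- Along a path, the coordinate `(i, x)` is read at time `i` only. A cylinder event is therefore a
product event over the distinct coordinates `(i, (e i).1)`. -/
theorem hasSpineLaw_chainMeasure :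
    HasSpineLaw (chainMeasure x₀ q lam rho) x₀ (fun i x y => q i x {y}) lam rho := by
  intro e n hA hB
  rw [chainMeasure, Measure.map_apply (measurable_chainData x₀) (measurableSet_forall_fits hA hB n)]
  by_cases h0 : (e 0).1 = x₀
  -- At the last vertex the side trees are prescribed but the next label is free.
  · let C : ℕ × ℤ → Set (ℤ × LTree × LTree) := fun p =>
      (if p.1 < n then {(e (p.1 + 1)).1} else Set.univ) ×ˢ ((e p.1).2.1 ×ˢ (e p.1).2.2)
    let F : Finset (ℕ × ℤ) := (Finset.range (n + 1)).image fun i => (i, (e i).1)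
    have hset : chainData x₀ ⁻¹' {δ | ∀ i ≤ n, Fits (e i) (δ i)} = Set.pi F C := by
      ext ω
      simp only [Set.mem_preimage, Set.mem_ofPred_eq, Set.mem_pi, F, Finset.coe_image,
        Set.forall_mem_image, Finset.coe_range, Set.mem_Iio, Nat.lt_succ_iff]
      constructor
      · intro h i hi
        have h1 := h i hi
        have h2 : chainLabel x₀ ω i = (e i).1 := h1.1
        simp only [chainData, Fits, h2] at h1
        refine ⟨?_, h1.2⟩
        dsimp only
        split_ifs with hin
        · have h3 : chainLabel x₀ ω (i + 1) = (e (i + 1)).1 := (h (i + 1) hin).1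
          rw [chainLabel, h2] at h3
          exact h3
        · trivial
      · intro h
        have hl : ∀ i ≤ n, chainLabel x₀ ω i = (e i).1 := by
          intro i hi
          induction i with
          | zero => exact h0.symm
          | succ i ih =>
            rw [chainLabel, ih (by omega)]
            have := (h (by omega : i ≤ n)).1
            dsimp only at this
            rw [if_pos (by omega)] at this
            exact this
        intro i hi
        refine ⟨hl i hi, ?_⟩
        simp only [chainData, hl i hi]
        exact (h hi).2
    have hC : ∀ p ∈ F, MeasurableSet (C p) := by
      intro p _
      refine MeasurableSet.prod ?_ ((hA _).prod (hB _))
      split_ifs <;> simp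
    rw [hset, Measure.infinitePi_pi _ hC, Finset.prod_image (by simp +contextual [Set.InjOn]),
      spineWeight, if_pos h0, one_mul]
    simp only [C, Measure.prod_prod, Finset.prod_mul_distrib]
    congr 1
    rw [Finset.prod_range_succ, if_neg (lt_irrefl n), measure_univ, mul_one]
    exact Finset.prod_congr rfl fun i hi => by rw [if_pos (Finset.mem_range.1 hi)]
  · rw [spineWeight, if_neg h0, zero_mul, zero_mul]
    convert measure_empty (μ := Measure.infinitePi fun p : ℕ × ℤ =>
      (q p.1 p.2).prod ((lam p.1 p.2).prod (rho p.1 p.2)))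
    ext ω
    simp only [Set.mem_preimage, Set.mem_ofPred_eq, Set.mem_empty_iff_false, iff_false]
    exact fun h => h0 (h 0 (Nat.zero_le n)).1.symm

end construction

/-! ### Almost sure properties -/

section ae

variable {D : Measure (ℕ → ℤ × LTree × LTree)} {x₀ : ℤ} {Q : ℕ → ℤ → ℤ → ℝ≥0∞}
  {lam rho : ℕ → ℤ → Measure LTree}

theorem HasSpineLaw.ae_fst_zero (h : HasSpineLaw D x₀ Q lam rho) : ∀ᵐ δ ∂D, (δ 0).1 = x₀ := by
  rw [ae_iff, measure_eq_tsum_path D 0, ENNReal.tsum_eq_zero]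
  intro s
  by_cases hs : s 0 = x₀
  · convert measure_empty (μ := D)
    ext δ
    simp only [Set.mem_inter_iff, Set.mem_ofPred_eq, Set.mem_empty_iff_false, iff_false, not_and]
    intro h1
    have := h1 0 le_rfl
    simp [extendPath, hs] at this
    simp [this]
  · refine measure_mono_null (Set.inter_subset_left.trans fun δ hδ => ?_)
      ((h (fun j => (extendPath s j, Set.univ, Set.univ)) 0 (by simp) (by simp)).trans ?_)
    · exact fun j hj => ⟨hδ j hj, trivial, trivial⟩
    · simp [spineWeight, extendPath, hs]

theorem HasSpineLaw.ae_step (h : HasSpineLaw D x₀ Q lam rho) :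
    ∀ᵐ δ ∂D, ∀ i, Q i (δ i).1 (δ (i + 1)).1 ≠ 0 := by
  rw [ae_all_iff]
  intro i
  rw [ae_iff, measure_eq_tsum_path D (i + 1), ENNReal.tsum_eq_zero]
  intro s
  by_cases hs : Q i (extendPath s i) (extendPath s (i + 1)) = 0
  · refine measure_mono_null (Set.inter_subset_left.trans fun δ hδ => ?_)
      ((h (fun j => (extendPath s j, Set.univ, Set.univ)) (i + 1) (by simp) (by simp)).trans ?_)
    · exact fun j hj => ⟨hδ j hj, trivial, trivial⟩
    · rw [spineWeight_succ]
      simp [hs]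
  · convert measure_empty (μ := D)
    ext δ
    simp only [Set.mem_inter_iff, Set.mem_ofPred_eq, Set.mem_empty_iff_false, iff_false, not_and]
    intro h1
    rwa [h1 i (by omega), h1 (i + 1) le_rfl, not_not]

/-- Along each fixed label path, an exceptional set for one side tree is a null cylinder. -/
theorem HasSpineLaw.ae_sides (h : HasSpineLaw D x₀ Q lam rho) {A B : ℕ → ℤ → Set LTree}
    (hA : ∀ i x, MeasurableSet (A i x)) (hB : ∀ i x, MeasurableSet (B i x))
    (hl : ∀ i x, ∀ᵐ t ∂(lam i x), t ∈ A i x) (hr : ∀ i x, ∀ᵐ t ∂(rho i x), t ∈ B i x) :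
    ∀ᵐ δ ∂D, ∀ i, (δ i).2.1 ∈ A i (δ i).1 ∧ (δ i).2.2 ∈ B i (δ i).1 := by
  have key : ∀ i (A' B' : ℤ → Set LTree), (∀ x, MeasurableSet (A' x)) →
      (∀ x, MeasurableSet (B' x)) → (∀ x, lam i x (A' x) * rho i x (B' x) = 0) →
      D {δ | (δ i).2.1 ∈ A' (δ i).1 ∧ (δ i).2.2 ∈ B' (δ i).1} = 0 := by
    intro i A' B' hA' hB' h0
    rw [measure_eq_tsum_path D i, ENNReal.tsum_eq_zero]
    intro s
    refine measure_mono_null (fun δ hδ => ?_) ((h (fun j => (extendPath s j,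
      if j = i then A' (extendPath s j) else Set.univ,
      if j = i then B' (extendPath s j) else Set.univ)) i ?_ ?_).trans ?_)
    · intro j hj
      refine ⟨hδ.1 j hj, ?_, ?_⟩
      · dsimp only
        split_ifs with hji
        · subst hji; rw [← hδ.1 j le_rfl]; exact hδ.2.1
        · trivial
      · dsimp only
        split_ifs with hji
        · subst hji; rw [← hδ.1 j le_rfl]; exact hδ.2.2
        · trivial
    · intro j; dsimp only; split_ifs <;> simp [hA']
    · intro j; dsimp only; split_ifs <;> simp [hB']
    · rw [spineWeight, Finset.prod_range_succ]
      simp [h0]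
  rw [ae_all_iff]
  intro i
  refine Filter.Eventually.and ?_ ?_
  · have := key i (fun x => (A i x)ᶜ) (fun _ => Set.univ) (fun x => (hA i x).compl) (by simp)
      (fun x => by rw [show lam i x (A i x)ᶜ = 0 from hl i x, zero_mul])
    rw [ae_iff]
    simpa using this
  · have := key i (fun _ => Set.univ) (fun x => (B i x)ᶜ) (by simp) (fun x => (hB i x).compl)
      (fun x => by rw [show rho i x (B i x)ᶜ = 0 from hr i x, mul_zero])
    rw [ae_iff]
    simpa using this

end ae

/-! ### Side trees of well-labeled trees with one spine -/

/-- The finite well-labeled trees with root label `x`. -/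
def finiteTrees (x : ℤ) : Set LTree := {t | t.rootLabel = x ∧ t.IsFinite ∧ t.WellLabeled}

theorem measurableSet_finiteTrees (x : ℤ) : MeasurableSet (finiteTrees x) :=
  (measurable_rootLabel (measurableSet_singleton x)).inter
    (measurableSet_isFinite.inter measurableSet_wellLabeled)

theorem gw_finiteTrees (x : ℤ) : ∀ᵐ t ∂(gw x), t ∈ finiteTrees x := by
  filter_upwards [gw_rootLabel x, gw_isFinite x, gw_wellLabeled x] with t h1 h2 h3
  exact ⟨h1, h2, h3⟩

theorem gwPos_finiteTrees (x : ℤ) : ∀ᵐ t ∂(gwPos x), t ∈ finiteTrees x :=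
  cond_absolutelyContinuous (gw_finiteTrees x)

theorem node_nil_mem_finiteTrees (x : ℤ) : node x [] ∈ finiteTrees x :=
  ⟨rfl, ⟨1, heightLT_succ_node.2 (by simp)⟩, wellLabeled_node.2 (by simp)⟩

/-! ### The uniform infinite tree -/

/-- The uniform law on `{x - 1, x, x + 1}`. -/
noncomputable def uniformMeasure (x : ℤ) : Measure ℤ :=
  (3 : ℝ≥0∞)⁻¹ • (Measure.dirac (x - 1) + Measure.dirac x + Measure.dirac (x + 1))

instance (x : ℤ) : IsProbabilityMeasure (uniformMeasure x) := by
  constructor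
  simp only [uniformMeasure, Measure.smul_apply, Measure.add_apply, measure_univ, smul_eq_mul]
  rw [show (1 : ℝ≥0∞) + 1 + 1 = 3 by norm_num]
  exact ENNReal.inv_mul_cancel (by norm_num) (by norm_num)

theorem uniformMeasure_singleton (x y : ℤ) : uniformMeasure x {y} = uniformStep x y := by
  simp only [uniformMeasure, Measure.smul_apply, Measure.add_apply, smul_eq_mul, uniformStep,
    Measure.dirac_apply' _ (measurableSet_singleton y), Set.indicator_apply,
    Set.mem_singleton_iff, Pi.one_apply, one_div]
  rcases lt_trichotomy y x with h | rfl | h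
  · by_cases h1 : x - 1 = y
    · rw [if_pos h1, if_neg (by omega), if_neg (by omega), if_pos (by rw [abs_le]; omega)]
      simp
    · rw [if_neg h1, if_neg (by omega), if_neg (by omega), if_neg (by rw [abs_le]; omega)]
      simp
  · simp
  · by_cases h1 : x + 1 = y
    · rw [if_pos h1, if_neg (by omega), if_neg (by omega), if_pos (by rw [abs_le]; omega)]
      simp
    · rw [if_neg h1, if_neg (by omega), if_neg (by omega), if_neg (by rw [abs_le]; omega)]
      simp

/-- The law of the spine labels and side trees of the uniform infinite tree with root label `x`. -/
noncomputable def uniformData (x : ℤ) : Measure (ℕ → ℤ × LTree × LTree) :=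
  chainMeasure x (fun _ => uniformMeasure) (fun _ => gw) fun _ => gw

instance (x : ℤ) : IsProbabilityMeasure (uniformData x) := by
  unfold uniformData; infer_instance

theorem hasSpineLaw_uniformData (x : ℤ) :
    HasSpineLaw (uniformData x) x (fun _ => uniformStep) (fun _ => gw) fun _ => gw := by
  have := hasSpineLaw_chainMeasure x (fun _ => uniformMeasure) (fun _ => gw) fun _ => gw
  simp only [uniformMeasure_singleton] at this
  exact this

theorem goodData_of_sides {δ : ℕ → ℤ × LTree × LTree}
    (h1 : ∀ i, |(δ (i + 1)).1 - (δ i).1| ≤ 1)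
    (h2 : ∀ i, (δ i).2.1 ∈ finiteTrees (δ i).1 ∧ (δ i).2.2 ∈ finiteTrees (δ i).1) : GoodData δ :=
  ⟨h1, fun i => (h2 i).1.1, fun i => (h2 i).1.2.1, fun i => (h2 i).1.2.2, fun i => (h2 i).2.1,
    fun i => (h2 i).2.2.1, fun i => (h2 i).2.2.2⟩

theorem goodData_uniformData (x : ℤ) : ∀ᵐ δ ∂(uniformData x), GoodData δ ∧ (δ 0).1 = x := by
  have h := hasSpineLaw_uniformData x
  filter_upwards [h.ae_fst_zero, h.ae_step, h.ae_sides (fun _ => measurableSet_finiteTrees)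
    (fun _ => measurableSet_finiteTrees) (fun _ => gw_finiteTrees) (fun _ => gw_finiteTrees)]
    with δ h1 h2 h3
  refine ⟨goodData_of_sides (fun i => ?_) h3, h1⟩
  by_contra hi
  exact h2 i (by rw [uniformStep, if_neg hi])

/-! ### The limit tree -/

/-- The law of a step of the limit chain from `x`. -/
noncomputable def besselMeasure (x : ℤ) : Measure ℤ :=
  if x ≤ 0 then Measure.dirac x
  else besselStep x (x + 1) • Measure.dirac (x + 1) + besselStep x x • Measure.dirac x +
    besselStep x (x - 1) • Measure.dirac (x - 1)

instance (x : ℤ) : IsProbabilityMeasure (besselMeasure x) := by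
  unfold besselMeasure
  split_ifs with h
  · infer_instance
  · have hx : (1 : ℝ) ≤ x := by exact_mod_cast (by omega : (1 : ℤ) ≤ x)
    constructor
    simp only [Measure.smul_apply, Measure.add_apply, measure_univ, smul_eq_mul, mul_one,
      besselStep, if_neg h, if_true, if_neg (show x ≠ x + 1 by omega),
      if_neg (show x - 1 ≠ x + 1 by omega), if_neg (show x - 1 ≠ x by omega)]
    have h1 : 0 ≤ (x : ℝ) - 1 := by linarith
    rw [← ENNReal.ofReal_add (by positivity) (by positivity),
      ← ENNReal.ofReal_add (by positivity) (by positivity), ENNReal.ofReal_eq_one]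
    field_simp
    ring

theorem besselMeasure_singleton {x : ℤ} (hx : 0 < x) (y : ℤ) :
    besselMeasure x {y} = besselStep x y := by
  have h : ¬ x ≤ 0 := by omega
  simp only [besselMeasure, if_neg h, Measure.smul_apply, Measure.add_apply, smul_eq_mul,
    Measure.dirac_apply' _ (measurableSet_singleton y), Set.indicator_apply,
    Set.mem_singleton_iff, Pi.one_apply]
  by_cases h1 : x + 1 = y
  · subst h1
    simp [show x - 1 ≠ x + 1 by omega]
  · by_cases h2 : x = y
    · subst h2
      simp
    · by_cases h3 : x - 1 = y
      · subst h3
        simp [show x + 1 ≠ x - 1 by omega, h2]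
      · rw [if_neg h1, if_neg h2, if_neg h3]
        simp [besselStep, h, Ne.symm h1, Ne.symm h2, Ne.symm h3]

theorem besselStep_ne_zero {x y : ℤ} (h : besselStep x y ≠ 0) : 0 < x ∧ 0 < y ∧ |y - x| ≤ 1 := by
  unfold besselStep at h
  split_ifs at h with h1 h2 h3 h4
  · exact absurd rfl h
  · subst h2; refine ⟨by omega, by omega, by simp⟩
  · subst h3; refine ⟨by omega, by omega, by simp⟩
  · subst h4
    refine ⟨by omega, ?_, by simp⟩
    by_contra h5
    obtain rfl : x = 1 := by omega
    simp at h
  · exact absurd rfl h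

theorem pos_of_prod_limitStep_ne_zero {s : ℕ → ℤ} {n : ℕ}
    (h : ∏ i ∈ Finset.range n, limitStep i (s i) (s (i + 1)) ≠ 0) {i : ℕ} (hi : i < n) :
    0 < s (i + 1) := by
  have := Finset.prod_ne_zero_iff.1 h i (Finset.mem_range.2 hi)
  unfold limitStep at this
  split_ifs at this with h1 h2
  · omega
  · exact absurd rfl this
  · exact (besselStep_ne_zero this).2.1

instance (n : ℕ) : IsProbabilityMeasure (gwPos (n + 1 : ℕ)) := by
  refine cond_isProbabilityMeasure fun h => ?_
  have := gw_positive (n + 1)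
  rw [measureReal_def, h] at this
  exact (posProb_pos (x := (n + 1 : ℕ)) (by positivity)).ne this

theorem isProbabilityMeasure_gwPos {x : ℤ} (hx : 0 < x) : IsProbabilityMeasure (gwPos x) := by
  obtain ⟨n, rfl⟩ : ∃ n : ℕ, x = (n + 1 : ℕ) := ⟨(x - 1).toNat, by omega⟩
  infer_instance

/-- The law of the `i`-th right subtree, with a probability measure for every label. -/
noncomputable def limitRho' (i : ℕ) (x : ℤ) : Measure LTree :=
  if i = 0 then Measure.dirac (node 0 []) else if 0 < x then gwPos x else Measure.dirac (node x [])

instance (i : ℕ) (x : ℤ) : IsProbabilityMeasure (limitRho' i x) := by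
  unfold limitRho'
  split_ifs with h1 h2
  · infer_instance
  · exact isProbabilityMeasure_gwPos h2
  · infer_instance

/-- The law of the `i`-th step, with a probability measure for every label. -/
noncomputable def limitStepMeasure (i : ℕ) (x : ℤ) : Measure ℤ :=
  if i = 0 then Measure.dirac 1 else besselMeasure x

instance (i : ℕ) (x : ℤ) : IsProbabilityMeasure (limitStepMeasure i x) := by
  unfold limitStepMeasure
  split_ifs <;> infer_instance

/-- The law of the spine labels and side trees of the limit tree. -/
noncomputable def limitData : Measure (ℕ → ℤ × LTree × LTree) :=
  chainMeasure 0 limitStepMeasure (fun _ => gw) limitRho'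

instance : IsProbabilityMeasure limitData := by
  unfold limitData; infer_instance

theorem limitStepMeasure_singleton {i : ℕ} {x : ℤ} (h : i ≠ 0 → 0 < x) (y : ℤ) :
    limitStepMeasure i x {y} = limitStep i x y := by
  unfold limitStepMeasure limitStep
  split_ifs with h1 h2
  · subst h2; simp
  · simp [Ne.symm h2]
  · exact besselMeasure_singleton (h h1) y

/-- The two kernels differ only at nonpositive labels after time `0`. These have zero weight: the
first step leads to `1`, and the chain `X̃` steps only to positive labels. -/
theorem prod_limitStepMeasure (s : ℕ → ℤ) (n : ℕ) :
    ∏ i ∈ Finset.range n, limitStepMeasure i (s i) {s (i + 1)} =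
      ∏ i ∈ Finset.range n, limitStep i (s i) (s (i + 1)) := by
  induction n with
  | zero => rfl
  | succ n ih =>
    rw [Finset.prod_range_succ, Finset.prod_range_succ, ih]
    by_cases h : ∏ i ∈ Finset.range n, limitStep i (s i) (s (i + 1)) = 0
    · rw [h, zero_mul, zero_mul]
    · rw [limitStepMeasure_singleton]
      intro hn
      obtain ⟨m, rfl⟩ := Nat.exists_eq_succ_of_ne_zero hn
      exact pos_of_prod_limitStep_ne_zero h (Nat.lt_succ_self m)

theorem hasSpineLaw_limitData :
    HasSpineLaw limitData 0 limitStep (fun _ => gw) limitRho := by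
  intro e n hA hB
  have := hasSpineLaw_chainMeasure 0 limitStepMeasure (fun _ => gw) limitRho' e n hA hB
  rw [limitData, this, spineWeight, spineWeight, prod_limitStepMeasure fun i => (e i).1]
  by_cases h : ∏ i ∈ Finset.range n, limitStep i (e i).1 (e (i + 1)).1 = 0
  · rw [h]; simp
  · congr 1
    refine Finset.prod_congr rfl fun i hi => ?_
    unfold limitRho' limitRho
    split_ifs with h1 h2
    · rfl
    · rfl
    · obtain ⟨m, rfl⟩ := Nat.exists_eq_succ_of_ne_zero h1
      have := Finset.mem_range.1 hi
      exact absurd (pos_of_prod_limitStep_ne_zero h (i := m) (by omega)) h2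

theorem goodData_limitData : ∀ᵐ δ ∂limitData, GoodData δ ∧ (δ 0).1 = 0 := by
  have h := hasSpineLaw_limitData
  -- The law of the first right tree ignores its argument `x`, so its root label is compared with
  -- `0`; the root label of the spine is `0` almost surely.
  have hr : ∀ (i : ℕ) (x : ℤ), ∀ᵐ t ∂(limitRho i x),
      t ∈ finiteTrees (if i = 0 then 0 else x) := by
    intro i x
    unfold limitRho
    split_ifs with h1
    · exact (ae_dirac_iff (measurableSet_finiteTrees 0)).2 (node_nil_mem_finiteTrees 0)
    · exact gwPos_finiteTrees x
  filter_upwards [h.ae_fst_zero, h.ae_step, h.ae_sides (fun _ => measurableSet_finiteTrees)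
    (fun _ _ => measurableSet_finiteTrees _) (fun _ => gw_finiteTrees) hr]
    with δ h1 h2 h3
  refine ⟨goodData_of_sides (fun i => ?_) fun i => ⟨(h3 i).1, ?_⟩, h1⟩
  · have := h2 i
    unfold limitStep at this
    split_ifs at this with h4 h5
    · subst h4; rw [h1, h5]; norm_num
    · exact absurd rfl this
    · exact (besselStep_ne_zero this).2.2
  · have := (h3 i).2
    split_ifs at this with h4
    · subst h4; rwa [h1]
    · exact this

/-! ### Characterization of the laws -/

theorem hasSpineLaw_map_spineData {ν : Measure LTree} (h : ∀ᵐ t ∂ν, ∃! j, t.IsSpine j) {x₀ : ℤ}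
    {Q : ℕ → ℤ → ℤ → ℝ≥0∞} {lam rho : ℕ → ℤ → Measure LTree} :
    HasSpineLaw (ν.map spineData) x₀ Q lam rho ↔
      ∀ (e : ℕ → ℤ × Set LTree × Set LTree) (n : ℕ), (∀ i, MeasurableSet (e i).2.1) →
        (∀ i, MeasurableSet (e i).2.2) →
        ν {t | ∀ i ≤ n, t.spineLabel i = (e i).1 ∧ t.leftTree i ∈ (e i).2.1 ∧
          t.rightTree i ∈ (e i).2.2} = spineWeight x₀ Q lam rho e n := by
  refine forall_congr' fun e => forall_congr' fun n => forall_congr' fun hA =>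
    forall_congr' fun hB => ?_
  rw [Measure.map_apply_of_aemeasurable (aemeasurable_spineData h)
    (measurableSet_forall_fits hA hB n)]
  rfl

theorem spineWeight_univ {x₀ : ℤ} {Q : ℕ → ℤ → ℤ → ℝ≥0∞} {lam rho : ℕ → ℤ → Measure LTree}
    (s : ℕ → ℤ) (n : ℕ) (hl : ∀ i ≤ n, lam i (s i) Set.univ = 1)
    (hr : ∀ i ≤ n, rho i (s i) Set.univ = 1) :
    spineWeight x₀ Q lam rho (fun i => (s i, Set.univ, Set.univ)) n =
      (if s 0 = x₀ then 1 else 0) * ∏ i ∈ Finset.range n, Q i (s i) (s (i + 1)) := by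
  rw [spineWeight, Finset.prod_eq_one (s := Finset.range (n + 1)), mul_one]
  intro i hi
  have hi := Nat.lt_succ_iff.1 (Finset.mem_range.1 hi)
  rw [hl i hi, hr i hi, one_mul]

theorem existsUnique_isSpine_of_oneSpine {ν : Measure LTree} {x : ℤ}
    (h : ∀ᵐ t ∂ν, t ∈ oneSpine x) : ∀ᵐ t ∂ν, ∃! j, t.IsSpine j := h.mono fun _ ht => ht.2.2

theorem isUniformInfiniteLaw_iff_hasSpineLaw (ν : Measure LTree) :
    IsUniformInfiniteLaw ν ↔ (∀ᵐ t ∂ν, t ∈ oneSpine 0) ∧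
      HasSpineLaw (ν.map spineData) 0 (fun _ => uniformStep) (fun _ => gw) fun _ => gw := by
  constructor
  · rintro ⟨h1, h2, h3⟩
    refine ⟨h1, (hasSpineLaw_map_spineData (existsUnique_isSpine_of_oneSpine h1)).2
      fun e n hA hB => ?_⟩
    rw [h3 n (fun i => (e i).1) (fun i => (e i).2.1) (fun i => (e i).2.2) hA hB, h2]
    rfl
  · rintro ⟨h1, h2⟩
    rw [hasSpineLaw_map_spineData (existsUnique_isSpine_of_oneSpine h1)] at h2
    have h3 : IsMarkovChain ν spineLabel 0 uniformStep := by
      intro n s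
      have := h2 (fun i => (s i, Set.univ, Set.univ)) n (by simp) (by simp)
      rw [spineWeight_univ s n (by simp) (by simp)] at this
      simpa using this
    refine ⟨h1, h3, fun n s A B hA hB => ?_⟩
    rw [h2 (fun i => (s i, A i, B i)) n hA hB, h3]
    rfl

theorem limitWeight_eq_zero_of_prod {e : ℕ → ℤ × Set LTree × Set LTree} {n : ℕ}
    (h : (if (e 0).1 = 0 then 1 else 0) *
      ∏ i ∈ Finset.range n, limitStep i (e i).1 (e (i + 1)).1 = 0) : limitWeight e n = 0 := by
  rw [limitWeight, spineWeight, h, zero_mul]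

theorem limitWeight_univ (s : ℕ → ℤ) (n : ℕ) :
    limitWeight (fun i => (s i, Set.univ, Set.univ)) n =
      (if s 0 = 0 then 1 else 0) * ∏ i ∈ Finset.range n, limitStep i (s i) (s (i + 1)) := by
  by_cases h : ∏ i ∈ Finset.range n, limitStep i (s i) (s (i + 1)) = 0
  · rw [limitWeight_eq_zero_of_prod (by rw [h, mul_zero]), h, mul_zero]
  · refine spineWeight_univ s n (by simp) fun i hi => ?_
    unfold limitRho
    split_ifs with h1
    · simp
    · obtain ⟨m, rfl⟩ := Nat.exists_eq_succ_of_ne_zero h1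
      have := isProbabilityMeasure_gwPos (pos_of_prod_limitStep_ne_zero h (i := m) (by omega))
      simp

theorem prod_limitStep_succ (s : ℕ → ℤ) (n : ℕ) :
    ∏ i ∈ Finset.range (n + 1), limitStep i (s i) (s (i + 1)) =
      (if s 1 = 1 then 1 else 0) * ∏ i ∈ Finset.range n, besselStep (s (i + 1)) (s (i + 2)) := by
  rw [Finset.prod_range_succ', mul_comm]
  simp [limitStep]

/-- The chain in `IsRightLimitLaw` starts at the first spine vertex after the root. Almost surely
the root has label `0`, and `limitStep 0` inserts the deterministic step to `1`. -/
theorem isRightLimitLaw_iff_hasSpineLaw (ν : Measure LTree) [IsProbabilityMeasure ν] :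
    IsRightLimitLaw ν ↔ (∀ᵐ t ∂ν, t ∈ oneSpine 0) ∧
      HasSpineLaw (ν.map spineData) 0 limitStep (fun _ => gw) limitRho := by
  have hae : (∀ᵐ t ∂ν, t ∈ oneSpine 0) → ∀ᵐ t ∂ν, t.spineLabel 0 = 0 := fun h =>
    h.mono fun t ht => by rw [← rootLabel_eq_spineLabel_zero]; exact ht.2.1
  have hshift : (∀ᵐ t ∂ν, t ∈ oneSpine 0) → ∀ (n : ℕ) (s : ℕ → ℤ), s 0 = 0 →
      ν {t | ∀ i ≤ n + 1, t.spineLabel i = s i} =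
        ν {t | ∀ i ≤ n, t.spineLabel (i + 1) = s (i + 1)} := by
    intro h n s hs
    refine measure_congr ?_
    filter_upwards [hae h] with t ht
    refine propext ⟨fun h i hi => h (i + 1) (by omega), fun h i hi => ?_⟩
    cases i with
    | zero => rw [ht, hs]
    | succ i => exact h i (by omega)
  constructor
  · rintro ⟨h1, h2, h3⟩
    refine ⟨h1, (hasSpineLaw_map_spineData (existsUnique_isSpine_of_oneSpine h1)).2
      fun e n hA hB => ?_⟩
    rw [h3 n (fun i => (e i).1) (fun i => (e i).2.1) (fun i => (e i).2.2) hA hB, spineWeight]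
    congr 1
    by_cases h0 : (e 0).1 = 0
    · cases n with
      | zero =>
        rw [if_pos h0, Finset.prod_range_zero, mul_one, ← measure_univ (μ := ν)]
        refine measure_congr ?_
        filter_upwards [hae h1] with t ht
        refine propext ⟨fun _ => trivial, fun _ i hi => ?_⟩
        obtain rfl := Nat.le_zero.1 hi
        rw [ht, h0]
      | succ n =>
        rw [hshift h1 n (fun i => (e i).1) h0, h2 n fun i => (e (i + 1)).1, if_pos h0, one_mul,
          prod_limitStep_succ fun i => (e i).1]
    · rw [if_neg h0, zero_mul]
      refine measure_mono_null (t := {t | t.spineLabel 0 ≠ 0}) (fun t ht => ?_) (hae h1)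
      intro h
      exact h0 ((ht 0 (Nat.zero_le n)).symm.trans h)
  · rintro ⟨h1, h2⟩
    rw [hasSpineLaw_map_spineData (existsUnique_isSpine_of_oneSpine h1)] at h2
    have h3 : ∀ (n : ℕ) (s : ℕ → ℤ), ν {t | ∀ i ≤ n, t.spineLabel i = s i} =
        (if s 0 = 0 then 1 else 0) * ∏ i ∈ Finset.range n, limitStep i (s i) (s (i + 1)) := by
      intro n s
      have := h2 (fun i => (s i, Set.univ, Set.univ)) n (by simp) (by simp)
      rw [← limitWeight, limitWeight_univ] at this
      simpa using this
    refine ⟨h1, fun n s => ?_, fun n s A B hA hB => ?_⟩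
    · have h4 := hshift h1 n (fun i => if i = 0 then 0 else s (i - 1)) (by simp)
      rw [h3, prod_limitStep_succ] at h4
      simpa using h4.symm
    · rw [h2 (fun i => (s i, A i, B i)) n hA hB, h3]
      rfl

theorem isUniformInfiniteLaw_iff (ν : Measure LTree) [IsProbabilityMeasure ν] :
    IsUniformInfiniteLaw ν ↔ ν = (uniformData 0).map glue := by
  rw [isUniformInfiniteLaw_iff_hasSpineLaw, ← eq_map_glue_iff (goodData_uniformData 0)]
  refine and_congr_right fun h => ⟨fun h' => ?_, fun h' => h' ▸ hasSpineLaw_uniformData 0⟩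
  have : IsProbabilityMeasure (ν.map spineData) := Measure.isProbabilityMeasure_map
    (aemeasurable_spineData (existsUnique_isSpine_of_oneSpine h))
  exact h'.unique (hasSpineLaw_uniformData 0)

theorem isRightLimitLaw_iff (ν : Measure LTree) [IsProbabilityMeasure ν] :
    IsRightLimitLaw ν ↔ ν = limitData.map glue := by
  rw [isRightLimitLaw_iff_hasSpineLaw, ← eq_map_glue_iff goodData_limitData]
  refine and_congr_right fun h => ⟨fun h' => ?_, fun h' => h' ▸ hasSpineLaw_limitData⟩
  have : IsProbabilityMeasure (ν.map spineData) := Measure.isProbabilityMeasure_map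
    (aemeasurable_spineData (existsUnique_isSpine_of_oneSpine h))
  exact h'.unique hasSpineLaw_limitData

/-! ### Reflection of the laws. -/

/-! ### Mirror images -/

/-- The effect on spine labels and side trees of taking the mirror image and adding `c` to all
labels. -/
noncomputable def mirrorShift (c : ℤ) (δ : ℕ → ℤ × LTree × LTree) (i : ℕ) : ℤ × LTree × LTree :=
  ((δ i).1 + c, (δ i).2.2.mirror.addLabel c, (δ i).2.1.mirror.addLabel c)

theorem IsChain.mirrorShift {P : ℕ → LTree} {δ : ℕ → ℤ × LTree × LTree} (h : IsChain P δ)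
    (c : ℤ) : IsChain (fun i => (P i).mirror.addLabel c) (mirrorShift c δ) := by
  intro i
  dsimp only [LTree.mirrorShift]
  rw [h i, mirror_node, addLabel_node, children_addLabel, children_mirror, children_addLabel,
    children_mirror]
  simp

theorem glue_mirrorShift (c : ℤ) (δ : ℕ → ℤ × LTree × LTree) :
    glue (mirrorShift c δ) = (glue δ).mirror.addLabel c := by
  have := ((isChain_glue δ).mirrorShift c).eq_glue
  simpa using this.symm

theorem measurable_mirrorShift (c : ℤ) : Measurable (mirrorShift c) :=
  have h : Measurable fun t : LTree => t.mirror.addLabel c :=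
    ((continuous_addLabel c).comp continuous_mirror).measurable
  measurable_pi_lambda _ fun i => ((measurable_from_top (f := fun x : ℤ => x + c)).comp
    (measurable_spineFst i)).prodMk ((h.comp (measurable_spineRight i)).prodMk
      (h.comp (measurable_spineLeft i)))

theorem gw_map_mirror_addLabel (x c : ℤ) :
    (gw x).map (fun t => t.mirror.addLabel c) = gw (x + c) := by
  rw [← gw_map_addLabel, ← gw_map_mirror x, Measure.map_map (continuous_addLabel c).measurable
    continuous_mirror.measurable, gw_map_mirror]
  rfl

theorem gw_preimage (x c : ℤ) {A : Set LTree} (hA : MeasurableSet A) :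
    gw (x - c) {t | t.mirror.addLabel c ∈ A} = gw x A := by
  have h := gw_map_mirror_addLabel (x - c) c
  rw [sub_add_cancel] at h
  rw [← h]
  exact (Measure.map_apply ((continuous_addLabel c).comp continuous_mirror).measurable hA).symm

/-- Left and right trees have the same law, which is invariant under reflection and covariant under
translation; the steps of the spine labels are translation invariant. -/
theorem uniformData_map_mirrorShift (x c : ℤ) :
    (uniformData x).map (mirrorShift c) = uniformData (x + c) := by
  have : IsProbabilityMeasure ((uniformData x).map (mirrorShift c)) :=
    Measure.isProbabilityMeasure_map (measurable_mirrorShift c).aemeasurable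
  refine HasSpineLaw.unique (fun e n hA hB => ?_) (hasSpineLaw_uniformData (x + c))
  have hm : Measurable fun t : LTree => t.mirror.addLabel c :=
    ((continuous_addLabel c).comp continuous_mirror).measurable
  have h := hasSpineLaw_uniformData x (fun i => ((e i).1 - c, {t | t.mirror.addLabel c ∈ (e i).2.2},
    {t | t.mirror.addLabel c ∈ (e i).2.1})) n (fun i => hm (hB i)) (fun i => hm (hA i))
  rw [Measure.map_apply (measurable_mirrorShift c) (measurableSet_forall_fits hA hB n)]
  have hset : mirrorShift c ⁻¹' {δ | ∀ i ≤ n, Fits (e i) (δ i)} = {δ | ∀ i ≤ n,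
      Fits ((e i).1 - c, {t | t.mirror.addLabel c ∈ (e i).2.2},
        {t | t.mirror.addLabel c ∈ (e i).2.1}) (δ i)} := by
    ext δ
    refine forall_congr' fun i => forall_congr' fun _ => ?_
    simp only [Fits, mirrorShift, Set.mem_ofPred_eq, eq_sub_iff_add_eq]
    tauto
  rw [hset, h, spineWeight, spineWeight]
  have hs : ∀ i, uniformStep ((e i).1 - c) ((e (i + 1)).1 - c) =
      uniformStep (e i).1 (e (i + 1)).1 := fun i => by simp [uniformStep]
  simp only [gw_preimage _ c (hA _), gw_preimage _ c (hB _), hs, sub_eq_iff_eq_add]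
  simp only [mul_comm]

theorem positive_mirror {t : LTree} (h : t.Positive) : t.mirror.Positive := by
  intro u
  induction u generalizing t with
  | nil => exact fun x hx => h [] x hx
  | cons a w ih =>
    intro x hx
    obtain ⟨y, cs, rfl⟩ := t.exists_eq_node
    rw [mirror_node, lab_node_cons, Option.bind_eq_some_iff] at hx
    obtain ⟨c, hc, hx⟩ := hx
    have hm := List.mem_of_getElem? hc
    rw [List.mem_reverse, List.mem_map] at hm
    obtain ⟨d, hd, rfl⟩ := hm
    exact ih ((positive_node.1 h).2 d hd) x hx

/-- The side trees are replaced by their mirror images. -/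
noncomputable def mirrorSides (δ : ℕ → ℤ × LTree × LTree) (i : ℕ) : ℤ × LTree × LTree :=
  ((δ i).1, (δ i).2.1.mirror, (δ i).2.2.mirror)

theorem measurable_mirrorSides : Measurable mirrorSides :=
  measurable_pi_lambda _ fun i => (measurable_spineFst i).prodMk
    ((continuous_mirror.measurable.comp (measurable_spineLeft i)).prodMk
      (continuous_mirror.measurable.comp (measurable_spineRight i)))

theorem gwPos_map_mirror (x : ℤ) : (gwPos x).map mirror = gwPos x := by
  ext A hA
  have hm := continuous_mirror.measurable
  rw [Measure.map_apply hm hA, gwPos, cond_apply measurableSet_positive,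
    cond_apply measurableSet_positive]
  congr 1
  conv_rhs => rw [← gw_map_mirror x]
  rw [Measure.map_apply hm (measurableSet_positive.inter hA)]
  congr 1
  ext t
  refine and_congr_left fun _ => ⟨fun h => positive_mirror h, fun h => ?_⟩
  have := positive_mirror (show t.mirror.Positive from h)
  rwa [mirror_mirror] at this

theorem limitRho_map_mirror (i : ℕ) (x : ℤ) : (limitRho i x).map mirror = limitRho i x := by
  unfold limitRho
  split_ifs
  · rw [Measure.map_dirac' continuous_mirror.measurable, mirror_node]
    rfl
  · exact gwPos_map_mirror x

/-- Reflecting the whole tree exchanges the two sides and also reflects every side tree. This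
invariance removes the second effect, leaving the plain exchange of sides in the description of the
left limit law. -/
theorem limitData_map_mirrorSides : limitData.map mirrorSides = limitData := by
  have : IsProbabilityMeasure (limitData.map mirrorSides) :=
    Measure.isProbabilityMeasure_map measurable_mirrorSides.aemeasurable
  refine HasSpineLaw.unique (fun e n hA hB => ?_) hasSpineLaw_limitData
  have hm := continuous_mirror.measurable
  have h := hasSpineLaw_limitData (fun i => ((e i).1, mirror ⁻¹' (e i).2.1,
    mirror ⁻¹' (e i).2.2)) n (fun i => hm (hA i)) (fun i => hm (hB i))
  rw [Measure.map_apply measurable_mirrorSides (measurableSet_forall_fits hA hB n)]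
  refine Eq.trans h ?_
  simp only [spineWeight, ← Measure.map_apply hm (hA _), ← Measure.map_apply hm (hB _),
    limitRho_map_mirror, gw_map_mirror]

/-- The two sides are exchanged and `1` is added to all labels. -/
noncomputable def swapSides (δ : ℕ → ℤ × LTree × LTree) (i : ℕ) : ℤ × LTree × LTree :=
  ((δ i).1 + 1, (δ i).2.2.addLabel 1, (δ i).2.1.addLabel 1)

theorem measurable_swapSides : Measurable swapSides :=
  have h := (continuous_addLabel 1).measurable
  measurable_pi_lambda _ fun i => ((measurable_from_top (f := fun x : ℤ => x + 1)).comp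
    (measurable_spineFst i)).prodMk ((h.comp (measurable_spineRight i)).prodMk
      (h.comp (measurable_spineLeft i)))

theorem glue_swapSides_mirrorSides (δ : ℕ → ℤ × LTree × LTree) :
    glue (swapSides (mirrorSides δ)) = (glue δ).mirror.addLabel 1 := by
  rw [← glue_mirrorShift]
  rfl

theorem addLabel_wellLabeled {t : LTree} (h : t.WellLabeled) (k : ℤ) :
    (t.addLabel k).WellLabeled := by
  intro u i x y hx hy
  simp only [addLabel, Option.map_eq_some_iff] at hx hy
  obtain ⟨x, hx, rfl⟩ := hx
  obtain ⟨y, hy, rfl⟩ := hy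
  rw [add_sub_add_right_eq_sub]
  exact h u i x y hx hy

theorem GoodData.swapSides {δ : ℕ → ℤ × LTree × LTree} (h : GoodData δ) :
    GoodData (swapSides δ) where
  step i := by simpa [LTree.swapSides] using h.step i
  left_root i := by simp [LTree.swapSides, h.right_root i]
  left_finite i := (h.right_finite i).addLabel 1
  left_wellLabeled i := addLabel_wellLabeled (h.right_wellLabeled i) 1
  right_root i := by simp [LTree.swapSides, h.left_root i]
  right_finite i := (h.left_finite i).addLabel 1
  right_wellLabeled i := addLabel_wellLabeled (h.left_wellLabeled i) 1

theorem measurableSet_goodData : MeasurableSet {δ | GoodData δ} := by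
  have hside : ∀ (i : ℕ) (f : ℤ × LTree × LTree → LTree), Measurable f →
      MeasurableSet {δ : ℕ → ℤ × LTree × LTree | f (δ i) ∈ finiteTrees (δ i).1} := by
    intro i f hf
    have : {δ : ℕ → ℤ × LTree × LTree | f (δ i) ∈ finiteTrees (δ i).1} =
        ⋃ x : ℤ, {δ | (δ i).1 = x} ∩ {δ | f (δ i) ∈ finiteTrees x} := by
      ext; simp
    rw [this]
    exact MeasurableSet.iUnion fun x => (measurable_spineFst i (measurableSet_singleton x)).inter
      ((hf.comp (measurable_pi_apply i)) (measurableSet_finiteTrees x))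
  have : {δ | GoodData δ} = ⋂ i : ℕ, {δ : ℕ → ℤ × LTree × LTree | |(δ (i + 1)).1 - (δ i).1| ≤ 1} ∩
      ({δ | (δ i).2.1 ∈ finiteTrees (δ i).1} ∩ {δ | (δ i).2.2 ∈ finiteTrees (δ i).1}) := by
    ext δ
    simp only [Set.mem_iInter, Set.mem_inter_iff, Set.mem_ofPred_eq]
    exact ⟨fun h i => ⟨h.step i, ⟨h.left_root i, h.left_finite i, h.left_wellLabeled i⟩,
      ⟨h.right_root i, h.right_finite i, h.right_wellLabeled i⟩⟩,
      fun h => goodData_of_sides (fun i => (h i).1) fun i => (h i).2⟩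
  rw [this]
  refine MeasurableSet.iInter fun i => MeasurableSet.inter ?_
    ((hside i _ (measurable_fst.comp measurable_snd)).inter
      (hside i _ (measurable_snd.comp measurable_snd)))
  exact ((Measurable.of_discrete (f := fun p : ℤ × ℤ => |p.1 - p.2|)).comp
    ((measurable_spineFst (i + 1)).prodMk (measurable_spineFst i))) measurableSet_Iic

theorem goodData_map_swapSides :
    ∀ᵐ δ ∂(limitData.map swapSides), GoodData δ ∧ (δ 0).1 = 1 := by
  refine (ae_map_iff measurable_swapSides.aemeasurable (measurableSet_goodData.inter
    (measurable_spineFst 0 (measurableSet_singleton 1)))).2 ?_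
  filter_upwards [goodData_limitData] with δ hδ
  exact ⟨hδ.1.swapSides, by simp [swapSides, hδ.2]⟩

theorem map_mirror_addLabel_limit :
    ((limitData.map glue).map fun t => t.mirror.addLabel 1) = (limitData.map swapSides).map glue := by
  have h1 : Measurable fun t : LTree => t.mirror.addLabel 1 :=
    ((continuous_addLabel 1).comp continuous_mirror).measurable
  conv_rhs => rw [← limitData_map_mirrorSides]
  rw [Measure.map_map measurable_swapSides measurable_mirrorSides, Measure.map_map h1 measurable_glue,
    Measure.map_map measurable_glue (measurable_swapSides.comp measurable_mirrorSides)]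
  congr 1
  funext δ
  exact (glue_swapSides_mirrorSides δ).symm

/-- The joint identity in law prescribes the spine data of `ν`, because the translation `U` of the
labels by `-1` is inverted by `V`; `eq_map_glue_iff` then determines `ν`. -/
theorem isLeftLimitLaw_iff (ν : Measure LTree) [IsProbabilityMeasure ν] :
    IsLeftLimitLaw (limitData.map glue) ν ↔
      ν = (limitData.map glue).map fun t => t.mirror.addLabel 1 := by
  rw [map_mirror_addLabel_limit, ← eq_map_glue_iff goodData_map_swapSides]
  let U : (ℕ → ℤ × LTree × LTree) → ℕ → ℤ × LTree × LTree := fun δ i =>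
    ((δ i).1 - 1, (δ i).2.1.addLabel (-1), (δ i).2.2.addLabel (-1))
  let V : (ℕ → ℤ × LTree × LTree) → ℕ → ℤ × LTree × LTree := fun δ i =>
    ((δ i).1 + 1, (δ i).2.1.addLabel 1, (δ i).2.2.addLabel 1)
  let W : (ℕ → ℤ × LTree × LTree) → ℕ → ℤ × LTree × LTree := fun δ i =>
    ((δ i).1, (δ i).2.2, (δ i).2.1)
  have hU : Measurable U :=
    have h := (continuous_addLabel (-1)).measurable
    measurable_pi_lambda _ fun i => ((measurable_from_top (f := fun x : ℤ => x - 1)).comp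
      (measurable_spineFst i)).prodMk ((h.comp (measurable_spineLeft i)).prodMk
        (h.comp (measurable_spineRight i)))
  have hV : Measurable V :=
    have h := (continuous_addLabel 1).measurable
    measurable_pi_lambda _ fun i => ((measurable_from_top (f := fun x : ℤ => x + 1)).comp
      (measurable_spineFst i)).prodMk ((h.comp (measurable_spineLeft i)).prodMk
        (h.comp (measurable_spineRight i)))
  have hW : Measurable W := measurable_pi_lambda _ fun i => (measurable_spineFst i).prodMk
    ((measurable_spineRight i).prodMk (measurable_spineLeft i))
  have hUV : U ∘ V = id := by
    funext δ i
    simp [U, V, addLabel_zero]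
  have hVU : V ∘ U = id := by
    funext δ i
    simp [U, V, addLabel_zero]
  have hlim := (eq_map_glue_iff goodData_limitData (limitData.map glue)).2 rfl
  have hright : ((limitData.map glue).map fun t (i : ℕ) =>
      (t.spineLabel i, t.rightTree i, t.leftTree i)) = limitData.map W := by
    rw [← hlim.2, AEMeasurable.map_map_of_aemeasurable hW.aemeasurable
      (aemeasurable_spineData (existsUnique_isSpine_of_oneSpine hlim.1)), hlim.2]
    rfl
  have hleft : (∀ᵐ t ∂ν, t ∈ LTree.oneSpine 1) → (ν.map fun t (i : ℕ) =>
      (t.spineLabel i - 1, (t.leftTree i).addLabel (-1), (t.rightTree i).addLabel (-1))) =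
      (ν.map spineData).map U := by
    intro h
    rw [AEMeasurable.map_map_of_aemeasurable hU.aemeasurable
      (aemeasurable_spineData (existsUnique_isSpine_of_oneSpine h))]
    rfl
  have hswap : limitData.map swapSides = (limitData.map W).map V := by
    rw [Measure.map_map hV hW]
    rfl
  rw [hswap]
  constructor
  · rintro ⟨h1, h2⟩
    rw [hleft h1, hright] at h2
    refine ⟨h1, ?_⟩
    rw [← h2, Measure.map_map hV hU, hVU, Measure.map_id]
  · rintro ⟨h1, h2⟩
    refine ⟨h1, ?_⟩
    rw [hleft h1, hright, h2, Measure.map_map hU hV, hUV, Measure.map_id]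

/-! ### High position of the first zeros, and asymptotic independence of the two sides. -/

/-! ### The first zero along the spine -/

theorem measurable_spineShift :
    Measurable fun (δ : ℕ → ℤ × LTree × LTree) (i : ℕ) => δ (i + 1) :=
  measurable_pi_lambda _ fun _ => measurable_pi_apply _

theorem uniformData_left (x : ℤ) {A : Set LTree} (hA : MeasurableSet A) :
    uniformData x {δ | (δ 0).2.1 ∈ A} = gw x A := by
  have h := hasSpineLaw_uniformData x
  have h1 := h (fun _ => (x, A, Set.univ)) 0 (fun _ => hA) (fun _ => .univ)
  rw [spineWeight] at h1
  simp only [if_true, Finset.prod_range_zero, one_mul, zero_add, Finset.prod_range_one,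
    measure_univ, mul_one] at h1
  rw [← h1]
  refine measure_congr ?_
  filter_upwards [h.ae_fst_zero] with δ hδ
  refine propext ⟨fun h i hi => ?_, fun h => (h 0 le_rfl).2.1⟩
  obtain rfl := Nat.le_zero.1 hi
  exact ⟨hδ, h, trivial⟩

/-- Markov property after one spine vertex, with an event on the left tree at that vertex. It is
checked on cylinders, by putting the specification `(x, A, univ)` in front. -/
theorem uniformData_shift (x : ℤ) {A : Set LTree} (hA : MeasurableSet A)
    {F : Set (ℕ → ℤ × LTree × LTree)} (hF : MeasurableSet F) :
    uniformData x {δ | (δ 0).2.1 ∈ A ∧ (fun i => δ (i + 1)) ∈ F} =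
      gw x A * ((3 : ℝ≥0∞)⁻¹ *
        (uniformData (x - 1) F + uniformData x F + uniformData (x + 1) F)) := by
  have h := hasSpineLaw_uniformData
  have hS : MeasurableSet {δ : ℕ → ℤ × LTree × LTree | (δ 0).2.1 ∈ A} := measurable_spineLeft 0 hA
  have key : ((uniformData x).restrict {δ | (δ 0).2.1 ∈ A}).map (fun δ i => δ (i + 1)) =
      gw x A • ((3 : ℝ≥0∞)⁻¹ • (uniformData (x - 1) + uniformData x + uniformData (x + 1))) := by
    refine ext_of_generate_finite _ generateFrom_spineCylinders isPiSystem_spineCylinders ?_ ?_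
    · rintro _ ⟨e, n, hA', hB', rfl⟩
      have hm := measurableSet_forall_fits hA' hB' n
      rw [Measure.map_apply measurable_spineShift hm,
        Measure.restrict_apply (measurable_spineShift hm)]
      simp only [Measure.smul_apply, Measure.add_apply, smul_eq_mul]
      rw [h _ e n hA' hB', h _ e n hA' hB', h _ e n hA' hB']
      obtain ⟨g, g0, gs⟩ : ∃ g : ℕ → ℤ × Set LTree × Set LTree, g 0 = (x, A, Set.univ) ∧
        ∀ i, g (i + 1) = e i := ⟨fun i => Nat.casesOn i (x, A, Set.univ) e, rfl, fun _ => rfl⟩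
      have h1 := h x g (n + 1) (fun i => by cases i <;> simp [hA, hA', g0, gs])
        (fun i => by cases i <;> simp [hB', g0, gs])
      have h2 : uniformData x ((fun (δ : ℕ → ℤ × LTree × LTree) i => δ (i + 1)) ⁻¹'
          {δ | ∀ i ≤ n, Fits (e i) (δ i)} ∩ {δ | (δ 0).2.1 ∈ A}) =
          uniformData x {δ | ∀ i ≤ n + 1, Fits (g i) (δ i)} := by
        refine measure_congr ?_
        filter_upwards [(h x).ae_fst_zero] with δ hδ
        refine propext ⟨fun h i hi => ?_, fun h => ⟨fun i hi => gs i ▸ h (i + 1) (by omega), ?_⟩⟩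
        · cases i with
          | zero => rw [g0]; exact ⟨hδ, h.2, trivial⟩
          | succ i => rw [gs]; exact h.1 i (by omega)
        · have := (h 0 (Nat.zero_le _)).2.1
          rwa [g0] at this
      have h3 : uniformStep x (e 0).1 = (3 : ℝ≥0∞)⁻¹ * ((if (e 0).1 = x - 1 then 1 else 0) +
          (if (e 0).1 = x then 1 else 0) + (if (e 0).1 = x + 1 then 1 else 0)) := by
        simp only [← uniformMeasure_singleton, uniformMeasure, Measure.smul_apply,
          Measure.add_apply, smul_eq_mul, Measure.dirac_apply' _ (measurableSet_singleton (e 0).1),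
          Set.indicator_apply, Set.mem_singleton_iff, Pi.one_apply, eq_comm (a := (e 0).1)]
      rw [h2, h1]
      simp only [spineWeight]
      rw [Finset.prod_range_succ', Finset.prod_range_succ' _ (n + 1)]
      simp only [g0, gs, h3, measure_univ, if_true]
      ring
    · rw [Measure.map_apply measurable_spineShift .univ, Set.preimage_univ,
        Measure.restrict_apply_univ, uniformData_left x hA]
      simp only [Measure.smul_apply, Measure.add_apply, smul_eq_mul, measure_univ]
      rw [show (1 : ℝ≥0∞) + 1 + 1 = 3 by norm_num, ENNReal.inv_mul_cancel (by norm_num)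
        (by norm_num), mul_one]
  have := congrArg (fun m => m F) key
  simp only [Measure.map_apply measurable_spineShift hF,
    Measure.restrict_apply (measurable_spineShift hF), Measure.smul_apply, Measure.add_apply,
    smul_eq_mul] at this
  rw [← this]
  congr 1
  ext δ
  exact and_comm

/-- The first left tree that is not positive, if any, is attached at a vertex with label less
than `M`. -/
def lowHit (M : ℤ) : Set (ℕ → ℤ × LTree × LTree) :=
  {δ | ∀ i, (∀ j < i, (δ j).2.1.Positive) → (δ i).2.1.Positive ∨ (δ i).1 < M}

theorem measurableSet_lowHit (M : ℤ) : MeasurableSet (lowHit M) := by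
  have hp : ∀ i, MeasurableSet {δ : ℕ → ℤ × LTree × LTree | (δ i).2.1.Positive} :=
    fun i => measurable_spineLeft i measurableSet_positive
  have : lowHit M = ⋂ i : ℕ, ((⋂ j : ℕ, ⋂ _ : j < i, {δ | (δ j).2.1.Positive})ᶜ ∪
      ({δ | (δ i).2.1.Positive} ∪ {δ | (δ i).1 < M})) := by
    ext δ
    simp only [lowHit, Set.mem_ofPred_eq, Set.mem_iInter, Set.mem_union, Set.mem_compl_iff,
      imp_iff_not_or]
  rw [this]
  exact MeasurableSet.iInter fun i => (MeasurableSet.iInter fun j => MeasurableSet.iInter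
    fun _ => hp j).compl.union ((hp i).union (measurable_spineFst i measurableSet_Iio))

/-- From a label at least `M`, the first left tree cannot be the low exception and must be positive.
-/
theorem mem_lowHit_iff {M : ℤ} {δ : ℕ → ℤ × LTree × LTree} (h : M ≤ (δ 0).1) :
    δ ∈ lowHit M ↔ (δ 0).2.1.Positive ∧ (fun i => δ (i + 1)) ∈ lowHit M := by
  constructor
  · intro hδ
    have h0 := (hδ 0 (by simp)).resolve_right (by omega)
    refine ⟨h0, fun i hi => hδ (i + 1) fun j hj => ?_⟩
    cases j with
    | zero => exact h0
    | succ j => exact hi j (by omega)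
  · rintro ⟨h0, hδ⟩ i hi
    cases i with
    | zero => exact Or.inl h0
    | succ i => exact hδ i fun j hj => hi (j + 1) (by omega)

theorem lowHit_average {M : ℤ} {x : ℤ} (hx : M ≤ x) :
    (uniformData x).real (lowHit M) = (gw x).real {t | t.Positive} *
      (((uniformData (x - 1)).real (lowHit M) + (uniformData x).real (lowHit M) +
        (uniformData (x + 1)).real (lowHit M)) / 3) := by
  have h := uniformData_shift x measurableSet_positive (measurableSet_lowHit M)
  have h2 : uniformData x (lowHit M) = uniformData x {δ | (δ 0).2.1 ∈ {t : LTree | t.Positive} ∧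
      (fun i => δ (i + 1)) ∈ lowHit M} := by
    refine measure_congr ?_
    filter_upwards [(hasSpineLaw_uniformData x).ae_fst_zero] with δ hδ
    exact propext (mem_lowHit_iff (by omega))
  have h3 := congrArg ENNReal.toReal (h2.trans h)
  rw [ENNReal.toReal_mul, ENNReal.toReal_mul, ENNReal.toReal_add (by simp) (by simp),
    ENNReal.toReal_add (by simp) (by simp), ENNReal.toReal_inv, ENNReal.toReal_ofNat] at h3
  simp only [measureReal_def]
  refine h3.trans ?_
  ring

/-- A maximum principle. -/
theorem nonpos_of_le_average {f c : ℕ → ℝ} (h0 : f 0 ≤ 0) (hlim : ∀ᶠ n in atTop, f n ≤ 0)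
    (hc : ∀ n, c n < 1) (hc0 : ∀ n, 0 ≤ c n)
    (h : ∀ n, f (n + 1) ≤ c n * ((f n + f (n + 1) + f (n + 2)) / 3)) (n : ℕ) : f n ≤ 0 := by
  by_contra hn
  obtain ⟨N, hN⟩ := eventually_atTop.1 hlim
  obtain ⟨z, hz, hmax⟩ := Finset.exists_max_image (Finset.range (N + n + 1)) f
    ⟨n, Finset.mem_range.2 (by omega)⟩
  have hpos : 0 < f z := (not_le.1 hn).trans_le (hmax n (Finset.mem_range.2 (by omega)))
  have hall : ∀ m, f m ≤ f z := fun m => by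
    by_cases hm : m < N + n + 1
    · exact hmax m (Finset.mem_range.2 hm)
    · exact (hN m (by omega)).trans hpos.le
  cases z with
  | zero => linarith
  | succ z =>
    have h1 := h z
    have h2 : (f z + f (z + 1) + f (z + 2)) / 3 ≤ f (z + 1) := by
      linarith [hall z, hall (z + 2)]
    have h3 := mul_le_mul_of_nonneg_left h2 (hc0 z)
    nlinarith [hc z]

/-- Above `m` the probability satisfies the averaging equation weighted by `posProb`, which `1 -
posProb` also solves; dividing by its value at `m` makes it dominate at the boundary. No decay at
infinity is known beforehand, so a small multiple of the growing solution `harmPoly` is added to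
control infinity. -/
theorem lowHit_le (m n : ℕ) : (uniformData (m + n : ℕ)).real (lowHit (m + 1 : ℕ)) ≤
    (1 - posProb (m + n : ℕ)) / (1 - posProb m) := by
  have hm : 0 < 1 - posProb m := by
    rw [one_sub_posProb (by positivity)]; positivity
  have hw : posProb m ≠ 1 := by linarith
  refine le_of_forall_pos_le_add fun ε hε => ?_
  have hh : ∀ n : ℕ, 0 ≤ harmPoly ((m + n : ℕ) : ℝ) := fun n => by unfold harmPoly; positivity
  -- With this choice, the correction `η * harmPoly` is at most `ε` at the label of interest.
  set η := ε / (harmPoly (m + n : ℕ) + 1) with hη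
  have hη0 : 0 < η := div_pos hε (by linarith [hh n])
  have key := nonpos_of_le_average (f := fun n : ℕ =>
    (uniformData (m + n : ℕ)).real (lowHit (m + 1 : ℕ)) -
      (1 - posProb (m + n : ℕ)) / (1 - posProb m) - η * harmPoly (m + n : ℕ))
    (c := fun n => posProb (m + n + 1)) ?_ ?_ ?_ ?_ ?_ n
  · have h2 : η * harmPoly (m + n : ℕ) ≤ ε := by
      rw [hη, div_mul_eq_mul_div, div_le_iff₀ (by linarith [hh n])]
      nlinarith [hh n]
    linarith
  · have h1 : (uniformData (m + 0 : ℕ)).real (lowHit (m + 1 : ℕ)) ≤ 1 := measureReal_le_one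
    have := mul_nonneg hη0.le (hh 0)
    rw [add_zero, div_self hm.ne'] at *
    linarith
  · filter_upwards [eventually_ge_atTop ⌈η⁻¹⌉₊] with z hz
    have h1 : (uniformData (m + z : ℕ)).real (lowHit (m + 1 : ℕ)) ≤ 1 := measureReal_le_one
    have h2 : 0 ≤ (1 - posProb (m + z : ℕ)) / (1 - posProb m) :=
      div_nonneg (by linarith [posProb_lt_one (x := (m + z : ℕ)) (by positivity)]) hm.le
    have h3 : η⁻¹ ≤ z := Nat.ceil_le.1 hz
    have h4 : (z : ℝ) ≤ harmPoly (m + z : ℕ) := by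
      have hm0 : (0 : ℝ) ≤ m := by positivity
      have hz0 : (0 : ℝ) ≤ z := by positivity
      unfold harmPoly
      push_cast
      have h5 : (1 : ℝ) ≤ (m + z + 3) * (2 * (m + z) + 3) := by nlinarith
      nlinarith
    have h5 : 1 ≤ η * harmPoly (m + z : ℕ) := by
      calc 1 = η * η⁻¹ := (mul_inv_cancel₀ hη0.ne').symm
        _ ≤ _ := by gcongr; exact h3.trans h4
    linarith
  · intro n
    exact posProb_lt_one (by positivity)
  · intro n
    exact posProb_nonneg (by positivity)
  · intro n
    have h1 := lowHit_average (M := (m + 1 : ℕ)) (x := (m + (n + 1) : ℕ)) (by omega)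
    rw [gw_positive, show ((m + (n + 1) : ℕ) : ℤ) - 1 = (m + n : ℕ) by push_cast; ring,
      show ((m + (n + 1) : ℕ) : ℤ) + 1 = (m + (n + 2) : ℕ) by push_cast; ring] at h1
    have e1 : ∀ x : ℝ, 0 ≤ x → (1 - posProb (x + 1)) = posProb (x + 1) *
        (((1 - posProb x) + (1 - posProb (x + 1)) + (1 - posProb (x + 2))) / 3) := by
      intro x hx
      linarith [posProb_succ_mul hx]
    have e2 : ∀ x : ℝ, 0 ≤ x → harmPoly (x + 1) = posProb (x + 1) *
        ((harmPoly x + harmPoly (x + 1) + harmPoly (x + 2)) / 3) := by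
      intro x hx
      unfold posProb harmPoly
      field_simp
      ring
    have e1' := e1 (m + n) (by positivity)
    have e2' := e2 (m + n) (by positivity)
    push_cast at h1 ⊢
    simp only [← add_assoc] at h1 ⊢
    refine le_of_eq ?_
    linear_combination h1 - (1 - posProb m)⁻¹ * e1' - η * e2'

theorem tendsto_lowHit (m : ℕ) :
    Tendsto (fun k : ℕ => (uniformData k).real (lowHit (m + 1 : ℕ))) atTop (𝓝 0) := by
  have h : Tendsto (fun k : ℕ => (1 - posProb k) / (1 - posProb m)) atTop (𝓝 0) := by
    simpa using tendsto_one_sub_posProb.div_const (1 - posProb m)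
  refine tendsto_of_tendsto_of_tendsto_of_le_of_le' tendsto_const_nhds h
    (Eventually.of_forall fun _ => measureReal_nonneg) ?_
  filter_upwards [eventually_ge_atTop m] with k hk
  obtain ⟨n, rfl⟩ := Nat.exists_eq_add_of_le hk
  exact lowHit_le m n

/-! ### Independence of both sides -/

/-- The first left tree that is not positive is the `i`-th one, it is in `T`, and its root label is
at least `M`. -/
def firstHitAt (M : ℤ) (T : Set LTree) (i : ℕ) : Set (ℕ → ℤ × LTree × LTree) :=
  {δ | (∀ j < i, (δ j).2.1.Positive) ∧ (δ i).2.1 ∈ T ∧ M ≤ (δ i).1}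

theorem measurableSet_firstHitAt (M : ℤ) {T : Set LTree} (hT : MeasurableSet T) (i : ℕ) :
    MeasurableSet (firstHitAt M T i) := by
  have : firstHitAt M T i = (⋂ j : ℕ, ⋂ _ : j < i, {δ | (δ j).2.1.Positive}) ∩
      ({δ | (δ i).2.1 ∈ T} ∩ {δ | M ≤ (δ i).1}) := by
    ext δ; simp [firstHitAt]
  rw [this]
  exact (MeasurableSet.iInter fun j => MeasurableSet.iInter fun _ =>
    measurable_spineLeft j measurableSet_positive).inter
      ((measurable_spineLeft i hT).inter (measurable_spineFst i measurableSet_Ici))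

theorem eq_of_mem_firstHitAt {M M' : ℤ} {T T' : Set LTree} (hT : ∀ t ∈ T, ¬ t.Positive)
    (hT' : ∀ t ∈ T', ¬ t.Positive) {i i' : ℕ} {δ : ℕ → ℤ × LTree × LTree}
    (h : δ ∈ firstHitAt M T i) (h' : δ ∈ firstHitAt M' T' i') : i = i' := by
  rcases lt_trichotomy i i' with hlt | heq | hgt
  · exact absurd (h'.1 i hlt) (hT _ h.2.1)
  · exact heq
  · exact absurd (h.1 i' hgt) (hT' _ h'.2.1)

/-- Given the spine labels, the `i`-th left tree is independent of all other side trees. For every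
path with label at least `M` at time `i`, replacing `T` by `T'` changes one factor of the product,
by `κ`. -/
theorem uniformData_firstHitAt_inter (x : ℤ) {M : ℤ} {T T' : Set LTree} (hT : MeasurableSet T)
    (hT' : MeasurableSet T') {κ : ℝ≥0∞} (h : ∀ x, M ≤ x → gw x T = κ * gw x T') {i N : ℕ}
    (hi : i ≤ N) {B : ℕ → ℤ → Set LTree} (hB : ∀ j y, MeasurableSet (B j y)) :
    uniformData x (firstHitAt M T i ∩ {δ | ∀ j ≤ N, (δ j).2.2 ∈ B j (δ j).1}) =
      κ * uniformData x (firstHitAt M T' i ∩ {δ | ∀ j ≤ N, (δ j).2.2 ∈ B j (δ j).1}) := by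
  rw [measure_eq_tsum_path _ N, measure_eq_tsum_path _ N (firstHitAt M T' i ∩ _),
    ← ENNReal.tsum_mul_left]
  refine tsum_congr fun s => ?_
  by_cases hs : M ≤ extendPath s i
  · let A : Set LTree → ℕ → Set LTree := fun T j =>
      if j = i then T else if j < i then {t | t.Positive} else Set.univ
    have key : ∀ T, MeasurableSet T →
        uniformData x ({δ | ∀ j ≤ N, (δ j).1 = extendPath s j} ∩
          (firstHitAt M T i ∩ {δ | ∀ j ≤ N, (δ j).2.2 ∈ B j (δ j).1})) =
        spineWeight x (fun _ => uniformStep) (fun _ => gw) (fun _ => gw)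
          (fun j => (extendPath s j, A T j, B j (extendPath s j))) N := by
      intro T hT
      rw [← hasSpineLaw_uniformData x _ N (fun j => ?_) fun j => hB _ _]
      · congr 1
        ext δ
        simp only [Set.mem_inter_iff, Set.mem_ofPred_eq, Fits, firstHitAt, A]
        constructor
        · rintro ⟨h1, ⟨h2, h3, -⟩, h4⟩ j hj
          refine ⟨h1 j hj, ?_, h1 j hj ▸ h4 j hj⟩
          split_ifs with h5 h6
          · rw [h5]; exact h3
          · exact h2 j h6
          · trivial
        · intro h1
          refine ⟨fun j hj => (h1 j hj).1, ⟨fun j hj => ?_, ?_, ?_⟩, fun j hj => ?_⟩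
          · have := (h1 j (by omega)).2.1
            rwa [if_neg hj.ne, if_pos hj] at this
          · have := (h1 i hi).2.1
            rwa [if_pos rfl] at this
          · rw [(h1 i hi).1]; exact hs
          · rw [(h1 j hj).1]; exact (h1 j hj).2.2
      · dsimp only [A]
        split_ifs
        exacts [hT, measurableSet_positive, .univ]
    rw [key T hT, key T' hT', spineWeight, spineWeight, mul_left_comm]
    congr 1
    have h1 : ∀ j, gw (extendPath s j) (A T j) * gw (extendPath s j) (B j (extendPath s j)) =
        (if j = i then κ else 1) *
          (gw (extendPath s j) (A T' j) * gw (extendPath s j) (B j (extendPath s j))) := by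
      intro j
      dsimp only [A]
      split_ifs with h1 h2
      · subst h1; rw [h _ hs, mul_assoc]
      · rw [one_mul]
      · rw [one_mul]
    simp only [h1]
    rw [Finset.prod_mul_distrib, Finset.prod_ite_eq', if_pos (Finset.mem_range.2 (by omega))]
  · have h0 : ∀ T (E : Set (ℕ → ℤ × LTree × LTree)),
        {δ | ∀ j ≤ N, (δ j).1 = extendPath s j} ∩ (firstHitAt M T i ∩ E) = ∅ := by
      intro T E
      ext δ
      simp only [Set.mem_inter_iff, Set.mem_ofPred_eq, Set.mem_empty_iff_false, iff_false]
      rintro ⟨h1, h2, -⟩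
      exact hs (h1 i hi ▸ h2.2.2)
    rw [h0, h0, measure_empty, mul_zero]

/-- The event on the reflected side only involves labels and finitely many right trees, so it acts
as a spectator. -/
theorem uniformData_firstHitAt_left (x c : ℤ) {M M₂ : ℤ} {T T' T₂ : Set LTree}
    (hT : MeasurableSet T) (hT' : MeasurableSet T') (hT₂ : MeasurableSet T₂) {κ : ℝ≥0∞}
    (h : ∀ x, M ≤ x → gw x T = κ * gw x T') (i i₂ : ℕ) :
    uniformData x (firstHitAt M T i ∩ mirrorShift c ⁻¹' firstHitAt M₂ T₂ i₂) =
      κ * uniformData x (firstHitAt M T' i ∩ mirrorShift c ⁻¹' firstHitAt M₂ T₂ i₂) := by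
  have hm : Measurable fun t : LTree => t.mirror.addLabel c :=
    ((continuous_addLabel c).comp continuous_mirror).measurable
  let B : ℕ → ℤ → Set LTree := fun j y => {r | (j < i₂ → (r.mirror.addLabel c).Positive) ∧
    (j = i₂ → r.mirror.addLabel c ∈ T₂ ∧ M₂ ≤ y + c)}
  have hB : ∀ j y, MeasurableSet (B j y) := by
    intro j y
    refine MeasurableSet.inter ?_ ?_
    · exact (MeasurableSet.const _).imp (hm measurableSet_positive)
    · exact (MeasurableSet.const _).imp ((hm hT₂).inter (MeasurableSet.const _))
  have hset : mirrorShift c ⁻¹' firstHitAt M₂ T₂ i₂ =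
      {δ | ∀ j ≤ max i i₂, (δ j).2.2 ∈ B j (δ j).1} := by
    ext δ
    simp only [Set.mem_preimage, firstHitAt, mirrorShift, Set.mem_ofPred_eq, B]
    constructor
    · rintro ⟨h1, h2⟩ j _
      exact ⟨h1 j, fun h3 => h3 ▸ h2⟩
    · intro h1
      exact ⟨fun j hj => (h1 j (by omega)).1 hj, (h1 i₂ (le_max_right _ _)).2 rfl⟩
  rw [hset]
  exact uniformData_firstHitAt_inter x hT hT' h (le_max_left _ _) hB

theorem mirrorShift_mirrorShift (c c' : ℤ) (δ : ℕ → ℤ × LTree × LTree) (h : c + c' = 0) :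
    mirrorShift c' (mirrorShift c δ) = δ := by
  funext i
  simp only [mirrorShift, mirror_addLabel, mirror_mirror, addLabel_addLabel, h, addLabel_zero,
    add_assoc, add_zero]

/-- This exchanges the roles of the two sides, so that the replacement argument, written for left
trees, also serves for right trees. -/
theorem uniformData_inter_mirrorShift (x c : ℤ) {A B : Set (ℕ → ℤ × LTree × LTree)}
    (hA : MeasurableSet A) (hB : MeasurableSet B) :
    uniformData x (A ∩ mirrorShift c ⁻¹' B) =
      uniformData (x + c) (B ∩ mirrorShift (-c) ⁻¹' A) := by
  rw [← uniformData_map_mirrorShift, Measure.map_apply (measurable_mirrorShift c)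
    (hB.inter (measurable_mirrorShift _ hA)), Set.inter_comm A]
  congr 1
  ext δ
  simp [mirrorShift_mirrorShift c (-c) δ (by ring)]

theorem uniformData_firstHitAt (x c : ℤ) {M : ℤ} {T T' T₂ T₂' : Set LTree}
    (hT : MeasurableSet T) (hT' : MeasurableSet T') (hT₂ : MeasurableSet T₂)
    (hT₂' : MeasurableSet T₂') {κ κ₂ : ℝ≥0∞}
    (h : ∀ x, M ≤ x → gw x T = κ * gw x T') (h₂ : ∀ x, M ≤ x → gw x T₂ = κ₂ * gw x T₂')
    (i i₂ : ℕ) :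
    uniformData x (firstHitAt M T i ∩ mirrorShift c ⁻¹' firstHitAt M T₂ i₂) =
      κ * κ₂ * uniformData x (firstHitAt M T' i ∩ mirrorShift c ⁻¹' firstHitAt M T₂' i₂) := by
  have hm := fun {T} (hT : MeasurableSet T) i => measurableSet_firstHitAt M (T := T) hT i
  rw [uniformData_firstHitAt_left x c hT hT' hT₂ h,
    uniformData_inter_mirrorShift x c (hm hT' i) (hm hT₂ i₂),
    uniformData_firstHitAt_left (x + c) (-c) hT₂ hT₂' hT' h₂,
    ← uniformData_inter_mirrorShift x c (hm hT' i) (hm hT₂' i₂), mul_assoc]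

/-- The positions of the first hits on both sides are determined by the tree, so the events for
different pairs of positions are disjoint. -/
theorem uniformData_iUnion_firstHitAt (x c : ℤ) {M : ℤ} {T T₂ : Set LTree}
    (hT : MeasurableSet T) (hT₂ : MeasurableSet T₂) (hp : ∀ t ∈ T, ¬ t.Positive)
    (hp₂ : ∀ t ∈ T₂, ¬ t.Positive) :
    uniformData x ((⋃ i, firstHitAt M T i) ∩ mirrorShift c ⁻¹' ⋃ i, firstHitAt M T₂ i) =
      ∑' p : ℕ × ℕ, uniformData x (firstHitAt M T p.1 ∩ mirrorShift c ⁻¹' firstHitAt M T₂ p.2) := by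
  rw [← measure_iUnion]
  · congr 1
    ext δ
    simp only [Set.mem_inter_iff, Set.mem_iUnion, Set.mem_preimage, Prod.exists,
      exists_and_left, exists_and_right]
  · rintro ⟨i, i₂⟩ ⟨j, j₂⟩ hne
    refine Set.disjoint_left.2 fun δ h h' => hne ?_
    exact Prod.ext (eq_of_mem_firstHitAt hp hp h.1 h'.1) (eq_of_mem_firstHitAt hp₂ hp₂ h.2 h'.2)
  · intro p
    exact (measurableSet_firstHitAt M hT _).inter
      (measurable_mirrorShift c (measurableSet_firstHitAt M hT₂ _))

theorem compl_iUnion_firstHitAt (M : ℤ) :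
    (⋃ i, firstHitAt M {t | ¬ t.Positive} i)ᶜ = lowHit M := by
  ext δ
  simp only [Set.mem_compl_iff, Set.mem_iUnion, firstHitAt, lowHit, Set.mem_ofPred_eq, not_exists,
    not_and, not_le]
  exact forall_congr' fun i => forall_congr' fun _ => or_iff_not_imp_left.symm

/-- Union bound: the event fails only if the hit is low or absent on one of the two sides, and the
reflected side has the law started from `x + c`. -/
theorem one_sub_lowHit_le (x c M : ℤ) :
    1 - (uniformData x (lowHit M) + uniformData (x + c) (lowHit M)) ≤
      uniformData x ((⋃ i, firstHitAt M {t | ¬ t.Positive} i) ∩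
        mirrorShift c ⁻¹' ⋃ i, firstHitAt M {t | ¬ t.Positive} i) := by
  have hm : MeasurableSet (⋃ i, firstHitAt M {t | ¬ t.Positive} i) :=
    MeasurableSet.iUnion fun i => measurableSet_firstHitAt M measurableSet_positive.compl i
  have h1 := prob_compl_eq_one_sub (μ := uniformData x) (hm.inter (measurable_mirrorShift c hm)).compl
  rw [compl_compl] at h1
  rw [h1, Set.compl_inter, ← Set.preimage_compl, compl_iUnion_firstHitAt,
    ← uniformData_map_mirrorShift, Measure.map_apply (measurable_mirrorShift c)
    (measurableSet_lowHit M)]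
  exact tsub_le_tsub_left (measure_union_le _ _) 1

/-- The first left tree that is not positive is in `T`. -/
def firstHit (T : Set LTree) : Set (ℕ → ℤ × LTree × LTree) :=
  {δ | ∃ i, (∀ j < i, (δ j).2.1.Positive) ∧ (δ i).2.1 ∈ T}

theorem gw_hitSet_eq_mul {e : ℕ → ℤ × Set LTree × Set LTree}
    (hA : ∀ i, MeasurableSet (e i).2.1) (hB : ∀ i, MeasurableSet (e i).2.2) (h0 : (e 0).1 = 0)
    {n m : ℕ} (hm : (e (n + 1)).1 ≤ m) (x : ℤ) (hx : (m : ℤ) ≤ x) :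
    gw x (hitSet e (n + 1)) = limitWeight e (n + 1) * gw x {t | ¬ t.Positive} := by
  obtain ⟨z, rfl⟩ := Int.eq_ofNat_of_zero_le ((Int.natCast_nonneg m).trans hx)
  have h := gw_hitSet hA hB h0 n z (hm.trans hx)
  have hle : limitWeight e (n + 1) ≤ 1 := by
    rw [limitWeight, ← hasSpineLaw_limitData e (n + 1) hA hB]
    exact prob_le_one
  simp only [measureReal_def] at h
  rw [← ENNReal.toReal_mul, ENNReal.toReal_eq_toReal_iff' (measure_ne_top _ _)
    (ENNReal.mul_ne_top (hle.trans_lt ENNReal.one_lt_top).ne (measure_ne_top _ _))] at h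
  exact h

/-- In the sum over the positions of the two first hits, each term factors with the same constants,
by `gw_hitSet_eq_mul`. What remains is the probability that both first hits occur at labels at least
`M`, which tends to `1`. -/
theorem le_liminf_uniformData {e e' : ℕ → ℤ × Set LTree × Set LTree}
    (hA : ∀ i, MeasurableSet (e i).2.1) (hB : ∀ i, MeasurableSet (e i).2.2) (h0 : (e 0).1 = 0)
    (hA' : ∀ i, MeasurableSet (e' i).2.1) (hB' : ∀ i, MeasurableSet (e' i).2.2)
    (h0' : (e' 0).1 = 0) (n : ℕ) :
    limitWeight e (n + 1) * limitWeight e' (n + 1) ≤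
      liminf (fun k : ℕ => uniformData k (firstHit (hitSet e (n + 1)) ∩
        mirrorShift (-1) ⁻¹' firstHit (hitSet e' (n + 1)))) atTop := by
  -- `M` is above the topmost prescribed labels, which makes `gw_hitSet` exact, and it has the form
  -- `m + 1` required by `tendsto_lowHit`.
  obtain ⟨m, hm, hm'⟩ : ∃ m : ℕ, (e (n + 1)).1 ≤ (m + 1 : ℕ) ∧ (e' (n + 1)).1 ≤ (m + 1 : ℕ) :=
    ⟨((e (n + 1)).1 ⊔ (e' (n + 1)).1).toNat, by omega, by omega⟩
  set M : ℤ := ((m + 1 : ℕ) : ℤ)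
  have hT := measurableSet_hitSet hA hB (n + 1)
  have hT' := measurableSet_hitSet hA' hB' (n + 1)
  have hP : MeasurableSet {t : LTree | ¬ t.Positive} := measurableSet_positive.compl
  have hlow : ∀ k : ℕ, limitWeight e (n + 1) * limitWeight e' (n + 1) *
      (1 - (uniformData k (lowHit M) + uniformData (k + -1) (lowHit M))) ≤
      uniformData k (firstHit (hitSet e (n + 1)) ∩
        mirrorShift (-1) ⁻¹' firstHit (hitSet e' (n + 1))) := by
    intro k
    have hsub : ∀ T : Set LTree, (⋃ i, firstHitAt M T i) ⊆ firstHit T := fun T δ hδ => by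
      obtain ⟨i, hi⟩ := Set.mem_iUnion.1 hδ
      exact ⟨i, hi.1, hi.2.1⟩
    refine le_trans ?_ (measure_mono (Set.inter_subset_inter (hsub _)
      (Set.preimage_mono (hsub _))))
    rw [uniformData_iUnion_firstHitAt _ _ hT hT' (hitSet_subset e _) (hitSet_subset e' _)]
    rw [tsum_congr fun p : ℕ × ℕ => uniformData_firstHitAt k (-1) (M := M) hT hP hT' hP
      (gw_hitSet_eq_mul hA hB h0 hm) (gw_hitSet_eq_mul hA' hB' h0' hm') p.1 p.2,
      ENNReal.tsum_mul_left, ← uniformData_iUnion_firstHitAt _ _ hP hP (fun _ h => h)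
      (fun _ h => h)]
    gcongr
    exact one_sub_lowHit_le k (-1) M
  have h1 : Tendsto (fun k : ℕ => uniformData k (lowHit M)) atTop (𝓝 0) := by
    have := ENNReal.tendsto_ofReal (tendsto_lowHit m)
    simpa [M] using this
  have h2 : Tendsto (fun k : ℕ => uniformData (k + -1) (lowHit M)) atTop (𝓝 0) := by
    rw [← tendsto_add_atTop_iff_nat 1]
    simpa using h1
  have h3 : Tendsto (fun k : ℕ => limitWeight e (n + 1) * limitWeight e' (n + 1) *
      (1 - (uniformData k (lowHit M) + uniformData (k + -1) (lowHit M)))) atTop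
      (𝓝 (limitWeight e (n + 1) * limitWeight e' (n + 1) * (1 - (0 + 0)))) := by
    refine ENNReal.Tendsto.const_mul (ENNReal.Tendsto.sub tendsto_const_nhds (h1.add h2)
      (Or.inl ENNReal.one_ne_top)) (Or.inl (by simp))
  rw [add_zero, tsub_zero, mul_one] at h3
  rw [← h3.liminf_eq]
  exact liminf_le_liminf (Eventually.of_forall hlow)

/-! ### From local configurations to weak convergence. -/

/-! ### Codes for balls -/

theorem isOpen_setOf_close (d : ℕ) (t : LTree) : IsOpen {t' | Close d t t'} :=
  isOpen_of_close fun _ h => ⟨d, fun _ h' => Close.trans h h'⟩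

instance : Nonempty LTree := ⟨node 0 []⟩

theorem exists_close_denseSeq (d : ℕ) (t : LTree) :
    ∃ m, Close d t (TopologicalSpace.denseSeq LTree m) := by
  obtain ⟨_, h, m, rfl⟩ := (TopologicalSpace.denseRange_denseSeq LTree).inter_open_nonempty _
    (isOpen_setOf_close d t) ⟨t, Close.refl d t⟩
  exact ⟨m, h⟩

/-- A number that determines the labels at the generations less than `d`. -/
noncomputable def code (d : ℕ) (t : LTree) : ℕ :=
  sInf {m | Close d t (TopologicalSpace.denseSeq LTree m)}

/-- By separability, there are countably many trees up to closeness at depth `d`. Codes thus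
partition events into countably many pieces. -/
theorem code_eq_iff {d : ℕ} {t t' : LTree} : code d t = code d t' ↔ Close d t t' := by
  constructor
  · intro h
    have h1 := Nat.sInf_mem (exists_close_denseSeq d t)
    have h2 := Nat.sInf_mem (exists_close_denseSeq d t')
    change Close d t (TopologicalSpace.denseSeq LTree (code d t)) at h1
    change Close d t' (TopologicalSpace.denseSeq LTree (code d t')) at h2
    rw [h] at h1
    exact h1.trans h2.symm
  · intro h
    unfold code
    congr 1
    ext m
    exact ⟨fun h' => h.symm.trans h', fun h' => h.trans h'⟩

theorem measurableSet_code (d m : ℕ) : MeasurableSet {t | code d t = m} :=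
  measurableSet_of_close d fun _ _ h ht => (code_eq_iff.2 h.symm).trans ht

/-- Numbers that determine the labels and the first generations of the side trees at the first
spine vertices. -/
noncomputable def dataCode (n : ℕ) (δ : ℕ → ℤ × LTree × LTree) (i : Fin (n + 2)) : ℤ × ℕ × ℕ :=
  ((δ i).1, code (n + 1) (δ i).2.1, code (n + 1) (δ i).2.2)

/-- The specifications that correspond to given codes. -/
def codeSpec {n : ℕ} (c : Fin (n + 2) → ℤ × ℕ × ℕ) (i : ℕ) : ℤ × Set LTree × Set LTree :=
  if h : i < n + 2 then ((c ⟨i, h⟩).1, {t | code (n + 1) t = (c ⟨i, h⟩).2.1},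
    {t | code (n + 1) t = (c ⟨i, h⟩).2.2}) else (0, Set.univ, Set.univ)

theorem measurableSet_codeSpec {n : ℕ} (c : Fin (n + 2) → ℤ × ℕ × ℕ) (i : ℕ) :
    MeasurableSet (codeSpec c i).2.1 ∧ MeasurableSet (codeSpec c i).2.2 := by
  unfold codeSpec
  split_ifs
  · exact ⟨measurableSet_code _ _, measurableSet_code _ _⟩
  · exact ⟨.univ, .univ⟩

theorem fits_codeSpec_iff {n : ℕ} {c : Fin (n + 2) → ℤ × ℕ × ℕ} (i : Fin (n + 2))
    {d : ℤ × LTree × LTree} :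
    Fits (codeSpec c i) d ↔ (d.1, code (n + 1) d.2.1, code (n + 1) d.2.2) = c i := by
  rw [codeSpec, dif_pos i.2]
  simp [Fits, Prod.ext_iff]

theorem forall_fits_codeSpec_iff {n : ℕ} {c : Fin (n + 2) → ℤ × ℕ × ℕ}
    {δ : ℕ → ℤ × LTree × LTree} :
    (∀ i ≤ n + 1, Fits (codeSpec c i) (δ i)) ↔ dataCode n δ = c := by
  rw [funext_iff]
  constructor
  · intro h i
    exact (fits_codeSpec_iff i).1 (h i (by omega))
  · intro h i hi
    exact (fits_codeSpec_iff ⟨i, by omega⟩).2 (h ⟨i, by omega⟩)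

theorem eq_of_mem_hitSet_codeSpec {n : ℕ} {c c' : Fin (n + 2) → ℤ × ℕ × ℕ} {t : LTree}
    (h : t ∈ hitSet (codeSpec c) (n + 1)) (h' : t ∈ hitSet (codeSpec c') (n + 1)) : c = c' := by
  funext i
  obtain ⟨d, hd, hd'⟩ := exists_fits_of_mem_hitSet h h' i (by omega)
  exact ((fits_codeSpec_iff i).1 hd).symm.trans ((fits_codeSpec_iff i).1 hd')

theorem exists_eq_revList {α : Type*} [Nonempty α] {n : ℕ} {l : List α} (h : l.length = n + 1) :
    ∃ f, l = revList f n := by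
  induction n generalizing l with
  | zero =>
    obtain ⟨a, rfl⟩ := List.length_eq_one_iff.1 h
    exact ⟨fun _ => a, rfl⟩
  | succ n ih =>
    cases l with
    | nil => simp at h
    | cons a l =>
      obtain ⟨f, rfl⟩ := ih (l := l) (by simpa using h)
      refine ⟨fun i => if i ≤ n then f i else a, ?_⟩
      rw [revList, if_neg (by omega), List.cons.injEq]
      refine ⟨rfl, List.forall₂_eq_eq_eq ▸ (forall₂_revList (r := Eq)).2 fun i hi => ?_⟩
      rw [if_pos hi]

theorem plug_revList_glue (δ : ℕ → ℤ × LTree × LTree) (n : ℕ) :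
    plug (revList δ n) [glue fun i => δ (n + 1 + i)] = [glue δ] := by
  have h := plug_revList (s := fun i => (δ i).1) (L := fun i => (δ i).2.1) (R := fun i => (δ i).2.2)
    (isChain_glue δ) n
  simpa using h

theorem close_glue_of_dataCode {n : ℕ} {δ δ' : ℕ → ℤ × LTree × LTree}
    (h : dataCode n δ = dataCode n δ') : Close (n + 1) (glue δ) (glue δ') := by
  refine close_of_plug (forall₂_revList.2 fun i hi => ?_) (by simp [revList])
    (by rw [length_revList]; omega) (plug_revList_glue δ (n + 1)) (plug_revList_glue δ' (n + 1))
  have := congrFun h ⟨i, by omega⟩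
  simp only [dataCode, Prod.mk.injEq] at this
  exact ⟨this.1, code_eq_iff.1 this.2.1, code_eq_iff.1 this.2.2⟩

/-- The lower end of the ancestral line, read from the zero upwards, is the start of the new spine.
It is extended arbitrarily to a sequence `δ'`, whose later terms lie too deep to be seen. -/
theorem exists_dataCode_close_firstZero {n : ℕ} {c : Fin (n + 2) → ℤ × ℕ × ℕ}
    {δ : ℕ → ℤ × LTree × LTree} (hδ : GoodData δ)
    (h : δ ∈ firstHit (hitSet (codeSpec c) (n + 1))) :
    ∃ δ', dataCode n δ' = c ∧ Close (n + 1) (glue δ).firstZero (glue δ') := by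
  obtain ⟨i, hpos, l1, l2, hl, hf⟩ := h
  obtain ⟨Qs, hQ⟩ := exists_plug_eq_firstZero_of_hitDec (isChain_glue δ) hδ.left_root
    hδ.left_finite hpos hl
  have hlen : l2.length = n + 2 := by rw [← hf.length_eq, length_revList]
  obtain ⟨δ', rfl⟩ := exists_eq_revList hlen
  refine ⟨δ', forall_fits_codeSpec_iff.1 (forall₂_revList.1 hf), ?_⟩
  rw [plug_append] at hQ
  have hQ' : plug (revList δ' (n + 1)) (plug l1 Qs) = [(glue δ).firstZero] := by simpa using hQ
  exact close_of_plug (forall₂_revList.2 fun i _ => ⟨rfl, Close.refl _ _, Close.refl _ _⟩)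
    (by simp [revList]) (by rw [length_revList]; omega) hQ' (plug_revList_glue δ' (n + 1))

/-! ### Lower bound on open sets -/

/-- Fatou's lemma for the counting measure on the index set. -/
theorem tsum_le_liminf_measure_iUnion {α ι : Type*} [MeasurableSpace α] [Countable ι]
    {m : ℕ → Measure α} {A : ι → Set α} (hA : ∀ i, MeasurableSet (A i))
    (hd : Pairwise (Function.onFun Disjoint A)) {a : ι → ℝ≥0∞}
    (h : ∀ i, a i ≤ liminf (fun k => m k (A i)) atTop) :
    ∑' i, a i ≤ liminf (fun k => m k (⋃ i, A i)) atTop := by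
  let _ : MeasurableSpace ι := ⊤
  have : MeasurableSingletonClass ι := ⟨fun _ => trivial⟩
  have h1 := lintegral_liminf_le (μ := (Measure.count : Measure ι)) (u := atTop)
    (f := fun k i => m k (A i)) fun k => measurable_from_top
  simp only [lintegral_count] at h1
  simp only [measure_iUnion hd hA]
  exact (ENNReal.tsum_le_tsum h).trans h1

theorem measurableSet_firstHit {T : Set LTree} (hT : MeasurableSet T) :
    MeasurableSet (firstHit T) := by
  have : firstHit T = ⋃ i : ℕ, (⋂ j : ℕ, ⋂ _ : j < i, {δ | (δ j).2.1.Positive}) ∩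
      {δ | (δ i).2.1 ∈ T} := by
    ext δ; simp [firstHit]
  rw [this]
  exact MeasurableSet.iUnion fun i => (MeasurableSet.iInter fun j => MeasurableSet.iInter fun _ =>
    measurable_spineLeft j measurableSet_positive).inter (measurable_spineLeft i hT)

/-- The first left tree that is not positive is determined by `δ`, and the ancestral line of its
first zero is unique. -/
theorem disjoint_firstHit_codeSpec {n : ℕ} {c c' : Fin (n + 2) → ℤ × ℕ × ℕ}
    {δ : ℕ → ℤ × LTree × LTree} (h : δ ∈ firstHit (hitSet (codeSpec c) (n + 1)))
    (h' : δ ∈ firstHit (hitSet (codeSpec c') (n + 1))) : c = c' := by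
  obtain ⟨i, hi, h⟩ := h
  obtain ⟨i', hi', h'⟩ := h'
  obtain rfl : i = i' := by
    rcases lt_trichotomy i i' with hlt | heq | hgt
    · exact absurd (hi' i hlt) (hitSet_subset _ _ h)
    · exact heq
    · exact absurd (hi i' hgt) (hitSet_subset _ _ h')
  exact eq_of_mem_hitSet_codeSpec h h'

/-- The pairs of codes that guarantee that the trees are in `G`. -/
def goodCodes (G : Set (LTree × LTree)) (n : ℕ) :
    Set ((Fin (n + 2) → ℤ × ℕ × ℕ) × (Fin (n + 2) → ℤ × ℕ × ℕ)) :=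
  {p | ∀ δ δ', dataCode n δ = p.1 → dataCode n δ' = p.2 → ∀ t t', Close (n + 1) t (glue δ) →
    Close (n + 1) t' (glue δ') → (t, t') ∈ G}

theorem limitData_dataCode {n : ℕ} (c : Fin (n + 2) → ℤ × ℕ × ℕ) :
    limitData {δ | dataCode n δ = c} = limitWeight (codeSpec c) (n + 1) := by
  simp only [← forall_fits_codeSpec_iff]
  exact hasSpineLaw_limitData _ _ (fun i => (measurableSet_codeSpec c i).1)
    (fun i => (measurableSet_codeSpec c i).2)

/-- The trees re-rooted at the first vertex with label `0` and at the last vertex with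
label `1`, the latter up to mirror symmetry and a translation of labels. -/
noncomputable def zeroPair (δ : ℕ → ℤ × LTree × LTree) : LTree × LTree :=
  ((glue δ).firstZero, (glue (mirrorShift (-1) δ)).firstZero)

theorem measurable_zeroPair : Measurable zeroPair :=
  (measurable_firstZero.comp measurable_glue).prodMk
    (measurable_firstZero.comp (measurable_glue.comp (measurable_mirrorShift (-1))))

theorem goodData_mirrorShift (x c : ℤ) : ∀ᵐ δ ∂(uniformData x), GoodData (mirrorShift c δ) := by
  have h := goodData_uniformData (x + c)
  rw [← uniformData_map_mirrorShift] at h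
  exact (ae_of_ae_map (measurable_mirrorShift c).aemeasurable h).mono fun _ h => h.1

/-- The good pairs of codes are countable in number. Each has a limiting probability in product
form, bounded by a lower limit for the uniform tree; the corresponding events are disjoint, and up
to a null set they imply that the re-rooted pair is in `G`. -/
theorem goodCodes_le_liminf (G : Set (LTree × LTree)) (n : ℕ) :
    (limitData.prod limitData) {p | (dataCode n p.1, dataCode n p.2) ∈ goodCodes G n} ≤
      liminf (fun k : ℕ => uniformData k (zeroPair ⁻¹' G)) atTop := by
  have h1 : {p : (ℕ → ℤ × LTree × LTree) × (ℕ → ℤ × LTree × LTree) |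
      (dataCode n p.1, dataCode n p.2) ∈ goodCodes G n} =
      ⋃ q : goodCodes G n, {δ | dataCode n δ = q.1.1} ×ˢ {δ | dataCode n δ = q.1.2} := by
    ext p
    simp
  have h2 : (limitData.prod limitData) {p | (dataCode n p.1, dataCode n p.2) ∈ goodCodes G n} ≤
      ∑' q : goodCodes G n,
        limitWeight (codeSpec q.1.1) (n + 1) * limitWeight (codeSpec q.1.2) (n + 1) := by
    rw [h1]
    refine (measure_iUnion_le _).trans (le_of_eq (tsum_congr fun q => ?_))
    rw [Measure.prod_prod, limitData_dataCode, limitData_dataCode]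
  let T : (Fin (n + 2) → ℤ × ℕ × ℕ) → Set LTree := fun c => hitSet (codeSpec c) (n + 1)
  have hT : ∀ c, MeasurableSet (firstHit (T c)) := fun c => measurableSet_firstHit
    (measurableSet_hitSet (fun i => (measurableSet_codeSpec c i).1)
      (fun i => (measurableSet_codeSpec c i).2) (n + 1))
  refine h2.trans ((tsum_le_liminf_measure_iUnion (m := fun k : ℕ => uniformData k)
    (A := fun q : goodCodes G n => firstHit (T q.1.1) ∩ mirrorShift (-1) ⁻¹' firstHit (T q.1.2))
    (fun q => (hT _).inter (measurable_mirrorShift (-1) (hT _))) ?_ fun q => ?_).trans ?_)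
  · intro q q' hne
    refine Set.disjoint_left.2 fun δ h h' => hne (Subtype.ext (Prod.ext ?_ ?_))
    · exact disjoint_firstHit_codeSpec h.1 h'.1
    · exact disjoint_firstHit_codeSpec h.2 h'.2
  · have hm := measurableSet_codeSpec q.1.1
    have hm' := measurableSet_codeSpec q.1.2
    by_cases h0 : limitWeight (codeSpec q.1.1) (n + 1) = 0
    · rw [h0, zero_mul]; exact zero_le
    by_cases h0' : limitWeight (codeSpec q.1.2) (n + 1) = 0
    · rw [h0', mul_zero]; exact zero_le
    exact le_liminf_uniformData (fun i => (hm i).1) (fun i => (hm i).2)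
      (le_of_limitWeight_ne_zero h0).1 (fun i => (hm' i).1) (fun i => (hm' i).2)
      (le_of_limitWeight_ne_zero h0').1 n
  · refine liminf_le_liminf (Eventually.of_forall fun k => measure_mono_ae ?_)
    filter_upwards [goodData_uniformData k, goodData_mirrorShift k (-1)] with δ hδ hδ' h
    obtain ⟨q, hq, hq'⟩ := Set.mem_iUnion.1 h
    obtain ⟨δ₁, hc, h3⟩ := exists_dataCode_close_firstZero hδ.1 hq
    obtain ⟨δ₂, hc', h4⟩ := exists_dataCode_close_firstZero hδ' hq'
    exact q.2 δ₁ δ₂ hc hc' _ _ h3 h4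

theorem eventually_mem_goodCodes {G : Set (LTree × LTree)} (hG : IsOpen G)
    {δ δ' : ℕ → ℤ × LTree × LTree} (h : (glue δ, glue δ') ∈ G) :
    ∀ᶠ n in atTop, (dataCode n δ, dataCode n δ') ∈ goodCodes G n := by
  obtain ⟨U, V, hU, hV, h1, h2, hUV⟩ := isOpen_prod_iff.1 hG _ _ h
  obtain ⟨d, hd⟩ := exists_close_of_isOpen hU h1
  obtain ⟨d', hd'⟩ := exists_close_of_isOpen hV h2
  filter_upwards [eventually_ge_atTop (max d d')] with n hn δ₁ δ₂ hc hc' t t' ht ht'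
  have h3 := (ht.trans (close_glue_of_dataCode hc)).symm
  have h4 := (ht'.trans (close_glue_of_dataCode hc')).symm
  exact hUV ⟨hd t (h3.mono (by omega)), hd' t' (h4.mono (by omega))⟩

theorem prod_le_liminf {G : Set (LTree × LTree)} (hG : IsOpen G) :
    ((limitData.map glue).prod (limitData.map glue)) G ≤
      liminf (fun k : ℕ => ((uniformData k).map zeroPair) G) atTop := by
  rw [Measure.map_prod_map _ _ measurable_glue measurable_glue,
    Measure.map_apply (measurable_glue.prodMap measurable_glue) hG.measurableSet]
  simp only [Measure.map_apply measurable_zeroPair hG.measurableSet]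
  -- Asking for good codes at all levels from `r` on makes these sets increasing in `r`, so that
  -- continuity from below applies.
  let S : ℕ → Set ((ℕ → ℤ × LTree × LTree) × (ℕ → ℤ × LTree × LTree)) := fun r =>
    {p | ∀ n ≥ r, (dataCode n p.1, dataCode n p.2) ∈ goodCodes G n}
  have hS : Monotone S := fun r r' hr p hp n hn => hp n (hr.trans hn)
  have hsub : Prod.map glue glue ⁻¹' G ⊆ ⋃ r, S r := fun p hp => by
    obtain ⟨r, hr⟩ := eventually_atTop.1 (eventually_mem_goodCodes hG hp)
    exact Set.mem_iUnion.2 ⟨r, hr⟩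
  refine (measure_mono hsub).trans ?_
  rw [hS.measure_iUnion]
  exact iSup_le fun r =>
    (measure_mono fun p (hp : p ∈ S r) => hp r le_rfl).trans (goodCodes_le_liminf G r)

/-! ### Re-rooting the uniform infinite tree -/

/-- Adding `k - 1` sends the target label `-k + 1` to `0`; the missing unit is restored after the
reflection. -/
theorem rerootLeft_eq (k : ℕ) (t : LTree) :
    t.rerootLeft k = ((t.mirror.addLabel (k - 1)).firstZero).mirror.addLabel 1 := by
  have : t.lastCornerBefore (-k + 1) = (t.mirror.addLabel (k - 1)).firstCornerAfter 0 := by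
    rw [lastCornerBefore, firstCornerAfter]
    congr 1; ext n
    simp only [Set.mem_ofPred_eq, prevCorner_iterate, rootLabel_mirror, nextCorner_iterate_addLabel,
      rootLabel_addLabel]
    omega
  rw [rerootLeft, this, prevCorner_iterate, firstZero, nextCorner_iterate_addLabel, mirror_addLabel,
    addLabel_addLabel, sub_add_cancel]

theorem measurable_reroot (k : ℕ) : Measurable fun t : LTree => (t.rerootRight k, t.rerootLeft k) := by
  simp only [rerootRight_eq, rerootLeft_eq]
  have h := fun c : ℤ => (continuous_addLabel c).measurable
  have hm := continuous_mirror.measurable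
  exact (measurable_firstZero.comp (h k)).prodMk
    ((h 1).comp (hm.comp (measurable_firstZero.comp ((h _).comp hm))))

/-- The mirror image of the second tree, with labels increased by `1`. -/
noncomputable def mirrorSnd (p : LTree × LTree) : LTree × LTree := (p.1, p.2.mirror.addLabel 1)

theorem continuous_mirrorSnd : Continuous mirrorSnd :=
  continuous_fst.prodMk ((continuous_addLabel 1).comp (continuous_mirror.comp continuous_snd))

theorem map_reroot (k : ℕ) :
    ((uniformData 0).map glue).map (fun t : LTree => (t.rerootRight k, t.rerootLeft k)) =
      ((uniformData k).map zeroPair).map mirrorSnd := by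
  -- A single `mirrorShift` also reflects the tree. Two of them amount to the translation of labels
  -- by `k`.
  have h1 : uniformData k = ((uniformData 0).map (mirrorShift k)).map (mirrorShift 0) := by
    rw [uniformData_map_mirrorShift, uniformData_map_mirrorShift, zero_add, add_zero]
  have hs := measurable_mirrorShift
  rw [h1, Measure.map_map (hs 0) (hs k), Measure.map_map measurable_zeroPair ((hs 0).comp (hs k)),
    Measure.map_map continuous_mirrorSnd.measurable
      (measurable_zeroPair.comp ((hs 0).comp (hs k))),
    Measure.map_map (measurable_reroot k) measurable_glue]
  congr 1
  funext δ
  simp only [Function.comp_apply, zeroPair, mirrorSnd, glue_mirrorShift, mirror_addLabel,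
    mirror_mirror, addLabel_addLabel, rerootRight_eq, rerootLeft_eq, add_zero,
    sub_eq_add_neg]

instance (x : ℤ) : IsProbabilityMeasure ((uniformData x).map glue) :=
  Measure.isProbabilityMeasure_map measurable_glue.aemeasurable

instance : IsProbabilityMeasure (limitData.map glue) :=
  Measure.isProbabilityMeasure_map measurable_glue.aemeasurable

theorem measurable_mirror_addLabel (c : ℤ) : Measurable fun t : LTree => t.mirror.addLabel c :=
  ((continuous_addLabel c).comp continuous_mirror).measurable

instance (ν : Measure LTree) [IsProbabilityMeasure ν] :
    IsProbabilityMeasure (ν.map fun t => t.mirror.addLabel 1) :=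
  Measure.isProbabilityMeasure_map (measurable_mirror_addLabel 1).aemeasurable

/-- Portmanteau theorem: for probability measures, the lower bound on open sets is enough. -/
theorem tendsto_map_zeroPair : Tendsto (β := ProbabilityMeasure (LTree × LTree))
    (fun k : ℕ => ⟨(uniformData k).map zeroPair,
      Measure.isProbabilityMeasure_map measurable_zeroPair.aemeasurable⟩) atTop
    (𝓝 ⟨(limitData.map glue).prod (limitData.map glue), inferInstance⟩) :=
  tendsto_of_forall_isOpen_le_liminf' fun _ hG => prod_le_liminf hG

theorem tendstoInDistribution_reroot {Ω Ω' : Type*} [MeasurableSpace Ω] [MeasurableSpace Ω']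
    {P : Measure Ω} {P' : Measure Ω'} [IsProbabilityMeasure P] [IsProbabilityMeasure P']
    {θ : Ω → LTree} {θR θL : Ω' → LTree} (hθ : HasLaw θ ((uniformData 0).map glue) P)
    (hR : HasLaw θR (limitData.map glue) P')
    (hL : HasLaw θL ((limitData.map glue).map fun t => t.mirror.addLabel 1) P')
    (h : IndepFun θR θL P') :
    TendstoInDistribution (fun (k : ℕ) ω => ((θ ω).rerootRight k, (θ ω).rerootLeft k)) atTop
      (fun ω => (θR ω, θL ω)) (fun _ => P) P' where
  forall_aemeasurable k := (measurable_reroot k).comp_aemeasurable hθ.aemeasurable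
  aemeasurable_limit := hR.aemeasurable.prodMk hL.aemeasurable
  tendsto := by
    -- The convergence holds for the pair with its second tree reflected and lowered by one; the
    -- continuous map `mirrorSnd` undoes this.
    have h1 := ProbabilityMeasure.tendsto_map_of_tendsto_of_continuous _ _ tendsto_map_zeroPair
      continuous_mirrorSnd
    have h2 : P'.map (fun ω => (θR ω, θL ω)) =
        ((limitData.map glue).prod (limitData.map glue)).map mirrorSnd := by
      have := Measure.map_prod_map (limitData.map glue) (limitData.map glue) measurable_id
        (measurable_mirror_addLabel 1)
      rw [Measure.map_id] at this
      rw [(indepFun_iff_map_prod_eq_prod_map_map hR.aemeasurable hL.aemeasurable).1 h, hR.map_eq,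
        hL.map_eq]
      exact this
    refine (congrArg (fun x : ProbabilityMeasure (LTree × LTree) => Tendsto _ atTop (𝓝 x))
      (Subtype.ext h2)).mpr
      (h1.congr fun k => Subtype.ext ?_)
    change _ = P.map ((fun t : LTree => (t.rerootRight k, t.rerootLeft k)) ∘ θ)
    rw [← AEMeasurable.map_map_of_aemeasurable (measurable_reroot k).aemeasurable
      hθ.aemeasurable, hθ.map_eq, map_reroot]
    rfl

end LTree

theorem mainTheorem1 :
    ∃ μ μR μL : ProbabilityMeasure LTree,
      (∀ ν : ProbabilityMeasure LTree, IsUniformInfiniteLaw ν ↔ ν = μ) ∧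
      (∀ ν : ProbabilityMeasure LTree, IsRightLimitLaw ν ↔ ν = μR) ∧
      (∀ ν : ProbabilityMeasure LTree, IsLeftLimitLaw μR ν ↔ ν = μL) ∧
      ∀ (Ω Ω' : Type*) [MeasurableSpace Ω] [MeasurableSpace Ω'] (P : Measure Ω) (P' : Measure Ω')
        [IsProbabilityMeasure P] [IsProbabilityMeasure P']
        (θ : Ω → LTree) (θR θL : Ω' → LTree),
        HasLaw θ μ P → HasLaw θR μR P' → HasLaw θL μL P' → IndepFun θR θL P' →
        TendstoInDistribution (fun (k : ℕ) ω => ((θ ω).rerootRight k, (θ ω).rerootLeft k)) atTop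
          (fun ω => (θR ω, θL ω)) (fun _ => P) P' := by
  refine ⟨⟨(uniformData 0).map glue, inferInstance⟩, ⟨limitData.map glue, inferInstance⟩,
    ⟨(limitData.map glue).map fun t => t.mirror.addLabel 1, inferInstance⟩, fun ν => ?_, fun ν => ?_,
    fun ν => ?_, fun Ω Ω' _ _ P P' _ _ θ θR θL hθ hR hL h => ?_⟩
  · exact ⟨fun h => Subtype.ext ((isUniformInfiniteLaw_iff ν).1 h),
      fun h => (isUniformInfiniteLaw_iff ν).2 (h ▸ rfl)⟩
  · exact ⟨fun h => Subtype.ext ((isRightLimitLaw_iff ν).1 h),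
      fun h => (isRightLimitLaw_iff ν).2 (h ▸ rfl)⟩
  · exact ⟨fun h => Subtype.ext ((isLeftLimitLaw_iff ν).1 h),
      fun h => (isLeftLimitLaw_iff ν).2 (h ▸ rfl)⟩
  · exact tendstoInDistribution_reroot hθ hR hL h
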